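/- Let $R$ be a simple polygon in the plane with vertices in general position (no three of them collinear). A vertex of a simple polygon is called convex (a corner) or reflex according to whether the angle spanned by its two incident edges and facing the interior is smaller or larger than $\pi$. A pseudo-triangle is a simple polygon with exactly three convex vertices. A pseudo-triangulation of $R$ is a subdivision of the interior of $R$ into pseudo-triangles that uses only the vertices of $R$; that is, a non-crossing straight-line graph on the vertices of $R$ that contains all edges of $R$, all of whose other edges are diagonals running through the interior of $R$, and all of whose bounded faces are pseudo-triangles. A vertex is pointed in such a graph if two cyclically consecutive edges at it span an angle larger than $\pi$, and non-pointed otherwise. For a set $V$ of reflex vertices of $R$, let $PT(V)$ denote the set of pseudo-triangulations of $R$ in which every vertex of $V$ is pointed and every reflex vertex of $R$ not in $V$ is non-pointed. Then for every set $V$ of reflex vertices of $R$ and every $p_0\in V$, $$|PT(V)|\;\le\; 2\,|PT(V\setminus\{p_0\})| .$$ -/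

import Mathlib

open Filter Topology

/-! The Euclidean plane is identified with `ℂ`.  A closed polygonal curve is a Mathlib
`Polygon ℂ n`: its vertices are `P i`, `i : Fin n`, and its edges join `P i` to
`P (finRotate n i)`, the cyclically next vertex. -/

namespace Polygon

variable {n : ℕ}

/-- `P` is a simple polygon: a non-crossing straight-line embedding of a cycle of length `≥ 3`.
Vertices are distinct, consecutive edges share only their common vertex, and edges without a
common end vertex are disjoint as closed segments. -/
structure IsSimple (P : Polygon ℂ n) : Prop where
  three_le : 3 ≤ n
  injective : Function.Injective P.vertices
  consecutive : ∀ i : Fin n,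
    P.edgeSet ℝ i ∩ P.edgeSet ℝ (finRotate n i) = {P (finRotate n i)}
  nonconsecutive : ∀ i j : Fin n, i ≠ j → j ≠ finRotate n i → i ≠ finRotate n j →
    Disjoint (P.edgeSet ℝ i) (P.edgeSet ℝ j)

/-- The total signed angle under which the closed polygonal curve `P` is seen from `z`, i.e. `2π`
times the winding number of `P` around `z` (for `z` not on the curve, each summand is the signed
angle, in `(-π, π)`, swept along one edge). -/
noncomputable def windingAngle (P : Polygon ℂ n) (z : ℂ) : ℝ :=
  ∑ i : Fin n, Complex.arg ((P (finRotate n i) - z) / (P i - z))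

/-- The (open) interior region of a polygon: the points off the boundary around which the polygon
has non-zero winding number. -/
def inside (P : Polygon ℂ n) : Set ℂ :=
  {z | z ∉ P.boundary ℝ ∧ P.windingAngle z ≠ 0}

/-- The two vectors from the `i`-th vertex to its two neighbours, added up: when the two incident
edges are not collinear, this vector points strictly inside the one of the two sectors between them
that has angle `< π`, and its negative points strictly inside the sector of angle `> π`. -/
noncomputable def sectorVector (P : Polygon ℂ n) (i : Fin n) : ℂ :=
  (P ((finRotate n).symm i) - P i) + (P (finRotate n i) - P i)

/-- The two edges at the `i`-th vertex span a straight (or zero) angle. -/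
def IsDegenerateVertex (P : Polygon ℂ n) (i : Fin n) : Prop :=
  Collinear ℝ {P ((finRotate n).symm i), P i, P (finRotate n i)}

/-- Convex vertex (corner): the angle spanned by the two incident edges that faces the interior
region is strictly smaller than `π`. -/
def IsConvexVertex (P : Polygon ℂ n) (i : Fin n) : Prop :=
  ¬ P.IsDegenerateVertex i ∧
    ∀ᶠ ε : ℝ in 𝓝[>] 0, P i + (ε : ℂ) * P.sectorVector i ∈ P.inside

/-- Reflex vertex: the angle spanned by the two incident edges that faces the interior region is
strictly larger than `π`. -/
def IsReflexVertex (P : Polygon ℂ n) (i : Fin n) : Prop :=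
  ¬ P.IsDegenerateVertex i ∧
    ∀ᶠ ε : ℝ in 𝓝[>] 0, P i - (ε : ℂ) * P.sectorVector i ∈ P.inside

/-- Pseudo-triangle: a simple polygon with exactly three corners. -/
def IsPseudoTriangle (P : Polygon ℂ n) : Prop :=
  P.IsSimple ∧ {i : Fin n | P.IsConvexVertex i}.ncard = 3

/-- General position: no three of the vertices are collinear. -/
def InGeneralPosition (P : Polygon ℂ n) : Prop :=
  ∀ i j k : Fin n, i ≠ j → i ≠ k → j ≠ k → ¬ Collinear ℝ {P i, P j, P k}

/-! ### Geometric graphs on the vertices of a polygon -/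

/-- The straight-line drawing of the graph `G` on the vertices of `R`: the union of its edges. -/
def drawing (R : Polygon ℂ n) (G : SimpleGraph (Fin n)) : Set ℂ :=
  {z | ∃ i j : Fin n, G.Adj i j ∧ z ∈ segment ℝ (R i) (R j)}

/-- The drawing of `G` is non-crossing: edges without a common end vertex are disjoint closed
segments. -/
def IsNonCrossing (R : Polygon ℂ n) (G : SimpleGraph (Fin n)) : Prop :=
  ∀ i j k l : Fin n, G.Adj i j → G.Adj k l → i ≠ k → i ≠ l → j ≠ k → j ≠ l →
    Disjoint (segment ℝ (R i) (R j)) (segment ℝ (R k) (R l))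

/-- The polygon traced by a cyclic sequence `c` of vertices of `R`. -/
def trace {k : ℕ} (R : Polygon ℂ n) (c : Fin k → Fin n) : Polygon ℂ k :=
  ⟨fun i => R (c i)⟩

/-- The cyclic sequence `c` of vertices bounds a face of (the drawing of) `G` which is a
pseudo-triangle: it is a cycle of `G`, its polygon is a pseudo-triangle, and the interior of that
pseudo-triangle contains no point of the drawing. -/
structure IsPseudoTriangularFace {k : ℕ} (R : Polygon ℂ n) (G : SimpleGraph (Fin n))
    (c : Fin k → Fin n) : Prop where
  adj : ∀ i : Fin k, G.Adj (c i) (c (finRotate k i))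
  isPseudoTriangle : (R.trace c).IsPseudoTriangle
  empty : Disjoint (R.trace c).inside (R.drawing G)

/-- `G` is (the edge graph of) a pseudo-triangulation of the simple polygon `R`: a non-crossing
geometric graph on the vertices of `R`, consisting of the edges of `R` and of diagonals through the
interior of `R`, that subdivides the interior of `R` into pseudo-triangles. -/
structure IsPseudoTriangulation (R : Polygon ℂ n) (G : SimpleGraph (Fin n)) : Prop where
  boundary_adj : ∀ i : Fin n, G.Adj i (finRotate n i)
  nonCrossing : R.IsNonCrossing G
  diagonal : ∀ i j : Fin n, G.Adj i j → j ≠ finRotate n i → i ≠ finRotate n j →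
    openSegment ℝ (R i) (R j) ⊆ R.inside
  subdivides : ∀ z ∈ R.inside, z ∉ R.drawing G →
    ∃ (k : ℕ) (c : Fin k → Fin n), R.IsPseudoTriangularFace G c ∧ z ∈ (R.trace c).inside

/-- The angle, in `(0, 2π]`, by which the ray from `v` through `a` has to be turned
counterclockwise to reach the ray from `v` through `b` (a full turn if the rays coincide). -/
noncomputable def ccwAngle (v a b : ℂ) : ℝ :=
  toIocMod Real.two_pi_pos 0 (Complex.arg ((b - v) / (a - v)))

/-- The vertex `v` is pointed in the drawing of `G`: some pair of consecutive edges `va`, `vb` in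
the counterclockwise cyclic order around `v` spans an angle larger than `π`. -/
def IsPointed (R : Polygon ℂ n) (G : SimpleGraph (Fin n)) (v : Fin n) : Prop :=
  ∃ a b : Fin n, G.Adj v a ∧ G.Adj v b ∧
    (∀ w : Fin n, G.Adj v w → ccwAngle (R v) (R a) (R b) ≤ ccwAngle (R v) (R a) (R w)) ∧
    Real.pi < ccwAngle (R v) (R a) (R b)

/-- `PT(V)`: the pseudo-triangulations of `R` in which the reflex vertices of `R` belonging to `V`
are pointed and the remaining reflex vertices of `R` are non-pointed. -/
def PT (R : Polygon ℂ n) (V : Finset (Fin n)) : Set (SimpleGraph (Fin n)) :=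
  {G | R.IsPseudoTriangulation G ∧ ∀ i : Fin n, R.IsReflexVertex i → (R.IsPointed G i ↔ i ∈ V)}

end Polygon

/-! Let `p` be the prescribed vertex. In a pseudo-triangulation `G` in which `p` is pointed and
reflex, some face has `p` as a reflex vertex (`Subdivision.exists_face`). The heart of the argument
is that this pseudo-triangle has an interior diagonal `pt` for which `t`, unless it is a corner of
the face, stays reflex in one of the two parts (`Oriented.exists_good`). Counting corners, both
parts are then pseudo-triangles and `p` is a corner of both (`Oriented.cut_good`). Adding `pt`
therefore gives another pseudo-triangulation; it destroys pointedness at `p`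
(`not_pointed_sup_edge`), preserves it at `t` (`Pointed.sup_edge`) and changes nothing elsewhere
(`exists_sup_edge`).

The map `G ↦ G + pt` has fibres of size at most two. Suppose three graphs had the same image `H`.
Then `H` has three edges at `p`, each of which makes `p` pointed when it is removed; moreover a
boundary edge at `p` belongs to all three graphs. Four such directions, with the corresponding half
planes, cannot exist in the plane (`three_half_planes`).

To find the diagonal, start from any diagonal `pq` of the face. If it is unsuitable, then `q` is
reflex in the face and a corner of both parts. The corner count leaves two possibilities: either `p`
is still reflex in one part, which is again a pseudo-triangle, and induction applies; or `p` is a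
corner of both parts, which have four and three corners. In the second case
(`Oriented.exists_good_of_four`) the part with four corners is trimmed by diagonals that avoid `q`
(`Oriented.exists_fan`, `Oriented.exists_idiag_avoiding`), and the first vertex after `p` on the
trimmed boundary is either a suitable choice of `t` or starts a smaller instance.

The planar topology rests on the total signed angle `wind`. A simple polygon is `Oriented` if this
angle takes only the values `0` and `2πσ` for one sign `σ`. `Simple.oriented` proves this by
induction: every polygon with at least four vertices has a diagonal that misses its boundary
(`Simple.exists_region`), the angle is additive under cutting (`wind_cut`), and a ray parallel to
the diagonal controls how the two parts lie (`no_pocket`). The local behaviour at vertices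
(`Oriented.sector`), cutting along interior diagonals (`Oriented.cut`) and connectedness of the
interior follow from it. -/

namespace PlanarCycle

/-! ### Cyclic sequences and their directed edges -/

section Lists

variable {ι : Type*}

/-- The directed edges of the path that starts at `a` and continues through the list. -/
def path : ι → List ι → List (ι × ι)
  | _, [] => []
  | a, b :: l => (a, b) :: path b l

/-- The directed edges of a cyclic sequence. -/
def cyc : List ι → List (ι × ι)
  | [] => []
  | a :: l => path a (l ++ [a])

theorem path_append (a : ι) (l₁ : List ι) (q : ι) (l₂ : List ι) :
    path a (l₁ ++ q :: l₂) = path a (l₁ ++ [q]) ++ path q l₂ := by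
  induction l₁ generalizing a with
  | nil => simp [path]
  | cons b l ih => simp [path, ih]

theorem cyc_split (u : ι) (l₁ : List ι) (w : ι) (l₂ : List ι) :
    cyc (u :: l₁ ++ w :: l₂) = path u (l₁ ++ [w]) ++ path w (l₂ ++ [u]) := by
  simp only [cyc, List.cons_append, List.append_assoc]
  exact path_append u l₁ w (l₂ ++ [u])

theorem cyc_left (u : ι) (l₁ : List ι) (w : ι) :
    cyc (u :: l₁ ++ [w]) = path u (l₁ ++ [w]) ++ [(w, u)] := by
  rw [cyc_split]; rfl

theorem cyc_right (u w : ι) (l₂ : List ι) :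
    cyc (u :: w :: l₂) = (u, w) :: path w (l₂ ++ [u]) := rfl

/-- Two lists that describe the same cyclic sequence (up to the choice of the starting point). -/
def Rot (L L' : List ι) : Prop := L.Perm L' ∧ (cyc L).Perm (cyc L')

theorem Rot.symm {L L' : List ι} (h : Rot L L') : Rot L' L := ⟨h.1.symm, h.2.symm⟩

theorem Rot.trans {L L' L'' : List ι} (h : Rot L L') (h' : Rot L' L'') : Rot L L'' :=
  ⟨h.1.trans h'.1, h.2.trans h'.2⟩

theorem rot_append (l₁ l₂ : List ι) : Rot (l₁ ++ l₂) (l₂ ++ l₁) := by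
  refine ⟨List.perm_append_comm, ?_⟩
  cases l₁ with
  | nil => simp
  | cons u l₁ =>
    cases l₂ with
    | nil => simp
    | cons w l₂ =>
      rw [cyc_split, cyc_split]
      exact List.perm_append_comm

theorem Rot.mem_iff {L L' : List ι} (h : Rot L L') {x : ι} : x ∈ L ↔ x ∈ L' := h.1.mem_iff

theorem Rot.mem_cyc {L L' : List ι} (h : Rot L L') {x : ι × ι} : x ∈ cyc L ↔ x ∈ cyc L' :=
  h.2.mem_iff

theorem path_map_fst (a : ι) (l : List ι) (b : ι) :
    (path a (l ++ [b])).map Prod.fst = a :: l := by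
  induction l generalizing a with
  | nil => simp [path]
  | cons c l ih => simp [path, ih]

theorem path_map_snd (a : ι) (l : List ι) : (path a l).map Prod.snd = l := by
  induction l generalizing a with
  | nil => simp [path]
  | cons c l ih => simp [path, ih]

theorem cyc_map_fst (L : List ι) : (cyc L).map Prod.fst = L := by
  cases L with
  | nil => rfl
  | cons a l => exact path_map_fst a l a

theorem cyc_map_snd (L : List ι) : ((cyc L).map Prod.snd).Perm L := by
  cases L with
  | nil => simp [cyc]
  | cons a l =>
    simp only [cyc, path_map_snd]
    exact (List.perm_append_singleton a l)

theorem mem_of_mem_cyc {L : List ι} {a b : ι} (h : (a, b) ∈ cyc L) : a ∈ L ∧ b ∈ L := by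
  constructor
  · rw [← cyc_map_fst L]; exact List.mem_map_of_mem (f := Prod.fst) h
  · exact (cyc_map_snd L).mem_iff.1 (List.mem_map_of_mem (f := Prod.snd) h)

theorem exists_next {L : List ι} {a : ι} (h : a ∈ L) : ∃ b, (a, b) ∈ cyc L := by
  rw [← cyc_map_fst L] at h
  obtain ⟨⟨x, y⟩, hm, rfl⟩ := List.mem_map.1 h
  exact ⟨y, hm⟩

theorem exists_prev {L : List ι} {a : ι} (h : a ∈ L) : ∃ b, (b, a) ∈ cyc L := by
  rw [← (cyc_map_snd L).mem_iff] at h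
  obtain ⟨⟨x, y⟩, hm, rfl⟩ := List.mem_map.1 h
  exact ⟨x, hm⟩

theorem nodup_cyc {L : List ι} (h : L.Nodup) : (cyc L).Nodup := by
  rw [← cyc_map_fst L] at h
  exact List.Nodup.of_map _ h

theorem next_unique {L : List ι} (h : L.Nodup) {a b b' : ι} (hb : (a, b) ∈ cyc L)
    (hb' : (a, b') ∈ cyc L) : b = b' := by
  rw [← cyc_map_fst L] at h
  exact congrArg Prod.snd (List.inj_on_of_nodup_map h hb hb' rfl)

theorem prev_unique {L : List ι} (h : L.Nodup) {a a' b : ι} (hb : (a, b) ∈ cyc L)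
    (hb' : (a', b) ∈ cyc L) : a = a' := by
  rw [← (cyc_map_snd L).nodup_iff] at h
  exact congrArg Prod.fst (List.inj_on_of_nodup_map h hb hb' rfl)

theorem exists_rot_cons {L : List ι} {x : ι} (h : x ∈ L) : ∃ l, Rot L (x :: l) := by
  obtain ⟨s, t, rfl⟩ := List.append_of_mem h
  exact ⟨t ++ s, rot_append s (x :: t)⟩

theorem Rot.nodup {L L' : List ι} (h : Rot L L') (hL : L.Nodup) : L'.Nodup := h.1.nodup_iff.1 hL

theorem exists_rot_edge {L : List ι} (hd : L.Nodup) (h2 : 2 ≤ L.length) {a b : ι}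
    (h : (a, b) ∈ cyc L) : ∃ l, Rot L (a :: b :: l) := by
  obtain ⟨l, hl⟩ := exists_rot_cons (mem_of_mem_cyc h).1
  cases l with
  | nil => have := hl.1.length_eq; simp at this; omega
  | cons c l =>
    have : b = c := next_unique (hl.nodup hd) (hl.mem_cyc.1 h) (by simp [cyc, path])
    subst this
    exact ⟨l, hl⟩

theorem exists_rot_two {L : List ι} {u w : ι} (hu : u ∈ L) (hw : w ∈ L) (hne : u ≠ w) :
    ∃ l₁ l₂, Rot L (u :: l₁ ++ w :: l₂) := by
  obtain ⟨l, hl⟩ := exists_rot_cons hu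
  have hw' := hl.mem_iff.1 hw
  simp only [List.mem_cons, hne.symm, false_or] at hw'
  obtain ⟨s, t, rfl⟩ := List.append_of_mem hw'
  exact ⟨s, t, hl⟩

theorem ne_of_mem_cyc {L : List ι} (hd : L.Nodup) (h2 : 2 ≤ L.length) {a b : ι}
    (h : (a, b) ∈ cyc L) : a ≠ b := by
  obtain ⟨l, hl⟩ := exists_rot_edge hd h2 h
  have := hl.nodup hd
  simp at this
  tauto

theorem swap_notMem_cyc {L : List ι} (hd : L.Nodup) (h3 : 3 ≤ L.length) {a b : ι}
    (h : (a, b) ∈ cyc L) : (b, a) ∉ cyc L := by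
  intro h'
  obtain ⟨l, hl⟩ := exists_rot_edge hd (by omega) h
  have hn := hl.nodup hd
  cases l with
  | nil => have := hl.1.length_eq; simp at this; omega
  | cons c l =>
    have : a = c := next_unique hn (hl.mem_cyc.1 h') (by simp [cyc, path])
    subst this
    simp at hn

theorem path_reverse (a : ι) (l : List ι) (b : ι) :
    (path a (l ++ [b])).reverse.map Prod.swap = path b (l.reverse ++ [a]) := by
  induction l generalizing a with
  | nil => simp [path]
  | cons c l ih =>
    have := path_append b l.reverse c [a]
    simp only [List.cons_append, path, List.reverse_cons, List.map_append, ih, List.map_cons,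
      List.map_nil, Prod.swap_prod_mk, List.append_assoc, List.nil_append] at this ⊢
    rw [this]

/-- Reversal of a cyclic sequence, keeping the starting point. -/
theorem cyc_reverse (a : ι) (l : List ι) :
    (cyc (a :: l.reverse)).Perm ((cyc (a :: l)).map Prod.swap) := by
  simp only [cyc]
  rw [← path_reverse]
  exact ((List.reverse_perm _).map _)

end Lists

end PlanarCycle

namespace PlanarCycle

/-! ### Cross products and general position -/

/-- The cross product of two plane vectors. -/
def cr (a b : ℂ) : ℝ := a.re * b.im - a.im * b.re

theorem cr_smul_right (a b : ℂ) (t : ℝ) : cr a (t * b) = t * cr a b := by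
  simp [cr]; ring

theorem cr_smul_left (a b : ℂ) (t : ℝ) : cr (t * a) b = t * cr a b := by
  simp [cr]; ring

theorem cr_swap (a b : ℂ) : cr a b = -cr b a := by simp [cr]; ring

theorem cr_self (a : ℂ) : cr a a = 0 := by simp [cr]; ring

theorem cr_neg_right (a b : ℂ) : cr a (-b) = -cr a b := by simp [cr]; ring

theorem cr_neg_left (a b : ℂ) : cr (-a) b = -cr a b := by simp [cr]; ring

theorem cr_add_right (a b c : ℂ) : cr a (b + c) = cr a b + cr a c := by simp [cr]; ring

theorem cr_sub_right (a b c : ℂ) : cr a (b - c) = cr a b - cr a c := by simp [cr]; ring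

/-- Expansion of a vector in a basis, seen by a linear functional. -/
theorem cr_expand (f p q e : ℂ) : cr q p * cr f e = cr e p * cr f q + cr q e * cr f p := by
  simp only [cr]; ring

theorem cr_expand_vec (p q e : ℂ) : (cr q p : ℂ) * e = cr e p * q + cr q e * p := by
  apply Complex.ext <;> simp [cr] <;> ring

variable {ι : Type*} (R : ι → ℂ)

/-- Twice the signed area of the triangle spanned by three points. -/
def ori (i j k : ι) : ℝ := cr (R j - R i) (R k - R i)

theorem ori_eq (p u n : ι) : ori R p u n = cr (R n - R u) (R p - R u) := by
  simp [ori, cr]; ring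

theorem ori_rot (i j k : ι) : ori R i j k = ori R j k i := by simp [ori, cr]; ring

theorem ori_swap (i j k : ι) : ori R i j k = -ori R i k j := by simp [ori, cr]; ring

/-- General position: the points are distinct and no three of them are collinear. -/
structure GP : Prop where
  inj : Function.Injective R
  noncol : ∀ i j k, i ≠ j → i ≠ k → j ≠ k → ori R i j k ≠ 0

theorem mem_segment_param {a b z : ℂ} (h : z ∈ segment ℝ a b) :
    ∃ t : ℝ, 0 ≤ t ∧ t ≤ 1 ∧ z = a + t * (b - a) := by
  rw [segment_eq_image'] at h
  obtain ⟨t, ht, rfl⟩ := h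
  exact ⟨t, ht.1, ht.2, by simp⟩

theorem mem_openSegment_param {a b z : ℂ} (h : z ∈ openSegment ℝ a b) :
    ∃ t : ℝ, 0 < t ∧ t < 1 ∧ z = a + t * (b - a) := by
  rw [openSegment_eq_image'] at h
  obtain ⟨t, ht, rfl⟩ := h
  exact ⟨t, ht.1, ht.2, by simp⟩

theorem param_mem_segment {a b : ℂ} {t : ℝ} (h0 : 0 ≤ t) (h1 : t ≤ 1) :
    a + t * (b - a) ∈ segment ℝ a b := by
  rw [segment_eq_image']; exact ⟨t, ⟨h0, h1⟩, by simp⟩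

theorem param_mem_openSegment {a b : ℂ} {t : ℝ} (h0 : 0 < t) (h1 : t < 1) :
    a + t * (b - a) ∈ openSegment ℝ a b := by
  rw [openSegment_eq_image']; exact ⟨t, ⟨h0, h1⟩, by simp⟩

variable {R}

theorem GP.notMem_segment (hR : GP R) {x y w : ι} (h1 : x ≠ y) (h2 : x ≠ w) :
    R x ∉ segment ℝ (R y) (R w) := by
  intro h
  by_cases h3 : y = w
  · subst h3
    rw [segment_same] at h
    exact h1 (hR.inj h)
  obtain ⟨t, -, -, h⟩ := mem_segment_param h
  apply hR.noncol x y w h1 h2 h3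
  rw [ori_rot, ori, h]
  simp [cr]; ring

theorem GP.inter_share (hR : GP R) {x y w : ι} (h1 : x ≠ y) (h2 : x ≠ w) (h3 : y ≠ w) {z : ℂ}
    (hz : z ∈ segment ℝ (R x) (R y)) (hz' : z ∈ segment ℝ (R x) (R w)) : z = R x := by
  obtain ⟨s, -, -, hs⟩ := mem_segment_param hz
  obtain ⟨t, -, -, ht⟩ := mem_segment_param hz'
  have h : cr (s * (R y - R x)) (R w - R x) = 0 := by
    have : (s : ℂ) * (R y - R x) = t * (R w - R x) := by
      rw [hs] at ht; exact add_left_cancel ht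
    rw [this, cr_smul_left, cr_self, mul_zero]
  rw [cr_smul_left] at h
  have h0 := hR.noncol x y w h1 h2 h3
  rw [ori] at h0
  have : s = 0 := by
    rcases mul_eq_zero.1 h with h | h
    · exact h
    · exact absurd h h0
  simp [hs, this]

theorem ne_of_mem_openSegment_left {a b z : ℂ} (hab : a ≠ b) (h : z ∈ openSegment ℝ a b) :
    z ≠ a := by
  obtain ⟨t, h0, h1, rfl⟩ := mem_openSegment_param h
  have : (b - a) ≠ 0 := sub_ne_zero.2 hab.symm
  have ht : (t : ℂ) ≠ 0 := by exact_mod_cast h0.ne'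
  simp [this, ht]

theorem ne_of_mem_openSegment_right {a b z : ℂ} (hab : a ≠ b) (h : z ∈ openSegment ℝ a b) :
    z ≠ b := by
  rw [openSegment_symm] at h
  exact ne_of_mem_openSegment_left hab.symm h

/-! ### The closed curve, its total angle, its interior, and simplicity. -/

variable (R)

/-- The closed polygonal curve drawn by a cyclic sequence. -/
def bd (L : List ι) : Set ℂ := {z | ∃ e ∈ cyc L, z ∈ segment ℝ (R e.1) (R e.2)}

/-- The signed angle swept by a directed edge, seen from `z`. -/
noncomputable def term (z : ℂ) (e : ι × ι) : ℝ := Complex.arg ((R e.2 - z) / (R e.1 - z))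

/-- The total signed angle swept by a cyclic sequence, seen from `z`. -/
noncomputable def wind (L : List ι) (z : ℂ) : ℝ := ((cyc L).map (term R z)).sum

/-- The interior region of a cyclic sequence. -/
def inside (L : List ι) : Set ℂ := {z | z ∉ bd R L ∧ wind R L z ≠ 0}

/-- Simple closed polygon. -/
structure Simple (L : List ι) : Prop where
  nodup : L.Nodup
  three_le : 3 ≤ L.length
  disjoint : ∀ a b c d, (a, b) ∈ cyc L → (c, d) ∈ cyc L → a ≠ c → a ≠ d → b ≠ c → b ≠ d →
    Disjoint (segment ℝ (R a) (R b)) (segment ℝ (R c) (R d))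

variable {R}

theorem Rot.bd {L L' : List ι} (h : Rot L L') : bd R L = bd R L' := by
  ext z; simp only [PlanarCycle.bd, Set.mem_ofPred_eq, h.mem_cyc]

theorem Rot.wind {L L' : List ι} (h : Rot L L') : wind R L = wind R L' := by
  ext z; exact (h.2.map _).sum_eq

theorem Rot.inside {L L' : List ι} (h : Rot L L') : inside R L = inside R L' := by
  simp only [PlanarCycle.inside, h.bd, h.wind]

theorem Rot.simple {L L' : List ι} (h : Rot L L') (hL : Simple R L) : Simple R L' where
  nodup := h.nodup hL.nodup
  three_le := h.1.length_eq ▸ hL.three_le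
  disjoint a b c d := by
    rw [← h.mem_cyc, ← h.mem_cyc]
    exact hL.disjoint a b c d

theorem Simple.ne {L : List ι} (hL : Simple R L) {a b : ι} (h : (a, b) ∈ cyc L) : a ≠ b :=
  ne_of_mem_cyc hL.nodup (by have := hL.three_le; omega) h

/-- Two edges of a simple polygon meet in common end vertices only. -/
theorem Simple.inter (hR : GP R) {L : List ι} (hL : Simple R L) {a b c d : ι} (h : (a, b) ∈ cyc L)
    (h' : (c, d) ∈ cyc L) (hne : (a, b) ≠ (c, d)) {z : ℂ} (hz : z ∈ segment ℝ (R a) (R b))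
    (hz' : z ∈ segment ℝ (R c) (R d)) : (a = d ∧ z = R a) ∨ (b = c ∧ z = R b) := by
  have hab := hL.ne h
  have hcd := hL.ne h'
  have hac : a ≠ c := by
    rintro rfl; exact hne (by rw [next_unique hL.nodup h h'])
  have hbd : b ≠ d := by
    rintro rfl; exact hne (by rw [prev_unique hL.nodup h h'])
  by_cases had : a = d
  · subst had
    left
    refine ⟨rfl, ?_⟩
    have hbc : b ≠ c := by
      rintro rfl; exact swap_notMem_cyc hL.nodup hL.three_le h h'
    rw [segment_symm] at hz'
    exact hR.inter_share hab hac hbc hz hz'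
  by_cases hbc : b = c
  · subst hbc
    right
    refine ⟨rfl, ?_⟩
    rw [segment_symm] at hz
    exact hR.inter_share hab.symm hbd had hz hz'
  exact absurd hz' (Set.disjoint_left.1 (hL.disjoint a b c d h h' hac had hbc hbd) hz)

/-- Isolates the two edges whose angle terms are discontinuous at the vertex; the sum over the
remaining edges is continuous there. `Simple.edge_split` does the same for a point inside an edge.
-/
theorem Simple.vertex_split (hR : GP R) {L : List ι} (hL : Simple R L) {p u n : ι}
    (hp : (p, u) ∈ cyc L) (hn : (u, n) ∈ cyc L) :
    ∃ E : List (ι × ι), (cyc L).Perm ((p, u) :: (u, n) :: E) ∧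
      ∀ e ∈ E, R u ∉ segment ℝ (R e.1) (R e.2) := by
  classical
  have hnd := nodup_cyc hL.nodup
  have hpu := hL.ne hp
  have hun := hL.ne hn
  have hn' : (u, n) ∈ (cyc L).erase (p, u) := by
    rw [hnd.mem_erase_iff]
    exact ⟨by simp [hpu.symm], hn⟩
  refine ⟨((cyc L).erase (p, u)).erase (u, n),
    (List.perm_cons_erase hp).trans ((List.perm_cons_erase hn').cons _), ?_⟩
  rintro ⟨c, d⟩ he
  rw [(hnd.erase _).mem_erase_iff, hnd.mem_erase_iff] at he
  obtain ⟨h1, h2, h3⟩ := he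
  apply hR.notMem_segment
  · rintro rfl
    exact h1 (by rw [next_unique hL.nodup h3 hn])
  · rintro rfl
    exact h2 (by rw [prev_unique hL.nodup h3 hp])

theorem Simple.edge_split (hR : GP R) {L : List ι} (hL : Simple R L) {a b : ι}
    (h : (a, b) ∈ cyc L) {z : ℂ} (hz : z ∈ openSegment ℝ (R a) (R b)) :
    ∃ E : List (ι × ι), (cyc L).Perm ((a, b) :: E) ∧
      ∀ e ∈ E, z ∉ segment ℝ (R e.1) (R e.2) := by
  classical
  have hnd := nodup_cyc hL.nodup
  have hab := hR.inj.ne (hL.ne h)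
  refine ⟨(cyc L).erase (a, b), List.perm_cons_erase h, ?_⟩
  rintro ⟨c, d⟩ he hz'
  rw [hnd.mem_erase_iff] at he
  obtain h | h := hL.inter hR h he.2 he.1.symm (openSegment_subset_segment _ _ _ hz) hz'
  · exact ne_of_mem_openSegment_left hab hz h.2
  · exact ne_of_mem_openSegment_right hab hz h.2

/-! ### The angle function -/

theorem ratio_im (a b : ℂ) : (b / a).im = cr a b / Complex.normSq a := by
  rw [Complex.div_im, cr]; ring

/-- A ratio equal to `-s` with `s ≥ 0` would make `z` the convex combination of `a` and `b` with
weights `s/(1+s)` and `1/(1+s)`. So each angle term is continuous away from its own edge. -/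
theorem ratio_mem_slitPlane {a b z : ℂ} (h : z ∉ segment ℝ a b) :
    (b - z) / (a - z) ∈ Complex.slitPlane := by
  have hza : a - z ≠ 0 := by
    intro h0
    rw [sub_eq_zero.1 h0] at h
    exact h (left_mem_segment ℝ _ _)
  rw [Complex.mem_slitPlane_iff_not_le_zero]
  intro hle
  apply h
  rw [Complex.le_def] at hle
  set s := -((b - z) / (a - z)).re with hs
  have hs0 : 0 ≤ s := by have := hle.1; simp at this; linarith
  have hr : (b - z) / (a - z) = -(s : ℂ) := by
    apply Complex.ext
    · simp [hs]
    · simpa using hle.2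
  have hb : b - z = -(s : ℂ) * (a - z) := by rw [← hr]; field_simp
  have h1 : (0:ℝ) < 1 + s := by linarith
  rw [segment_eq_image]
  refine ⟨1 / (1 + s), ⟨by positivity, by rw [div_le_one h1]; linarith⟩, ?_⟩
  have h1' : (1 + (s : ℂ)) ≠ 0 := by exact_mod_cast h1.ne'
  have hbz : b = z - s * (a - z) := by linear_combination hb
  simp only [Complex.real_smul]
  rw [hbz]
  push_cast
  field_simp
  ring

theorem term_continuousAt {e : ι × ι} {z : ℂ} (h : z ∉ segment ℝ (R e.1) (R e.2)) :
    ContinuousAt (fun y => term R y e) z := by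
  have hza : R e.1 - z ≠ 0 := by
    intro h0
    rw [sub_eq_zero.1 h0] at h
    exact h (left_mem_segment ℝ _ _)
  have := Complex.continuousAt_arg (ratio_mem_slitPlane h)
  refine ContinuousAt.comp (f := fun y => (R e.2 - y) / (R e.1 - y)) this ?_
  fun_prop (disch := exact hza)

theorem sum_term_continuousAt {E : List (ι × ι)} {z : ℂ}
    (h : ∀ e ∈ E, z ∉ segment ℝ (R e.1) (R e.2)) :
    ContinuousAt (fun y => (E.map (term R y)).sum) z := by
  induction E with
  | nil => simpa using continuousAt_const
  | cons e E ih =>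
    simp only [List.map_cons, List.sum_cons]
    exact (term_continuousAt (h e (by simp))).add (ih fun e he => h e (by simp [he]))

theorem wind_continuousAt {L : List ι} {z : ℂ} (h : z ∉ bd R L) : ContinuousAt (wind R L) z :=
  sum_term_continuousAt fun e he hz => h ⟨e, he, hz⟩

theorem isCompact_bd (L : List ι) : IsCompact (bd R L) := by
  have : bd R L = ⋃ e ∈ {e | e ∈ cyc L}, segment ℝ (R e.1) (R e.2) := by
    ext z; simp [bd]
  rw [this]
  refine (List.finite_toSet (cyc L)).isCompact_biUnion fun e _ => ?_
  rw [segment_eq_image']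
  exact isCompact_Icc.image (by fun_prop)

theorem isClosed_bd (L : List ι) : IsClosed (bd R L) := (isCompact_bd L).isClosed

theorem vertex_mem_bd {L : List ι} {x : ι} (h : x ∈ L) : R x ∈ bd R L := by
  obtain ⟨y, hy⟩ := exists_next h
  exact ⟨_, hy, left_mem_segment ℝ _ _⟩

/-- Modulo `2π` each term is a difference of two arguments, so the sum telescopes. For a closed path
this makes the total an integer multiple of `2π`. -/
theorem path_term_angle (z : ℂ) (a : ι) (l : List ι) (h : ∀ x ∈ a :: l, R x ≠ z) :
    ((((path a l).map (term R z)).sum : ℝ) : Real.Angle) =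
      Complex.arg (R ((a :: l).getLast (by simp)) - z) - Complex.arg (R a - z) := by
  induction l generalizing a with
  | nil => simp [path]
  | cons b l ih =>
    have ha := sub_ne_zero.2 (h a (by simp))
    have hb := sub_ne_zero.2 (h b (by simp))
    simp only [path, List.map_cons, List.sum_cons, Real.Angle.coe_add]
    rw [ih b fun x hx => h x (List.mem_cons_of_mem _ hx), term, Complex.arg_div_coe_angle hb ha,
      List.getLast_cons_cons]
    abel

theorem wind_int {L : List ι} {z : ℂ} (h : z ∉ bd R L) :
    ∃ k : ℤ, wind R L z = k * (2 * Real.pi) := by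
  cases L with
  | nil => exact ⟨0, by simp [wind, cyc]⟩
  | cons a l =>
    have := path_term_angle (R := R) z a (l ++ [a]) (by
      intro x hx hxz
      apply h
      rw [← hxz]
      apply vertex_mem_bd
      simp at hx ⊢; tauto)
    simp only [← List.cons_append, List.getLast_concat, sub_self] at this
    rw [Real.Angle.coe_eq_zero_iff] at this
    obtain ⟨k, hk⟩ := this
    exact ⟨k, by rw [wind, cyc, ← hk]; simp⟩

/-- A function with values in a discrete set of multiples of `2π` attains its limits. -/
theorem eventually_eq_of_tendsto_int {α : Type*} {l : Filter α} [l.NeBot] {f : α → ℝ} {c : ℝ}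
    (hf : Tendsto f l (𝓝 c)) (hi : ∀ᶠ x in l, ∃ k : ℤ, f x = k * (2 * Real.pi)) :
    (∃ k : ℤ, c = k * (2 * Real.pi)) ∧ ∀ᶠ x in l, f x = c := by
  have hpi := Real.pi_pos
  have hev : ∀ᶠ x in l, |f x - c| < Real.pi := by
    have := hf.eventually (Metric.ball_mem_nhds c hpi)
    simpa [Metric.mem_ball, Real.dist_eq] using this
  obtain ⟨x₀, ⟨k₀, hk₀⟩, hx₀⟩ := (hi.and hev).exists
  have hconst : ∀ᶠ x in l, f x = f x₀ := by
    filter_upwards [hi, hev] with x ⟨k, hk⟩ hx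
    have h2 : |f x - f x₀| < 2 * Real.pi := by
      have := abs_sub_le (f x) c (f x₀)
      rw [abs_sub_comm c] at this
      linarith
    rw [hk, hk₀, ← sub_mul, abs_mul, abs_of_pos (by positivity : 0 < 2 * Real.pi)] at h2
    have h3 : |((k - k₀ : ℤ) : ℝ)| < 1 := by
      push_cast
      by_contra! h
      nlinarith
    have : k - k₀ = 0 := by
      rw [← Int.cast_abs] at h3
      exact Int.abs_lt_one_iff.1 (by exact_mod_cast h3)
    rw [hk, hk₀, sub_eq_zero.1 this]
  have hc : c = f x₀ := tendsto_nhds_unique hf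
    ((tendsto_const_nhds (x := f x₀)).congr' (hconst.mono fun x hx => hx.symm))
  exact ⟨⟨k₀, hc.trans hk₀⟩, hc ▸ hconst⟩

theorem wind_eventually {L : List ι} {z : ℂ} (h : z ∉ bd R L) :
    ∀ᶠ y in 𝓝 z, y ∉ bd R L ∧ wind R L y = wind R L z := by
  have h1 : ∀ᶠ y in 𝓝 z, y ∉ bd R L := (isClosed_bd L).isOpen_compl.mem_nhds h
  exact h1.and (eventually_eq_of_tendsto_int (wind_continuousAt h)
    (h1.mono fun y hy => wind_int hy)).2

theorem isOpen_inside (L : List ι) : IsOpen (inside R L) := by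
  rw [isOpen_iff_mem_nhds]
  rintro z ⟨hz, hw⟩
  filter_upwards [wind_eventually hz] with y hy
  exact ⟨hy.1, hy.2 ▸ hw⟩

theorem wind_eq_of_isPreconnected {L : List ι} {S : Set ℂ} (hS : IsPreconnected S)
    (hd : Disjoint S (bd R L)) {x y : ℂ} (hx : x ∈ S) (hy : y ∈ S) :
    wind R L x = wind R L y := by
  refine hS.induction₂ (fun x y => wind R L x = wind R L y) ?_ (fun x y z _ _ _ h h' => h.trans h')
    (fun x y _ _ h => h.symm) hx hy
  intro z hz
  have := wind_eventually (Set.disjoint_left.1 hd hz)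
  filter_upwards [nhdsWithin_le_nhds this] with y hy
  exact hy.2.symm

/-- Multiplication by `-I * conj e` carries the half plane to the right half plane, where `arg` has
no jump. There the telescoping of arguments is exact and not merely modulo `2π`. -/
theorem wind_zero_of_halfplane {L : List ι} {z e : ℂ} (h : ∀ x ∈ L, 0 < cr e (R x - z)) :
    z ∉ bd R L ∧ wind R L z = 0 := by
  have hf : ∀ a b : ℂ, 0 < cr e (a - z) → 0 < cr e (b - z) →
      z ∉ segment ℝ a b := by
    intro a b ha hb hz
    obtain ⟨t, h0, h1, hz⟩ := mem_segment_param hz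
    have : (a - z) + t * ((b - z) - (a - z)) = 0 := by rw [hz]; ring
    have h2 : cr e ((a - z) + t * ((b - z) - (a - z))) = 0 := by rw [this]; simp [cr]
    rw [cr_add_right, cr_smul_right, cr_sub_right e (b - z)] at h2
    rcases h0.eq_or_lt with rfl | h0
    · linarith
    · nlinarith [mul_pos h0 hb, mul_nonneg (sub_nonneg.2 h1) ha.le]
  constructor
  · rintro ⟨⟨a, b⟩, he, hz⟩
    have := mem_of_mem_cyc he
    exact hf _ _ (h _ this.1) (h _ this.2) hz
  have key : ∀ (a : ι) (l : List ι), (∀ x ∈ a :: l, 0 < cr e (R x - z)) →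
      ((path a l).map (term R z)).sum =
        Complex.arg (-Complex.I * starRingEnd ℂ e * (R ((a :: l).getLast (by simp)) - z)) -
          Complex.arg (-Complex.I * starRingEnd ℂ e * (R a - z)) := by
    intro a l
    induction l generalizing a with
    | nil => simp [path]
    | cons b l ih =>
      intro h
      have hre : ∀ v : ℂ, (-Complex.I * starRingEnd ℂ e * v).re = cr e v := by
        intro v; simp [cr]
      simp only [path, List.map_cons, List.sum_cons]
      rw [ih b fun x hx => h x (List.mem_cons_of_mem _ hx), List.getLast_cons_cons]
      have ha := h a (by simp)
      have hb := h b (by simp)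
      rw [← hre] at ha hb
      have ha1 := Complex.abs_arg_lt_pi_div_two_iff.2 (Or.inl ha)
      have hb1 := Complex.abs_arg_lt_pi_div_two_iff.2 (Or.inl hb)
      set A := -Complex.I * starRingEnd ℂ e * (R a - z)
      set B := -Complex.I * starRingEnd ℂ e * (R b - z)
      have hc : -Complex.I * starRingEnd ℂ e ≠ 0 := by
        intro h0
        simp only [A, h0, zero_mul, Complex.zero_re, lt_self_iff_false] at ha
      have hAB : (R b - z) / (R a - z) = B / A := by
        simp only [A, B]; rw [mul_div_mul_left _ _ hc]
      have hA0 : A ≠ 0 := by rintro h0; simp [h0] at ha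
      have hB0 : B ≠ 0 := by rintro h0; simp [h0] at hb
      have : term R z (a, b) = Complex.arg B - Complex.arg A := by
        simp only [term]
        rw [hAB, ← Real.Angle.toReal_coe_eq_self_iff_mem_Ioc.2 (Complex.arg_mem_Ioc _),
          Complex.arg_div_coe_angle hB0 hA0, ← Real.Angle.coe_sub,
          Real.Angle.toReal_coe_eq_self_iff_mem_Ioc.2]
        rw [abs_lt] at ha1 hb1
        constructor <;> linarith
      rw [this]; ring
  cases L with
  | nil => simp [wind, cyc]
  | cons a l =>
    rw [wind, cyc, key a (l ++ [a]) (by intro x hx; apply h; simp at hx ⊢; tauto)]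
    simp only [← List.cons_append, List.getLast_concat, sub_self]

end PlanarCycle

namespace PlanarCycle

variable {ι : Type*} {R : ι → ℂ}

/-! ### The angle function near an edge and near a vertex -/

theorem isClosed_segment (a b : ℂ) : IsClosed (segment ℝ a b) := by
  rw [segment_eq_image']
  exact (isCompact_Icc.image (by fun_prop)).isClosed

theorem eventually_notMem_segments {E : List (ι × ι)} {z : ℂ}
    (h : ∀ e ∈ E, z ∉ segment ℝ (R e.1) (R e.2)) :
    ∀ᶠ y in 𝓝 z, ∀ e ∈ E, y ∉ segment ℝ (R e.1) (R e.2) := by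
  induction E with
  | nil => simp
  | cons e E ih =>
    have h1 := (isClosed_segment (R e.1) (R e.2)).isOpen_compl.mem_nhds (h e (by simp))
    filter_upwards [h1, ih fun e he => h e (by simp [he])] with y hy hy' f hf
    rcases List.mem_cons.1 hf with rfl | hf
    · exact hy
    · exact hy' f hf

theorem tendsto_line (z d : ℂ) :
    Tendsto (fun δ : ℝ => z + δ * d) (𝓝[>] 0) (𝓝 z) := by
  have : Continuous fun δ : ℝ => z + δ * d := by fun_prop
  simpa using (this.tendsto 0).mono_left nhdsWithin_le_nhds

/-- Explicit coordinates at distance parameter `δ` from an interior point of the edge: the imaginary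
part has the sign of `δ`, and the real part tends to `-(1-t)/t`, which is negative for `t < 1`. This
decides between the limits `π` and `-π` of the argument. -/
theorem edge_ratio {a d : ℂ} (hd : d ≠ 0) {t δ : ℝ} (ht : 0 < t) :
    (a + d - (a + t * d + δ * (Complex.I * d))) / (a - (a + t * d + δ * (Complex.I * d))) =
      ((-((1 - t) * t - δ ^ 2) / (t ^ 2 + δ ^ 2) : ℝ) : ℂ) +
        ((δ / (t ^ 2 + δ ^ 2) : ℝ) : ℂ) * Complex.I := by
  have h1 : (t ^ 2 + δ ^ 2 : ℂ) ≠ 0 := by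
    have : (0:ℝ) < t ^ 2 + δ ^ 2 := by positivity
    exact_mod_cast this.ne'
  have h2 : (t + δ * Complex.I : ℂ) ≠ 0 := by
    intro h
    have := congrArg Complex.re h
    simp at this
    exact ht.ne' this
  have h3 : a - (a + t * d + δ * (Complex.I * d)) = -(t + δ * Complex.I) * d := by ring
  have h4 : a + d - (a + t * d + δ * (Complex.I * d)) = (1 - t - δ * Complex.I) * d := by ring
  rw [h3, h4, mul_div_mul_right _ _ hd, div_eq_iff (neg_ne_zero.2 h2)]
  push_cast
  field_simp
  linear_combination (δ:ℂ) ^ 2 * Complex.I_sq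

/-- Crossing an edge changes the angle function by a full turn. -/
theorem Simple.wind_edge (hR : GP R) {L : List ι} (hL : Simple R L) {a b : ι}
    (h : (a, b) ∈ cyc L) {z : ℂ} (hz : z ∈ openSegment ℝ (R a) (R b)) :
    ∃ c : ℝ, ∀ᶠ δ : ℝ in 𝓝[>] 0,
      (z + δ * (Complex.I * (R b - R a)) ∉ bd R L ∧
        wind R L (z + δ * (Complex.I * (R b - R a))) = c + 2 * Real.pi) ∧
      (z + δ * -(Complex.I * (R b - R a)) ∉ bd R L ∧
        wind R L (z + δ * -(Complex.I * (R b - R a))) = c) := by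
  obtain ⟨E, hE, hzE⟩ := hL.edge_split hR h hz
  have hab := hR.inj.ne (hL.ne h)
  obtain ⟨t, ht0, ht1, hzt⟩ := mem_openSegment_param hz
  set d := R b - R a with hd
  have hd0 : d ≠ 0 := sub_ne_zero.2 hab.symm
  have hRb : R b = R a + d := by rw [hd]; ring
  set S := (E.map (term R z)).sum with hS
  have hsum := sum_term_continuousAt hzE
  have hpos : ∀ᶠ δ : ℝ in 𝓝[>] (0:ℝ), 0 < δ := self_mem_nhdsWithin
  -- the two sides
  have hoff : ∀ v : ℂ, cr d v ≠ 0 → ∀ᶠ δ : ℝ in 𝓝[>] (0:ℝ), z + δ * v ∉ bd R L := by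
    intro v hv
    filter_upwards [(tendsto_line z v).eventually (eventually_notMem_segments hzE), hpos] with
      δ hδ hδ0
    rintro ⟨e, he, hme⟩
    rcases List.mem_cons.1 (hE.mem_iff.1 he) with rfl | he
    · obtain ⟨s, -, -, hs⟩ := mem_segment_param hme
      have h1 : (δ : ℂ) * v = (s - t : ℝ) * d := by
        rw [hzt] at hs; push_cast; linear_combination hs
      have h2 : cr d (δ * v) = 0 := by rw [h1, cr_smul_right, cr_self, mul_zero]
      rw [cr_smul_right] at h2
      rcases mul_eq_zero.1 h2 with h2 | h2
      · exact hδ0.ne' h2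
      · exact hv h2
    · exact hδ e he hme
  have hcr : cr d (Complex.I * d) ≠ 0 := by
    have : cr d (Complex.I * d) = Complex.normSq d := by simp [cr, Complex.normSq_apply]
    rw [this]; exact (Complex.normSq_pos.2 hd0).ne'
  have hw : ∀ y, wind R L y = term R y (a, b) + (E.map (term R y)).sum := by
    intro y; rw [wind, (hE.map _).sum_eq, List.map_cons, List.sum_cons]
  have hre : Tendsto (fun δ : ℝ => ((-((1 - t) * t - δ ^ 2) / (t ^ 2 + δ ^ 2) : ℝ) : ℂ) +
        ((δ / (t ^ 2 + δ ^ 2) : ℝ) : ℂ) * Complex.I) (𝓝 0) (𝓝 ((-(1 - t) / t : ℝ) : ℂ)) := by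
    have : ContinuousAt (fun δ : ℝ => ((-((1 - t) * t - δ ^ 2) / (t ^ 2 + δ ^ 2) : ℝ) : ℂ) +
        ((δ / (t ^ 2 + δ ^ 2) : ℝ) : ℂ) * Complex.I) 0 := by
      have hne : t ^ 2 + (0:ℝ) ^ 2 ≠ 0 := by positivity
      refine ContinuousAt.add (Complex.continuous_ofReal.continuousAt.comp ?_)
        (ContinuousAt.mul (Complex.continuous_ofReal.continuousAt.comp ?_) continuousAt_const)
      · exact ContinuousAt.div (by fun_prop) (by fun_prop) hne
      · exact ContinuousAt.div (by fun_prop) (by fun_prop) hne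
    have h0 := this.tendsto
    convert h0 using 2
    have : (t:ℂ) ≠ 0 := by exact_mod_cast ht0.ne'
    push_cast
    simp
    field_simp
    ring
  have hneg : ((-(1 - t) / t : ℝ) : ℂ).re < 0 := by
    rw [Complex.ofReal_re]
    apply div_neg_of_neg_of_pos <;> linarith
  have him : ((-(1 - t) / t : ℝ) : ℂ).im = 0 := Complex.ofReal_im _
  -- From the left of the edge the ratio approaches the negative axis through the upper half plane.
  have h1 : Tendsto (fun δ : ℝ => term R (z + δ * (Complex.I * d)) (a, b)) (𝓝[>] 0)
      (𝓝 Real.pi) := by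
    refine (Complex.tendsto_arg_nhdsWithin_im_nonneg_of_re_neg_of_im_zero hneg him).comp
      (f := fun δ : ℝ => (R b - (z + δ * (Complex.I * d))) / (R a - (z + δ * (Complex.I * d)))) ?_
    refine tendsto_nhdsWithin_iff.2 ⟨?_, ?_⟩
    · refine (hre.mono_left nhdsWithin_le_nhds).congr fun δ => ?_
      rw [hzt, hRb, edge_ratio hd0 ht0]
    · filter_upwards [hpos] with δ hδ
      rw [hzt, hRb, edge_ratio hd0 ht0]
      simp only [Complex.add_im, Complex.ofReal_im, Complex.mul_im,
        Complex.I_im, Complex.I_re, Complex.ofReal_re]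
      have : 0 < δ / (t ^ 2 + δ ^ 2) := by positivity
      linarith
  -- From the right it approaches through the lower half plane, so the limits differ by a full turn.
  have h2 : Tendsto (fun δ : ℝ => term R (z + δ * -(Complex.I * d)) (a, b)) (𝓝[>] 0)
      (𝓝 (-Real.pi)) := by
    have hcg : ∀ δ : ℝ, z + δ * -(Complex.I * d) = R a + t * d + ((-δ : ℝ) : ℂ) * (Complex.I * d) := by
      intro δ; rw [hzt]; push_cast; ring
    refine (Complex.tendsto_arg_nhdsWithin_im_neg_of_re_neg_of_im_zero hneg him).comp
      (f := fun δ : ℝ => (R b - (z + δ * -(Complex.I * d))) / (R a - (z + δ * -(Complex.I * d)))) ?_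
    refine tendsto_nhdsWithin_iff.2 ⟨?_, ?_⟩
    · have hn : Tendsto (fun δ : ℝ => -δ) (𝓝[>] 0) (𝓝 0) := by
        simpa using (continuous_neg.tendsto (0:ℝ)).mono_left nhdsWithin_le_nhds
      refine (hre.comp hn).congr fun δ => ?_
      simp only [Function.comp]
      rw [hcg, hRb, edge_ratio hd0 ht0]
    · filter_upwards [hpos] with δ hδ
      rw [hcg, hRb, edge_ratio hd0 ht0]
      simp only [Complex.add_im, Complex.ofReal_im, Complex.mul_im,
        Complex.I_im, Complex.I_re, Complex.ofReal_re]
      have : 0 < δ / (t ^ 2 + (-δ) ^ 2) := by positivity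
      rw [neg_div]
      linarith
  have o1 := hoff (Complex.I * d) hcr
  have o2 := hoff (-(Complex.I * d)) (by rw [cr_neg_right]; exact neg_ne_zero.2 hcr)
  have e1 := (eventually_eq_of_tendsto_int
    ((h1.add (hsum.tendsto.comp (tendsto_line z (Complex.I * d)))).congr fun δ => (hw _).symm)
    (o1.mono fun δ hδ => wind_int hδ)).2
  have e2 := (eventually_eq_of_tendsto_int
    ((h2.add (hsum.tendsto.comp (tendsto_line z (-(Complex.I * d))))).congr fun δ => (hw _).symm)
    (o2.mono fun δ hδ => wind_int hδ)).2
  refine ⟨-Real.pi + S, ?_⟩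
  filter_upwards [o1, o2, e1, e2] with δ p1 p2 q1 q2
  exact ⟨⟨p1, by rw [q1]; ring⟩, p2, q2⟩

/-- `e` points to the left of the path that arrives along `-p` and leaves along `n`. -/
def LeftSector (n p e : ℂ) : Prop :=
  (0 < cr n p ∧ 0 < cr n e ∧ 0 < cr e p) ∨ (cr n p < 0 ∧ (0 < cr n e ∨ 0 < cr e p))

/-- `e` is not a nonnegative multiple of `n`. -/
def OffRay (n e : ℂ) : Prop := -(e / n) ∈ Complex.slitPlane

theorem offRay_of_cr_ne_zero {n e : ℂ} (h : cr n e ≠ 0) : OffRay n e := by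
  rw [OffRay, Complex.mem_slitPlane_iff]
  right
  rw [Complex.neg_im, ratio_im]
  have : n ≠ 0 := by rintro rfl; simp [cr] at h
  exact neg_ne_zero.2 (div_ne_zero h (Complex.normSq_pos.2 this).ne')

theorem offRay_neg {n : ℂ} (h : n ≠ 0) : OffRay n (-n) := by
  rw [OffRay, neg_div, neg_neg, div_self h]
  exact Complex.one_mem_slitPlane

theorem OffRay.ne {n e : ℂ} (h : OffRay n e) : n ≠ 0 ∧ e ≠ 0 := by
  constructor <;> rintro rfl <;> simp [OffRay, Complex.mem_slitPlane_iff] at h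

theorem OffRay.smul_ne {v e : ℂ} (hv : OffRay v e) {s ε : ℝ} (hs : 0 ≤ s) (hε : 0 < ε) :
    (ε : ℂ) * e ≠ s * v := by
  intro h
  obtain ⟨hv0, -⟩ := hv.ne
  have he : -(e / v) = ((-(s / ε) : ℝ) : ℂ) := by
    have : (ε : ℂ) ≠ 0 := by exact_mod_cast hε.ne'
    push_cast
    field_simp
    linear_combination -h
  rw [OffRay, he, Complex.ofReal_mem_slitPlane] at hv
  have : 0 ≤ s / ε := by positivity
  linarith

theorem OffRay.eq_neg {n e : ℂ} (h : OffRay n e) (h0 : cr n e = 0) :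
    ∃ s : ℝ, 0 < s ∧ e = ((-s : ℝ) : ℂ) * n := by
  obtain ⟨hn, he⟩ := h.ne
  rw [OffRay, Complex.mem_slitPlane_iff, Complex.neg_im, ratio_im, h0] at h
  simp only [Complex.neg_re, zero_div, neg_zero, ne_eq, not_true_eq_false, or_false] at h
  refine ⟨-(e / n).re, h, ?_⟩
  have : e / n = (((e / n).re : ℝ) : ℂ) := by
    apply Complex.ext
    · simp
    · rw [ratio_im, h0]; simp
  rw [neg_neg, ← this]
  field_simp

theorem OffRay.inv {n e : ℂ} (h : OffRay n e) : -n / e ∈ Complex.slitPlane := by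
  have h1 : -n / e = (-(e / n))⁻¹ := by rw [← neg_div, inv_div, div_neg, neg_div]
  have hq : 0 < Complex.normSq (-(e / n)) :=
    Complex.normSq_pos.2 (neg_ne_zero.2 (div_ne_zero h.ne.2 h.ne.1))
  rw [OffRay, Complex.mem_slitPlane_iff] at h
  rw [h1, Complex.mem_slitPlane_iff, Complex.inv_re, Complex.inv_im]
  rcases h with h | h
  · left; positivity
  · right; exact div_ne_zero (neg_ne_zero.2 h) hq.ne'

theorem arg_pos_iff {a b : ℂ} (ha : a ≠ 0) (h : b / a ∈ Complex.slitPlane) :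
    0 < Complex.arg (b / a) ↔ 0 < cr a b := by
  have hn := Complex.normSq_pos.2 ha
  have hpi : Complex.arg (b / a) ≠ Real.pi := Complex.mem_slitPlane_iff_arg.1 h |>.1
  constructor
  · intro hp
    have hi : 0 ≤ (b / a).im := Complex.arg_nonneg_iff.1 hp.le
    rcases hi.eq_or_lt with h0 | h0
    · exfalso
      rcases Complex.mem_slitPlane_iff.1 h with h1 | h1
      · have := Complex.arg_eq_zero_iff.2 ⟨h1.le, h0.symm⟩
        linarith
      · exact h1 h0.symm
    · rw [ratio_im] at h0
      exact (div_pos_iff_of_pos_right hn).1 h0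
  · intro hp
    have hi : 0 < (b / a).im := by rw [ratio_im]; exact div_pos hp hn
    have := Complex.arg_nonneg_iff.2 hi.le
    refine lt_of_le_of_ne this fun h0 => ?_
    have := Complex.arg_eq_zero_iff.1 h0.symm
    linarith [this.2]

theorem arg_neg_iff' {a b : ℂ} (ha : a ≠ 0) :
    Complex.arg (b / a) < 0 ↔ cr a b < 0 := by
  have hn := Complex.normSq_pos.2 ha
  rw [Complex.arg_neg_iff, ratio_im]
  constructor
  · intro h
    by_contra! h'
    exact absurd h (not_lt.2 (div_nonneg h' hn.le))
  · exact fun h => div_neg_of_neg_of_pos h hn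

/-- The sum of the two angles at a path vertex, depending on the side it is seen from. -/
theorem arg_add_arg {n p e : ℂ} (hnp : cr n p ≠ 0) (hn : OffRay n e) (hp : OffRay p e) :
    open Classical in
    Complex.arg (-e / p) + Complex.arg (-n / e) =
      (if 0 < cr n p then Complex.arg (n / p) else Complex.arg (n / p) - 2 * Real.pi) +
        if LeftSector n p e then 2 * Real.pi else 0 := by
  have hn0 := hn.ne.1
  have hp0 := hp.ne.1
  have he0 := hn.ne.2
  have s1 : -e / p ∈ Complex.slitPlane := by rw [neg_div]; exact hp
  have s2 := hn.inv
  set A := Complex.arg (-e / p) with hA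
  set B := Complex.arg (-n / e) with hB
  set φ := Complex.arg (n / p) with hφ
  have hA1 := Complex.neg_pi_lt_arg (-e / p)
  have hB1 := Complex.neg_pi_lt_arg (-n / e)
  have hA2 : A < Real.pi := lt_of_le_of_ne (Complex.arg_le_pi _) (Complex.mem_slitPlane_iff_arg.1 s1).1
  have hB2 : B < Real.pi := lt_of_le_of_ne (Complex.arg_le_pi _) (Complex.mem_slitPlane_iff_arg.1 s2).1
  have hpi := Real.pi_pos
  have s3 : n / p ∈ Complex.slitPlane := by
    rw [Complex.mem_slitPlane_iff]; right
    rw [ratio_im, cr_swap]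
    exact div_ne_zero (neg_ne_zero.2 hnp) (Complex.normSq_pos.2 hp0).ne'
  have hφ1 := Complex.neg_pi_lt_arg (n / p)
  have hφ2 : φ < Real.pi := lt_of_le_of_ne (Complex.arg_le_pi _) (Complex.mem_slitPlane_iff_arg.1 s3).1
  have pA : 0 < A ↔ 0 < cr e p := by
    rw [hA, arg_pos_iff hp0 s1, cr_neg_right, ← cr_swap]
  have pB : 0 < B ↔ 0 < cr n e := by
    rw [hB, arg_pos_iff he0 s2, cr_neg_right, ← cr_swap]
  have nA : A < 0 ↔ cr e p < 0 := by
    rw [hA, arg_neg_iff' hp0, cr_neg_right, ← cr_swap]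
  have nB : B < 0 ↔ cr n e < 0 := by
    rw [hB, arg_neg_iff' he0, cr_neg_right, ← cr_swap]
  have pφ : 0 < φ ↔ cr n p < 0 := by
    rw [hφ, arg_pos_iff hp0 s3, cr_swap, neg_pos]
  have nφ : φ < 0 ↔ 0 < cr n p := by
    rw [hφ, arg_neg_iff' hp0, cr_swap, neg_lt_zero]
  -- The identity holds modulo `2π`. Since `A`, `B` and `φ` lie strictly between `-π` and `π`, only
  -- three values of `k` remain, and the signs of the cross products select one.
  obtain ⟨k, hk⟩ : ∃ k : ℤ, A + B - φ = 2 * Real.pi * k := by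
    rw [← Real.Angle.angle_eq_iff_two_pi_dvd_sub, Real.Angle.coe_add, hA, hB, hφ,
      Complex.arg_div_coe_angle (neg_ne_zero.2 he0) hp0,
      Complex.arg_div_coe_angle (neg_ne_zero.2 hn0) he0, Complex.arg_div_coe_angle hn0 hp0,
      Complex.arg_neg_coe_angle he0, Complex.arg_neg_coe_angle hn0]
    have := Real.Angle.two_nsmul_coe_pi
    rw [two_nsmul] at this
    rw [show ((e.arg : Real.Angle) + Real.pi - p.arg + (n.arg + Real.pi - e.arg)) =
      n.arg - p.arg + ((Real.pi : Real.Angle) + Real.pi) by abel, this, add_zero]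
  have hkr : (k:ℝ) < 2 ∧ (-2:ℝ) < k := by constructor <;> nlinarith
  have hk2 : k < 2 ∧ -2 < k := by exact_mod_cast hkr
  have hk3 : k = -1 ∨ k = 0 ∨ k = 1 := by omega
  rcases hnp.lt_or_gt with h0 | h0
  · rw [if_neg h0.not_gt]
    have h0' := pφ.2 h0
    by_cases hs : LeftSector n p e
    · rw [if_pos hs]
      have h : 0 < A ∨ 0 < B := by
        rcases hs with hs | hs
        · linarith [hs.1]
        · rw [pA, pB]; exact hs.2.symm
      rcases hk3 with rfl | rfl | rfl
      · push_cast at hk; rcases h with h | h <;> linarith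
      · push_cast at hk; linarith
      · push_cast at hk; linarith
    · rw [if_neg hs]
      have h1 : A ≤ 0 := by
        by_contra! h; exact hs (Or.inr ⟨h0, Or.inr (pA.1 h)⟩)
      have h2 : B ≤ 0 := by
        by_contra! h; exact hs (Or.inr ⟨h0, Or.inl (pB.1 h)⟩)
      rcases hk3 with rfl | rfl | rfl
      · push_cast at hk; linarith
      · push_cast at hk; linarith
      · push_cast at hk; linarith
  · rw [if_pos h0]
    have h0' := nφ.2 h0
    by_cases hs : LeftSector n p e
    · rw [if_pos hs]
      have h : 0 < A ∧ 0 < B := by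
        rcases hs with hs | hs
        · rw [pA, pB]; exact hs.2.symm
        · linarith [hs.1]
      obtain ⟨h1, h2⟩ := h
      rcases hk3 with rfl | rfl | rfl
      · push_cast at hk; linarith
      · push_cast at hk; linarith
      · push_cast at hk; linarith
    · rw [if_neg hs]
      have h : A ≤ 0 ∨ B ≤ 0 := by
        by_contra! h; exact hs (Or.inl ⟨h0, pB.1 h.2, pA.1 h.1⟩)
      rcases hk3 with rfl | rfl | rfl
      · push_cast at hk; linarith
      · push_cast at hk; linarith
      · push_cast at hk; rcases h with h | h <;> linarith

/-- The angle function near a vertex. -/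
theorem Simple.wind_vertex (hR : GP R) {L : List ι} (hL : Simple R L) {p u n : ι}
    (hp : (p, u) ∈ cyc L) (hn : (u, n) ∈ cyc L) (hpn : p ≠ n) :
    open Classical in
    ∃ c : ℝ, ∀ e : ℂ, OffRay (R n - R u) e → OffRay (R p - R u) e → ∀ᶠ ε : ℝ in 𝓝[>] 0,
      R u + ε * e ∉ bd R L ∧ wind R L (R u + ε * e) =
        c + if LeftSector (R n - R u) (R p - R u) e then 2 * Real.pi else 0 := by
  classical
  obtain ⟨E, hE, huE⟩ := hL.vertex_split hR hp hn
  have hpu := hL.ne hp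
  have hun := hL.ne hn
  have hk := hR.noncol p u n hpu hpn hun
  rw [ori_eq] at hk
  set n' := R n - R u with hn'
  set p' := R p - R u with hp'
  refine ⟨(E.map (term R (R u))).sum +
    if 0 < cr n' p' then Complex.arg (n' / p') else Complex.arg (n' / p') - 2 * Real.pi, ?_⟩
  intro e hen hep
  have hsum := sum_term_continuousAt huE
  have hpos : ∀ᶠ ε : ℝ in 𝓝[>] (0:ℝ), 0 < ε := self_mem_nhdsWithin
  have hoff : ∀ᶠ ε : ℝ in 𝓝[>] (0:ℝ), R u + ε * e ∉ bd R L := by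
    filter_upwards [(tendsto_line (R u) e).eventually (eventually_notMem_segments huE), hpos] with
      ε hε hε0
    rintro ⟨f, hf, hm⟩
    rcases List.mem_cons.1 (hE.mem_iff.1 hf) with rfl | hf
    · rw [segment_symm] at hm
      obtain ⟨s, hs, -, h⟩ := mem_segment_param hm
      exact hep.smul_ne hs hε0 (add_left_cancel h)
    · rcases List.mem_cons.1 hf with rfl | hf
      · obtain ⟨s, hs, -, h⟩ := mem_segment_param hm
        exact hen.smul_ne hs hε0 (add_left_cancel h)
      · exact hε f hf hm
  have he0 := hen.ne.2
  have hp0 := hep.ne.1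
  have hn0 := hen.ne.1
  have hlin : ∀ v : ℂ, Tendsto (fun ε : ℝ => v - ε * e) (𝓝[>] 0) (𝓝 v) := by
    intro v
    have := tendsto_line v (-e)
    refine this.congr fun ε => by ring
  have t1 : Tendsto (fun ε : ℝ => term R (R u + ε * e) (p, u)) (𝓝[>] 0)
      (𝓝 (Complex.arg (-e / p'))) := by
    have hs : -e / p' ∈ Complex.slitPlane := by rw [neg_div]; exact hep
    refine ((Complex.continuousAt_arg hs).tendsto.comp
      (tendsto_const_nhds.div (hlin p') hp0)).congr' ?_
    filter_upwards [hpos] with ε hε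
    simp only [Function.comp, term]
    rw [← Complex.arg_real_mul _ hε]
    congr 1
    simp only [hp', Pi.div_apply]
    rw [← sub_sub, ← mul_div_assoc]
    congr 1 <;> ring
  have t2 : Tendsto (fun ε : ℝ => term R (R u + ε * e) (u, n)) (𝓝[>] 0)
      (𝓝 (Complex.arg (-n' / e))) := by
    have hs := hen.inv
    refine ((Complex.continuousAt_arg hs).tendsto.comp
      (((hlin n').neg).div_const e)).congr' ?_
    filter_upwards [hpos] with ε hε
    simp only [Function.comp, term]
    rw [← Complex.arg_real_mul ((R n - (R u + ε * e)) / (R u - (R u + ε * e))) hε]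
    congr 1
    have : (ε : ℂ) ≠ 0 := by exact_mod_cast hε.ne'
    simp only [hn']
    have h3 : R u - (R u + ε * e) = -(ε * e) := by ring
    rw [h3]
    field_simp
    ring
  have hw : ∀ y, wind R L y = term R y (p, u) + term R y (u, n) + (E.map (term R y)).sum := by
    intro y
    rw [wind, (hE.map _).sum_eq, List.map_cons, List.sum_cons, List.map_cons, List.sum_cons]
    ring
  have ev := (eventually_eq_of_tendsto_int
    (((t1.add t2).add (hsum.tendsto.comp (tendsto_line (R u) e))).congr fun ε => (hw _).symm)
    (hoff.mono fun ε hε => wind_int hε)).2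
  filter_upwards [hoff, ev] with ε h1 h2
  refine ⟨h1, ?_⟩
  rw [h2, arg_add_arg hk hen hep]
  ring

end PlanarCycle

namespace PlanarCycle

variable {ι : Type*} {R : ι → ℂ}

/-! ### Orientation -/

variable (R) in
/-- A simple polygon whose angle function only takes the values `0` and `2πσ`, with `σ = ±1`. -/
structure Oriented (L : List ι) (σ : ℝ) : Prop where
  simple : Simple R L
  sign : σ = 1 ∨ σ = -1
  wind_mem : ∀ z, z ∉ bd R L → wind R L z = 0 ∨ wind R L z = σ * (2 * Real.pi)

theorem Rot.oriented {L L' : List ι} {σ : ℝ} (h : Rot L L') (hL : Oriented R L σ) :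
    Oriented R L' σ where
  simple := h.simple hL.simple
  sign := hL.sign
  wind_mem := by rw [← h.bd, ← h.wind]; exact hL.wind_mem

/-- `e` points into the sector at a vertex (next neighbour along `n`, previous one along `p`) that
lies on the interior side of a polygon of orientation `σ`. -/
def InSec (σ : ℝ) (n p e : ℂ) : Prop :=
  (0 < σ * cr n p ∧ 0 < σ * cr n e ∧ 0 < σ * cr e p) ∨
    (σ * cr n p < 0 ∧ (0 < σ * cr n e ∨ 0 < σ * cr e p))

/-- Off the two edge rays the left and right sectors are complementary. The delicate directions are
those opposite to an edge, where one cross product vanishes; there `e` is a negative multiple of `n`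
or `p`, which fixes the sign of the other cross product. -/
theorem not_leftSector_iff {n p e : ℂ} (hnp : cr n p ≠ 0) (hn : OffRay n e) (hp : OffRay p e) :
    ¬LeftSector n p e ↔ InSec (-1) n p e := by
  have hcn : cr n e = 0 → ∃ s : ℝ, 0 < s ∧ cr e p = -s * cr n p := by
    intro h
    obtain ⟨s, hs, h⟩ := hn.eq_neg h
    exact ⟨s, hs, by rw [h, cr_smul_left]⟩
  have hcp : cr e p = 0 → ∃ s : ℝ, 0 < s ∧ cr n e = -s * cr n p := by
    intro h
    obtain ⟨s, hs, h⟩ := hp.eq_neg (by rw [cr_swap, h, neg_zero])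
    exact ⟨s, hs, by rw [h, cr_smul_right]⟩
  simp only [LeftSector, InSec, neg_one_mul, neg_pos, neg_lt_zero]
  rcases hnp.lt_or_gt with h0 | h0
  · simp only [h0, h0.not_gt, false_and, true_and, false_or, or_false, not_or, not_lt]
    constructor
    · rintro ⟨h1, h2⟩
      constructor
      · refine lt_of_le_of_ne h1 fun h => ?_
        obtain ⟨s, hs, h⟩ := hcn h
        nlinarith
      · refine lt_of_le_of_ne h2 fun h => ?_
        obtain ⟨s, hs, h⟩ := hcp h
        nlinarith
    · exact fun h => ⟨h.1.le, h.2.le⟩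
  · simp only [h0, h0.not_gt, false_and, true_and, false_or, or_false, not_and, not_lt]
    constructor
    · intro h
      by_contra! h'
      rcases h'.1.eq_or_lt with h1 | h1
      · obtain ⟨s, hs, h2⟩ := hcn h1.symm
        nlinarith [h'.2]
      · have := h h1
        obtain ⟨s, hs, h2⟩ := hcp (le_antisymm this h'.2)
        nlinarith
    · rintro (h | h) h'
      · linarith
      · exact h.le

theorem Simple.prev_ne_next {L : List ι} (hL : Simple R L) {p u n : ι} (hp : (p, u) ∈ cyc L)
    (hn : (u, n) ∈ cyc L) : p ≠ n := by
  rintro rfl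
  exact swap_notMem_cyc hL.nodup hL.three_le hp hn

/-- Near the vertex the angle function takes the values `c` and `c + 2π` on the two sectors, both of
which really occur. Two admissible values that differ by `2π` must be `0` and `2πσ`, so `σ` tells
which sector is interior. -/
theorem Oriented.sector (hR : GP R) {L : List ι} {σ : ℝ} (hL : Oriented R L σ) {p u n : ι}
    (hp : (p, u) ∈ cyc L) (hn : (u, n) ∈ cyc L) {e : ℂ} (hen : OffRay (R n - R u) e)
    (hep : OffRay (R p - R u) e) :
    ∀ᶠ ε : ℝ in 𝓝[>] 0, R u + ε * e ∉ bd R L ∧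
      (R u + ε * e ∈ inside R L ↔ InSec σ (R n - R u) (R p - R u) e) := by
  classical
  have hpn := hL.simple.prev_ne_next hp hn
  have hk := hR.noncol p u n (hL.simple.ne hp) hpn (hL.simple.ne hn)
  rw [ori_eq] at hk
  obtain ⟨c, hc⟩ := hL.simple.wind_vertex hR hp hn hpn
  set n' := R n - R u
  set p' := R p - R u
  have hpi := Real.pi_pos
  -- both values are attained
  have o1 : OffRay n' (n' + p') := offRay_of_cr_ne_zero (by rw [cr_add_right, cr_self, zero_add]; exact hk)
  have o2 : OffRay p' (n' + p') := offRay_of_cr_ne_zero (by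
    rw [cr_add_right, cr_self, add_zero, cr_swap]; exact neg_ne_zero.2 hk)
  have o3 : OffRay n' (-(n' + p')) := offRay_of_cr_ne_zero (by
    rw [cr_neg_right, cr_add_right, cr_self, zero_add]; exact neg_ne_zero.2 hk)
  have o4 : OffRay p' (-(n' + p')) := offRay_of_cr_ne_zero (by
    rw [cr_neg_right, cr_add_right, cr_self, add_zero, cr_swap, neg_neg]; exact hk)
  have c1 : cr n' (n' + p') = cr n' p' := by rw [cr_add_right, cr_self, zero_add]
  have c2 : cr (n' + p') p' = cr n' p' := by simp [cr]; ring
  have key : (c = 0 ∨ c = σ * (2 * Real.pi)) ∧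
      (c + 2 * Real.pi = 0 ∨ c + 2 * Real.pi = σ * (2 * Real.pi)) := by
    obtain ⟨ε, ⟨h1, h2⟩, h3, h4⟩ := ((hc _ o1 o2).and (hc _ o3 o4)).exists
    have w1 := hL.wind_mem _ h1
    have w2 := hL.wind_mem _ h3
    rw [h2] at w1
    rw [h4] at w2
    rcases hk.lt_or_gt with h0 | h0
    · have s1 : ¬LeftSector n' p' (n' + p') := by
        simp [LeftSector, c1, c2, h0.not_gt]
      have s2 : LeftSector n' p' (-(n' + p')) := by
        rw [LeftSector, cr_neg_right, cr_neg_left, c1, c2]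
        exact Or.inr ⟨h0, Or.inl (neg_pos.2 h0)⟩
      rw [if_neg s1, add_zero] at w1
      rw [if_pos s2] at w2
      exact ⟨w1, w2⟩
    · have s1 : LeftSector n' p' (n' + p') := by
        simp [LeftSector, c1, c2, h0]
      have s2 : ¬LeftSector n' p' (-(n' + p')) := by
        rw [LeftSector, cr_neg_right, cr_neg_left, c1, c2]
        rintro (⟨-, h, -⟩ | ⟨h, -⟩) <;> linarith
      rw [if_pos s1] at w1
      rw [if_neg s2, add_zero] at w2
      exact ⟨w2, w1⟩
  filter_upwards [hc e hen hep] with ε hε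
  refine ⟨hε.1, ?_⟩
  have hiff : R u + ε * e ∈ inside R L ↔ c + (if LeftSector n' p' e then 2 * Real.pi else 0) ≠ 0 := by
    rw [← hε.2]
    exact ⟨fun h => h.2, fun h => ⟨hε.1, h⟩⟩
  rw [hiff]
  rcases hL.sign with rfl | rfl
  · have hc0 : c = 0 := by rcases key with ⟨h | h, h' | h'⟩ <;> linarith
    have : LeftSector n' p' e ↔ InSec 1 n' p' e := by simp [LeftSector, InSec]
    rw [← this, hc0]
    split_ifs with h
    · simp [h, hpi.ne']
    · simp [h]
  · have hc0 : c = -(2 * Real.pi) := by rcases key with ⟨h | h, h' | h'⟩ <;> linarith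
    rw [← not_leftSector_iff hk hen hep, hc0]
    split_ifs with h
    · simp [h]
    · simp [h, hpi.ne']

theorem Oriented.sector_mem (hR : GP R) {L : List ι} {σ : ℝ} (hL : Oriented R L σ) {p u n : ι}
    (hp : (p, u) ∈ cyc L) (hn : (u, n) ∈ cyc L) {e : ℂ} (hen : OffRay (R n - R u) e)
    (hep : OffRay (R p - R u) e) (h : InSec σ (R n - R u) (R p - R u) e) :
    ∀ᶠ ε : ℝ in 𝓝[>] 0, R u + ε * e ∈ inside R L :=
  (hL.sector hR hp hn hen hep).mono fun _ hε => hε.2.2 h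

theorem Oriented.insec_of_frequently (hR : GP R) {L : List ι} {σ : ℝ} (hL : Oriented R L σ)
    {p u n : ι} (hp : (p, u) ∈ cyc L) (hn : (u, n) ∈ cyc L) {e : ℂ} (hen : OffRay (R n - R u) e)
    (hep : OffRay (R p - R u) e) (h : ∃ᶠ ε : ℝ in 𝓝[>] 0, R u + ε * e ∈ inside R L) :
    InSec σ (R n - R u) (R p - R u) e := by
  obtain ⟨ε, h1, h2⟩ := (h.and_eventually (hL.sector hR hp hn hen hep)).exists
  exact h2.2.1 h1

/-- The values on the two sides differ by `2π` and both are admissible. Multiplying the normal by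
`σ` makes it point into the interior for either orientation. -/
theorem Oriented.edge (hR : GP R) {L : List ι} {σ : ℝ} (hL : Oriented R L σ) {a b : ι}
    (h : (a, b) ∈ cyc L) {z : ℂ} (hz : z ∈ openSegment ℝ (R a) (R b)) :
    ∀ᶠ δ : ℝ in 𝓝[>] 0,
      (z + δ * (σ * (Complex.I * (R b - R a))) ∉ bd R L ∧
        wind R L (z + δ * (σ * (Complex.I * (R b - R a)))) = σ * (2 * Real.pi)) ∧
      (z + δ * -(σ * (Complex.I * (R b - R a))) ∉ bd R L ∧
        wind R L (z + δ * -(σ * (Complex.I * (R b - R a)))) = 0) := by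
  obtain ⟨c, hc⟩ := hL.simple.wind_edge hR h hz
  have hpi := Real.pi_pos
  filter_upwards [hc] with δ ⟨⟨h1, h2⟩, h3, h4⟩
  have w1 := hL.wind_mem _ h1
  have w2 := hL.wind_mem _ h3
  rcases hL.sign with rfl | rfl
  · have hc0 : c = 0 := by rcases w1 with h | h <;> rcases w2 with h' | h' <;> linarith
    subst hc0
    refine ⟨⟨by simpa using h1, ?_⟩, by simpa using h3, by simpa using h4⟩
    simpa using h2
  · have hc0 : c = -(2 * Real.pi) := by rcases w1 with h | h <;> rcases w2 with h' | h' <;> linarith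
    subst hc0
    refine ⟨⟨by simpa using h3, by simpa using h4⟩, by simpa using h1, by simpa using h2⟩

theorem Oriented.sign_ne {L : List ι} {σ : ℝ} (hL : Oriented R L σ) : σ ≠ 0 := by
  rcases hL.sign with h | h <;> rw [h] <;> norm_num

theorem Oriented.wind_eq {L : List ι} {σ : ℝ} (hL : Oriented R L σ) {z : ℂ}
    (hz : z ∈ inside R L) : wind R L z = σ * (2 * Real.pi) :=
  (hL.wind_mem z hz.1).resolve_left hz.2

/-! ### Cutting along a segment -/

variable (R) in
/-- The polygonal path through a list of vertices. -/
def arc (a : ι) (l : List ι) : Set ℂ := {z | ∃ e ∈ path a l, z ∈ segment ℝ (R e.1) (R e.2)}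

theorem bd_split (u : ι) (l₁ : List ι) (w : ι) (l₂ : List ι) :
    bd R (u :: l₁ ++ w :: l₂) = arc R u (l₁ ++ [w]) ∪ arc R w (l₂ ++ [u]) := by
  ext z
  simp only [bd, arc, cyc_split, List.mem_append, Set.mem_union, Set.mem_ofPred_eq]
  constructor
  · rintro ⟨e, h | h, hz⟩
    · exact Or.inl ⟨e, h, hz⟩
    · exact Or.inr ⟨e, h, hz⟩
  · rintro (⟨e, h, hz⟩ | ⟨e, h, hz⟩)
    · exact ⟨e, Or.inl h, hz⟩
    · exact ⟨e, Or.inr h, hz⟩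

theorem bd_left (u : ι) (l₁ : List ι) (w : ι) :
    bd R (u :: l₁ ++ [w]) = arc R u (l₁ ++ [w]) ∪ segment ℝ (R u) (R w) := by
  rw [bd_split]
  congr 1
  ext z
  simp [arc, path, segment_symm]

theorem bd_right (u w : ι) (l₂ : List ι) :
    bd R (u :: w :: l₂) = arc R w (l₂ ++ [u]) ∪ segment ℝ (R u) (R w) := by
  have := bd_split (R := R) u [] w l₂
  simp only [List.nil_append, List.cons_append] at this
  rw [this, Set.union_comm]
  congr 1
  ext z
  simp [arc, path]

theorem term_swap {a b : ι} {z : ℂ} (h : z ∉ segment ℝ (R a) (R b)) :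
    term R z (b, a) = -term R z (a, b) := by
  have hs := ratio_mem_slitPlane h
  simp only [term]
  rw [← inv_div, Complex.arg_inv, if_neg (Complex.mem_slitPlane_iff_arg.1 hs).1]

/-- The two parts traverse the diagonal in opposite directions, and these contributions cancel. -/
theorem wind_cut (u : ι) (l₁ : List ι) (w : ι) (l₂ : List ι) {z : ℂ}
    (h : z ∉ segment ℝ (R u) (R w)) :
    wind R (u :: l₁ ++ w :: l₂) z = wind R (u :: l₁ ++ [w]) z + wind R (u :: w :: l₂) z := by
  simp only [wind]
  rw [cyc_split, cyc_left, cyc_right]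
  simp only [List.map_append, List.sum_append, List.map_cons, List.sum_cons, List.map_nil,
    List.sum_nil]
  rw [term_swap h]
  ring

theorem path_mem {a : ι} {l : List ι} {x y : ι} (h : (x, y) ∈ path a l) : x ∈ a :: l ∧ y ∈ l := by
  induction l generalizing a with
  | nil => simp [path] at h
  | cons b l ih =>
    simp only [path, List.mem_cons, Prod.mk.injEq] at h
    rcases h with ⟨rfl, rfl⟩ | h
    · simp
    · have := ih h
      exact ⟨List.mem_cons_of_mem _ this.1, List.mem_cons_of_mem _ this.2⟩

/-- A cycle made from edges of a simple polygon and one free diagonal is simple. -/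
theorem Simple.of_free (hR : GP R) {L L' : List ι} (hL : Simple R L) {u w : ι}
    (hfree : Disjoint (openSegment ℝ (R u) (R w)) (bd R L)) (hnd : L'.Nodup) (h3 : 3 ≤ L'.length)
    (hc : ∀ a b, (a, b) ∈ cyc L' → (a, b) ∈ cyc L ∨ (a, b) = (u, w) ∨ (a, b) = (w, u)) :
    Simple R L' := by
  have key : ∀ c d, (c, d) ∈ cyc L → u ≠ c → u ≠ d → w ≠ c → w ≠ d →
      Disjoint (segment ℝ (R u) (R w)) (segment ℝ (R c) (R d)) := by
    intro c d h h1 h2 h3 h4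
    rw [Set.disjoint_left]
    intro z hz hz'
    rcases eq_or_ne z (R u) with rfl | hzu
    · exact hR.notMem_segment h1 h2 hz'
    rcases eq_or_ne z (R w) with rfl | hzw
    · exact hR.notMem_segment h3 h4 hz'
    exact Set.disjoint_left.1 hfree (mem_openSegment_of_ne_left_right hzu.symm hzw.symm hz)
      ⟨_, h, hz'⟩
  refine ⟨hnd, h3, ?_⟩
  intro a b c d h h' hac had hbc hbd
  rcases hc _ _ h with h | h | h <;> rcases hc _ _ h' with h' | h' | h'
  · exact hL.disjoint a b c d h h' hac had hbc hbd
  · cases h'; exact (key a b h hac.symm hbc.symm had.symm hbd.symm).symm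
  · cases h'; rw [segment_symm ℝ (R w)]
    exact (key a b h had.symm hbd.symm hac.symm hbc.symm).symm
  · cases h; exact key c d h' hac had hbc hbd
  · cases h; cases h'; exact absurd rfl hac
  · cases h; cases h'; exact absurd rfl had
  · cases h; rw [segment_symm]; exact key c d h' hbc hbd hac had
  · cases h; cases h'; exact absurd rfl had
  · cases h; cases h'; exact absurd rfl hac

/-- A function that is constant along each edge, off a set of
exceptional points, is constant along a path through regular vertices. -/
theorem arc_const {Z : Set ℂ} {g : ℂ → ℝ} {a : ι} {l : List ι} (w : ι)
    (h : ∀ e ∈ path a (l ++ [w]), ∀ z ∈ segment ℝ (R e.1) (R e.2), ∀ z' ∈ segment ℝ (R e.1) (R e.2),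
      z ∉ Z → z' ∉ Z → g z = g z')
    (hv : ∀ x ∈ l, R x ∉ Z) {z z' : ℂ} (hz : z ∈ arc R a (l ++ [w])) (hz' : z' ∈ arc R a (l ++ [w]))
    (hzZ : z ∉ Z) (hzZ' : z' ∉ Z) : g z = g z' := by
  induction l generalizing a z z' with
  | nil =>
    obtain ⟨e, he, hz⟩ := hz
    obtain ⟨e', he', hz'⟩ := hz'
    simp only [List.nil_append, path, List.mem_cons, List.not_mem_nil, or_false] at he he'
    subst he; subst he'
    exact h _ (by simp [path]) z hz z' hz' hzZ hzZ'
  | cons b l ih =>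
    have hb : R b ∉ Z := hv b (by simp)
    have hbm : R b ∈ arc R b (l ++ [w]) := by
      cases l <;> exact ⟨_, List.mem_cons_self, left_mem_segment ℝ _ _⟩
    have key : ∀ y ∈ arc R a (b :: l ++ [w]), y ∉ Z → g y = g (R b) := by
      rintro y ⟨e, he, hy⟩ hyZ
      simp only [List.cons_append, path, List.mem_cons] at he
      rcases he with rfl | he
      · exact h _ (by simp [path]) y hy _ (right_mem_segment ℝ _ _) hyZ hb
      · exact ih (fun e he => h e (by simp [path, he])) (fun x hx => hv x (by simp [hx]))
          ⟨e, he, hy⟩ hbm hyZ hb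
    rw [key z hz hzZ, key z' hz' hzZ']

end PlanarCycle

namespace PlanarCycle

variable {ι : Type*} {R : ι → ℂ}

/-! ### The theta lemma -/

variable (R) in
/-- The open segment between two vertices does not meet the polygon. -/
def Free (L : List ι) (u w : ι) : Prop := Disjoint (openSegment ℝ (R u) (R w)) (bd R L)

theorem openSegment_nonempty (a b : ℂ) : (openSegment ℝ a b).Nonempty :=
  ⟨_, param_mem_openSegment (by norm_num : (0:ℝ) < 1 / 2) (by norm_num)⟩

theorem Free.notMem_cyc {L : List ι} {u w : ι} (h : Free R L u w) :
    (u, w) ∉ cyc L ∧ (w, u) ∉ cyc L := by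
  obtain ⟨z, hz⟩ := openSegment_nonempty (R u) (R w)
  have hz' := openSegment_subset_segment _ _ _ hz
  constructor
  · exact fun h' => Set.disjoint_left.1 h hz ⟨_, h', hz'⟩
  · exact fun h' => Set.disjoint_left.1 h hz ⟨_, h', by rwa [segment_symm]⟩

theorem Free.symm {L : List ι} {u w : ι} (h : Free R L u w) : Free R L w u := by
  rw [Free, openSegment_symm]; exact h

theorem Free.ne_nil {u w : ι} {l₁ l₂ : List ι} (h : Free R (u :: l₁ ++ w :: l₂) u w) :
    l₁ ≠ [] ∧ l₂ ≠ [] := by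
  have := h.notMem_cyc
  rw [cyc_split] at this
  constructor
  · rintro rfl; exact this.1 (by simp [path])
  · rintro rfl; exact this.2 (by simp [path])

theorem mem_cyc_left {u w : ι} {l₁ : List ι} (l₂ : List ι) {e : ι × ι}
    (h : e ∈ cyc (u :: l₁ ++ [w])) : e ∈ cyc (u :: l₁ ++ w :: l₂) ∨ e = (w, u) := by
  rw [cyc_left] at h
  rw [cyc_split]
  simp only [List.mem_append, List.mem_singleton] at h ⊢
  tauto

theorem mem_cyc_right {u w : ι} (l₁ : List ι) {l₂ : List ι} {e : ι × ι}
    (h : e ∈ cyc (u :: w :: l₂)) : e ∈ cyc (u :: l₁ ++ w :: l₂) ∨ e = (u, w) := by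
  rw [cyc_right] at h
  rw [cyc_split]
  simp only [List.mem_append, List.mem_cons] at h ⊢
  tauto

theorem Simple.cut (hR : GP R) {u w : ι} {l₁ l₂ : List ι} (hL : Simple R (u :: l₁ ++ w :: l₂))
    (hf : Free R (u :: l₁ ++ w :: l₂) u w) :
    Simple R (u :: l₁ ++ [w]) ∧ Simple R (u :: w :: l₂) := by
  obtain ⟨h1, h2⟩ := hf.ne_nil
  have hnd := hL.nodup
  constructor
  · refine hL.of_free hR hf (hnd.sublist ?_) ?_ ?_
    · exact List.Sublist.append_left (by simp) _
    · have := List.length_pos_iff.2 h1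
      simp; omega
    · intro a b h
      rcases mem_cyc_left l₂ h with h | h
      · exact Or.inl h
      · exact Or.inr (Or.inr h)
  · refine hL.of_free hR hf (hnd.sublist ?_) ?_ ?_
    · rw [List.cons_append]
      exact (List.sublist_append_right _ _).cons_cons _
    · have := List.length_pos_iff.2 h2
      simp; omega
    · intro a b h
      rcases mem_cyc_right l₁ h with h | h
      · exact Or.inl h
      · exact Or.inr (Or.inl h)

/-- The two arcs between the ends of a free diagonal meet in these ends only. -/
theorem Simple.arc_inter (hR : GP R) {u w : ι} {l₁ l₂ : List ι}
    (hL : Simple R (u :: l₁ ++ w :: l₂)) (hf : Free R (u :: l₁ ++ w :: l₂) u w) {z : ℂ}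
    (hzu : z ≠ R u) (hzw : z ≠ R w) :
    (z ∈ arc R u (l₁ ++ [w]) → z ∉ bd R (u :: w :: l₂)) ∧
      (z ∈ arc R w (l₂ ++ [u]) → z ∉ bd R (u :: l₁ ++ [w])) := by
  have h12 : z ∈ arc R u (l₁ ++ [w]) → z ∉ arc R w (l₂ ++ [u]) := by
    rintro ⟨⟨a, b⟩, he, hz⟩ ⟨⟨c, d⟩, he', hz'⟩
    have hn := nodup_cyc hL.nodup
    rw [cyc_split, List.nodup_append] at hn
    have hne := hn.2.2 _ he _ he'
    have hnd := hL.nodup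
    have hvert : ∀ x, x ∈ u :: (l₁ ++ [w]) → x ∈ w :: (l₂ ++ [u]) → x = u ∨ x = w := by
      intro x h1 h2
      simp only [List.mem_cons, List.mem_append, List.not_mem_nil, or_false] at h1 h2
      by_contra! hx
      simp only [hx.1, hx.2, or_false, false_or] at h1 h2
      have := (List.nodup_append.1 hnd).2.2 x (by simp [h1]) x (by simp [h2])
      exact this rfl
    have m1 := path_mem he
    have m2 := path_mem he'
    have hm : ∀ {x}, x ∈ l₁ ++ [w] → x ∈ u :: (l₁ ++ [w]) := fun h => List.mem_cons_of_mem _ h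
    have hm' : ∀ {x}, x ∈ l₂ ++ [u] → x ∈ w :: (l₂ ++ [u]) := fun h => List.mem_cons_of_mem _ h
    have c1 : (a, b) ∈ cyc (u :: l₁ ++ w :: l₂) := by
      rw [cyc_split]; exact List.mem_append_left _ he
    have c2 : (c, d) ∈ cyc (u :: l₁ ++ w :: l₂) := by
      rw [cyc_split]; exact List.mem_append_right _ he'
    rcases hL.inter hR c1 c2 hne hz hz' with ⟨rfl, rfl⟩ | ⟨rfl, rfl⟩
    · rcases hvert a m1.1 (hm' m2.2) with rfl | rfl
      · exact hzu rfl
      · exact hzw rfl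
    · rcases hvert b (hm m1.2) m2.1 with rfl | rfl
      · exact hzu rfl
      · exact hzw rfl
  have hseg : z ∈ bd R (u :: l₁ ++ w :: l₂) → z ∉ segment ℝ (R u) (R w) := fun h h' =>
    Set.disjoint_left.1 hf (mem_openSegment_of_ne_left_right hzu.symm hzw.symm h') h
  rw [bd_split] at hseg
  rw [bd_left, bd_right]
  constructor
  · rintro h (h' | h')
    · exact h12 h h'
    · exact hseg (Or.inl h) h'
  · rintro h (h' | h')
    · exact h12 h' h
    · exact hseg (Or.inr h) h'

/-- The set lies between the open segment and its closure, so losing one or both end points does no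
harm. -/
theorem isPreconnected_segment_diff (a b : ℂ) {Z : Set ℂ}
    (hZ : ∀ z ∈ openSegment ℝ a b, z ∉ Z) : IsPreconnected (segment ℝ a b \ Z) := by
  refine (convex_openSegment a b).isPreconnected.subset_closure ?_ ?_
  · exact fun z hz => ⟨openSegment_subset_segment _ _ _ hz, hZ z hz⟩
  · rw [closure_openSegment]; exact Set.sdiff_subset

/-- The angle function of one part of a polygon is constant along the remaining arc. -/
theorem arc_wind_const (hR : GP R) {u w : ι} {l L : List ι} (hw : ∀ x ∈ l, x ≠ u ∧ x ≠ w)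
    (huw : u ≠ w) (hne : l ≠ [])
    (hoff : ∀ z ∈ arc R u (l ++ [w]), z ≠ R u → z ≠ R w → z ∉ bd R L) (hnd : l.Nodup) :
    ∃ c : ℝ, ∀ z ∈ arc R u (l ++ [w]), z ≠ R u → z ≠ R w → wind R L z = c := by
  obtain ⟨v, l', rfl⟩ := List.exists_cons_of_ne_nil hne
  have hv := hw v (by simp)
  refine ⟨wind R L (R v), fun z hz hzu hzw => ?_⟩
  refine arc_const (Z := {R u, R w}) (g := wind R L) w ?_ ?_ hz ?_ ?_ ?_
  · rintro ⟨a, b⟩ he z hz z' hz' hzZ hzZ'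
    have hopen : ∀ y ∈ openSegment ℝ (R a) (R b), y ∉ ({R u, R w} : Set ℂ) := by
      have hab : a ≠ b := by
        have hcyc : (a, b) ∈ cyc (u :: (v :: l') ++ [w]) := by
          rw [cyc_left]; exact List.mem_append_left _ he
        refine ne_of_mem_cyc ?_ (by simp) hcyc
        rw [List.cons_append, List.nodup_cons, List.nodup_append]
        refine ⟨?_, hnd, by simp, ?_⟩
        · simp only [List.mem_append, List.mem_singleton, not_or]
          exact ⟨fun h => (hw u h).1 rfl, huw⟩
        · rintro x hx y hy rfl
          simp only [List.mem_singleton] at hy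
          exact (hw x hx).2 hy
      have hopen' : ∀ x, R x ∉ openSegment ℝ (R a) (R b) := by
        intro x hx
        by_cases hxa : x = a
        · subst hxa
          exact ne_of_mem_openSegment_left (hR.inj.ne hab) hx rfl
        by_cases hxb : x = b
        · subst hxb
          exact ne_of_mem_openSegment_right (hR.inj.ne hab) hx rfl
        exact hR.notMem_segment hxa hxb (openSegment_subset_segment _ _ _ hx)
      rintro y hy (rfl | rfl)
      · exact hopen' _ hy
      · exact hopen' _ hy
    refine wind_eq_of_isPreconnected (isPreconnected_segment_diff (R a) (R b) hopen) ?_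
      ⟨hz, hzZ⟩ ⟨hz', hzZ'⟩
    rw [Set.disjoint_left]
    rintro y ⟨hy, hyZ⟩
    simp only [Set.mem_insert_iff, Set.mem_singleton_iff, not_or] at hyZ
    exact hoff y ⟨_, he, hy⟩ hyZ.1 hyZ.2
  · intro x hx
    simp only [Set.mem_insert_iff, Set.mem_singleton_iff, not_or]
    exact ⟨hR.inj.ne (hw x hx).1, hR.inj.ne (hw x hx).2⟩
  · exact ⟨(u, v), by simp [path], right_mem_segment ℝ _ _⟩
  · simp [hzu, hzw]
  · simp only [Set.mem_insert_iff, Set.mem_singleton_iff, not_or]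
    exact ⟨hR.inj.ne hv.1, hR.inj.ne hv.2⟩

/-- Far out in direction `f` all vertices lie behind the line perpendicular to `f`; combined with
`wind_zero_of_halfplane`, the angle function vanishes there. -/
theorem exists_far (L : List ι) (f : ℂ) (hf : f ≠ 0) (z : ℂ) :
    ∃ t : ℝ, 0 ≤ t ∧ ∀ s : ℝ, t ≤ s → ∀ x ∈ L, 0 < cr (Complex.I * f) (R x - (z + s * f)) := by
  have hI : cr (Complex.I * f) f = -Complex.normSq f := by simp [cr, Complex.normSq_apply]; ring
  have hpos := Complex.normSq_pos.2 hf
  induction L with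
  | nil => exact ⟨0, le_rfl, by simp⟩
  | cons a L ih =>
    obtain ⟨t, ht0, ht⟩ := ih
    refine ⟨max t ((1 - cr (Complex.I * f) (R a - z)) / Complex.normSq f), le_max_of_le_left ht0, ?_⟩
    intro s hs x hx
    rcases List.mem_cons.1 hx with rfl | hx
    · have h1 := (le_max_right _ _).trans hs
      rw [div_le_iff₀ hpos] at h1
      have h2 : R x - (z + s * f) = (R x - z) - s * f := by ring
      rw [h2, cr_sub_right _ (R x - z), cr_smul_right, hI]
      linarith
    · exact ht s ((le_max_left _ _).trans hs) x hx

/-- If a pair of values other than `(0, 0)` is taken by the angle functions of the two parts, then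
one of them is the value of the respective function on the opposite arc. -/
theorem no_pocket {u w : ι} {l₁ l₂ : List ι} (huw : R u ≠ R w)
    {c₁ c₂ : ℝ}
    (h1 : ∀ z ∈ arc R w (l₂ ++ [u]), z ≠ R u → z ≠ R w →
      z ∉ bd R (u :: l₁ ++ [w]) ∧ wind R (u :: l₁ ++ [w]) z = c₁)
    (h2 : ∀ z ∈ arc R u (l₁ ++ [w]), z ≠ R u → z ≠ R w →
      z ∉ bd R (u :: w :: l₂) ∧ wind R (u :: w :: l₂) z = c₂)
    {z : ℂ} (hz1 : z ∉ bd R (u :: l₁ ++ [w])) (hz2 : z ∉ bd R (u :: w :: l₂))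
    (hne : wind R (u :: l₁ ++ [w]) z ≠ 0 ∨ wind R (u :: w :: l₂) z ≠ 0) :
    wind R (u :: l₁ ++ [w]) z = c₁ ∨ wind R (u :: w :: l₂) z = c₂ := by
  set L₁ := u :: l₁ ++ [w] with hL₁
  set L₂ := u :: w :: l₂ with hL₂
  set d := R w - R u with hd
  have hd0 : d ≠ 0 := sub_ne_zero.2 huw.symm
  -- reduction to a point off the line through the diagonal
  suffices H : ∀ y : ℂ, y ∉ bd R L₁ → y ∉ bd R L₂ → (wind R L₁ y ≠ 0 ∨ wind R L₂ y ≠ 0) →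
      cr d (y - R u) ≠ 0 → wind R L₁ y = c₁ ∨ wind R L₂ y = c₂ by
    by_cases hline : cr d (z - R u) = 0
    · have hev := (wind_eventually hz1).and (wind_eventually hz2)
      have hpos : ∀ᶠ δ : ℝ in 𝓝[>] (0:ℝ), 0 < δ := self_mem_nhdsWithin
      obtain ⟨δ, ⟨⟨a1, a2⟩, a3, a4⟩, hδ⟩ :=
        (((tendsto_line z (Complex.I * d)).eventually hev).and hpos).exists
      rw [← a2, ← a4]
      refine H _ a1 a3 (by rwa [a2, a4]) ?_
      have : z + δ * (Complex.I * d) - R u = (z - R u) + δ * (Complex.I * d) := by ring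
      rw [this, cr_add_right, hline, zero_add, cr_smul_right]
      have hI : cr d (Complex.I * d) = Complex.normSq d := by simp [cr, Complex.normSq_apply]
      rw [hI]
      exact mul_ne_zero hδ.ne' (Complex.normSq_pos.2 hd0).ne'
    · exact H z hz1 hz2 hne hline
  clear! z
  intro z hz1 hz2 hne hline
  -- A ray parallel to the diagonal never meets it. Its first contact with either part is therefore
  -- on one of the two arcs.
  set ray : ℝ → ℂ := fun t => z + t * d with hray
  have hcont : Continuous ray := by fun_prop
  have hoffline : ∀ t, ray t ∉ segment ℝ (R u) (R w) := by
    intro t ht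
    obtain ⟨s, -, -, hs⟩ := mem_segment_param ht
    apply hline
    have : z - R u = ((s - t : ℝ) : ℂ) * d := by
      simp only [hray] at hs
      push_cast
      linear_combination hs
    rw [this, cr_smul_right, cr_self, mul_zero]
  obtain ⟨t₀, ht₀, hfar⟩ := exists_far (R := R) (L₁ ++ L₂) d hd0 z
  by_cases hT : ∃ t, 0 ≤ t ∧ ray t ∈ bd R L₁ ∪ bd R L₂
  · set T : Set ℝ := Set.Ici 0 ∩ ray ⁻¹' (bd R L₁ ∪ bd R L₂) with hTdef
    have hTc : IsClosed T :=
      isClosed_Ici.inter (((isClosed_bd L₁).union (isClosed_bd L₂)).preimage hcont)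
    have hTn : T.Nonempty := hT
    have hTb : BddBelow T := ⟨0, fun t ht => ht.1⟩
    have hm := hTc.csInf_mem hTn hTb
    set t' := sInf T with ht'
    have hlt : ∀ t, 0 ≤ t → t < t' → ray t ∉ bd R L₁ ∪ bd R L₂ := fun t h0 hlt hmem =>
      notMem_of_lt_csInf hlt hTb ⟨h0, hmem⟩
    -- Up to the first contact, the angle function of the part that is not hit stays constant, so
    -- its value at `z` is its value on the arc of the other part.
    have hmain : ∀ L : List ι, bd R L ⊆ bd R L₁ ∪ bd R L₂ → ray t' ∉ bd R L →
        wind R L z = wind R L (ray t') := by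
      intro L hsub hoff
      have hpc : IsPreconnected (ray '' Set.Icc 0 t') :=
        isPreconnected_Icc.image _ hcont.continuousOn
      refine wind_eq_of_isPreconnected hpc ?_ ⟨0, ⟨le_rfl, hm.1⟩, by simp [hray]⟩
        ⟨t', ⟨hm.1, le_rfl⟩, rfl⟩
      rw [Set.disjoint_left]
      rintro _ ⟨t, ⟨h0, h1⟩, rfl⟩ hb
      rcases h1.eq_or_lt with rfl | h1
      · exact hoff hb
      · exact hlt t h0 h1 (hsub hb)
    have hu : ray t' ≠ R u := fun h => hoffline t' (h ▸ left_mem_segment ℝ _ _)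
    have hw : ray t' ≠ R w := fun h => hoffline t' (h ▸ right_mem_segment ℝ _ _)
    rcases hm.2 with hb | hb
    · rw [hL₁, bd_left] at hb
      have hb := hb.resolve_right (hoffline t')
      right
      have := h2 _ hb hu hw
      rw [hmain L₂ Set.subset_union_right this.1, this.2]
    · rw [hL₂, bd_right] at hb
      have hb := hb.resolve_right (hoffline t')
      left
      have := h1 _ hb hu hw
      rw [hmain L₁ Set.subset_union_left this.1, this.2]
  -- A ray without any contact joins `z` to a point far away, and both values would be zero.
  · exfalso
    push Not at hT
    have hmain : ∀ L : List ι, bd R L ⊆ bd R L₁ ∪ bd R L₂ → (∀ x ∈ L, x ∈ L₁ ++ L₂) →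
        wind R L z = 0 := by
      intro L hsub hmem
      have hpc : IsPreconnected (ray '' Set.Icc 0 t₀) :=
        isPreconnected_Icc.image _ hcont.continuousOn
      rw [← (wind_zero_of_halfplane (z := ray t₀) fun x hx => hfar t₀ le_rfl x (hmem x hx)).2]
      refine wind_eq_of_isPreconnected hpc ?_ ⟨0, ⟨le_rfl, ht₀⟩, by simp [hray]⟩
        ⟨t₀, ⟨ht₀, le_rfl⟩, rfl⟩
      rw [Set.disjoint_left]
      rintro _ ⟨t, ⟨h0, -⟩, rfl⟩ hb
      exact hT t h0 (hsub hb)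
    rcases hne with h | h
    · exact h (hmain L₁ Set.subset_union_left fun x hx => List.mem_append_left _ hx)
    · exact h (hmain L₂ Set.subset_union_right fun x hx => List.mem_append_right _ hx)

variable (R) in
/-- A vertex at which a line supports the polygon strictly. -/
def Extreme (L : List ι) (v : ι) : Prop := v ∈ L ∧ ∃ e : ℂ, ∀ x ∈ L, x ≠ v → 0 < cr e (R x - R v)

/-- On the two sides of a free diagonal. -/
theorem diag_sides {u w : ι} {l₁ l₂ : List ι} (hR : GP R) {σ₁ σ₂ : ℝ}
    (h1 : Oriented R (u :: l₁ ++ [w]) σ₁) (h2 : Oriented R (u :: w :: l₂) σ₂)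
    {z : ℂ} (hz : z ∈ openSegment ℝ (R u) (R w)) {P : ℂ → Prop} (hP : ∀ᶠ y in 𝓝 z, P y) :
    ∃ y y', P y ∧ P y' ∧ (y ∉ bd R (u :: l₁ ++ [w]) ∧ y ∉ bd R (u :: w :: l₂)) ∧
      wind R (u :: l₁ ++ [w]) y = 0 ∧
      wind R (u :: w :: l₂) y = (if σ₁ = σ₂ then σ₂ * (2 * Real.pi) else 0) ∧
      (y' ∉ bd R (u :: l₁ ++ [w]) ∧ y' ∉ bd R (u :: w :: l₂)) ∧
      wind R (u :: l₁ ++ [w]) y' = σ₁ * (2 * Real.pi) ∧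
      wind R (u :: w :: l₂) y' = (if σ₁ = σ₂ then 0 else σ₂ * (2 * Real.pi)) := by
  have e1 := h1.edge hR (a := w) (b := u) (by rw [cyc_left]; simp) (z := z)
    (by rwa [openSegment_symm])
  have e2 := h2.edge hR (a := u) (b := w) (by rw [cyc_right]; simp) hz
  have p1 := (tendsto_line z (σ₁ * (Complex.I * (R w - R u)))).eventually hP
  have p2 := (tendsto_line z (σ₁ * (Complex.I * (R u - R w)))).eventually hP
  obtain ⟨δ, ⟨⟨⟨a1, a2⟩, a3, a4⟩, ⟨⟨b1, b2⟩, b3, b4⟩⟩, p1, p2⟩ :=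
    ((e1.and e2).and (p1.and p2)).exists
  have hd : σ₁ * (Complex.I * (R w - R u)) = -(σ₁ * (Complex.I * (R u - R w))) := by ring
  have hd' : -(σ₁ * (Complex.I * (R w - R u))) = (σ₁ * (Complex.I * (R u - R w))) := by ring
  refine ⟨_, _, p1, p2, ?_⟩
  by_cases hs : σ₁ = σ₂
  · subst hs
    rw [if_pos rfl, if_pos rfl]
    rw [hd'] at b3 b4
    exact ⟨⟨by rw [hd]; exact a3, b1⟩, by rw [hd]; exact a4, b2, ⟨a1, b3⟩, a2, b4⟩
  · have hs' : (σ₂ : ℂ) = -σ₁ := by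
      rcases h1.sign with h | h <;> rcases h2.sign with h' | h' <;> subst h <;> subst h' <;>
        simp at hs ⊢
    rw [if_neg hs, if_neg hs]
    have q1 : -((σ₂ : ℂ) * (Complex.I * (R w - R u))) = σ₁ * (Complex.I * (R w - R u)) := by
      rw [hs']; ring
    have q2 : ((σ₂ : ℂ) * (Complex.I * (R w - R u))) = σ₁ * (Complex.I * (R u - R w)) := by
      rw [hs']; ring
    rw [q1] at b3 b4
    rw [q2] at b1 b2
    exact ⟨⟨by rw [hd]; exact a3, b3⟩, by rw [hd]; exact a4, b4, ⟨a1, b1⟩, a2, b2⟩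

theorem notMem_bd_cut {u w : ι} {l₁ l₂ : List ι} {z : ℂ}
    (h : z ∉ bd R (u :: l₁ ++ w :: l₂)) (hd : z ∉ segment ℝ (R u) (R w)) :
    z ∉ bd R (u :: l₁ ++ [w]) ∧ z ∉ bd R (u :: w :: l₂) := by
  rw [bd_split] at h
  rw [bd_left, bd_right]
  simp only [Set.mem_union, not_or] at h ⊢
  exact ⟨⟨h.1, hd⟩, h.2, hd⟩

theorem notMem_bd_of_cut {u w : ι} {l₁ l₂ : List ι} {z : ℂ}
    (h1 : z ∉ bd R (u :: l₁ ++ [w])) (h2 : z ∉ bd R (u :: w :: l₂)) :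
    z ∉ bd R (u :: l₁ ++ w :: l₂) ∧ z ∉ segment ℝ (R u) (R w) := by
  rw [bd_split]
  rw [bd_left] at h1
  rw [bd_right] at h2
  simp only [Set.mem_union, not_or] at h1 h2 ⊢
  exact ⟨⟨h1.1, h2.1⟩, h1.2⟩

/-- If both parts cut off by a free diagonal satisfy the Jordan curve theorem, so does the whole. -/
theorem Simple.oriented_of_cut_aux (hR : GP R) {u w : ι} {l₁ l₂ : List ι}
    (hL : Simple R (u :: l₁ ++ w :: l₂)) (hf : Free R (u :: l₁ ++ w :: l₂) u w) {σ₁ σ₂ : ℝ}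
    (h1 : Oriented R (u :: l₁ ++ [w]) σ₁) (h2 : Oriented R (u :: w :: l₂) σ₂)
    {v : ι} (hv : Extreme R (u :: l₁ ++ w :: l₂) v) (hv1 : v ∈ l₁) :
    ∃ σ, Oriented R (u :: l₁ ++ w :: l₂) σ := by
  have hnd := hL.nodup
  obtain ⟨hn1, hn2⟩ := hf.ne_nil
  have hnd' := hnd
  rw [List.cons_append, List.nodup_cons, List.nodup_append, List.nodup_cons] at hnd'
  obtain ⟨hu, hnd1, ⟨hw2, hnd2⟩, hdis⟩ := hnd'
  simp only [List.mem_append, List.mem_cons, not_or] at hu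
  have huw : u ≠ w := hu.2.1
  have hw1 : w ∉ l₁ := fun h => hdis w h w (by simp) rfl
  obtain ⟨c₂, hc₂⟩ := arc_wind_const hR (L := u :: w :: l₂) (u := u) (w := w) (l := l₁)
    (fun x hx => ⟨fun h => hu.1 (h ▸ hx), fun h => hw1 (h ▸ hx)⟩) huw hn1
    (fun z hz hzu hzw => (hL.arc_inter hR hf hzu hzw).1 hz) hnd1
  obtain ⟨c₁, hc₁⟩ := arc_wind_const hR (L := u :: l₁ ++ [w]) (u := w) (w := u) (l := l₂)
    (fun x hx => ⟨fun h => hw2 (h ▸ hx), fun h => hu.2.2 (h ▸ hx)⟩) huw.symm hn2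
    (fun z hz hzw hzu => (hL.arc_inter hR hf hzu hzw).2 hz) hnd2
  -- the extreme vertex lies outside the second part
  have hc₂0 : c₂ = 0 := by
    obtain ⟨e, he⟩ := hv.2
    have hvu : v ≠ u := fun h => hu.1 (h ▸ hv1)
    have hvw : v ≠ w := fun h => hw1 (h ▸ hv1)
    have hmem : R v ∈ arc R u (l₁ ++ [w]) := by
      obtain ⟨y, hy⟩ := exists_next (L := u :: l₁ ++ [w]) (a := v) (by simp [hv1])
      rw [cyc_left, List.mem_append, List.mem_singleton] at hy
      rcases hy with hy | hy
      · exact ⟨_, hy, left_mem_segment ℝ _ _⟩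
      · exact absurd (congrArg Prod.fst hy) hvw
    rw [← hc₂ _ hmem (hR.inj.ne hvu) (hR.inj.ne hvw)]
    refine (wind_zero_of_halfplane (e := e) fun x hx => he x ?_ ?_).2
    · simp at hx ⊢; tauto
    · rintro rfl
      simp only [List.mem_cons, hvu, hvw, false_or] at hx
      exact hdis x hv1 x (by simp [hx]) rfl
  subst hc₂0
  have hpocket : ∀ {z : ℂ}, z ∉ bd R (u :: l₁ ++ [w]) → z ∉ bd R (u :: w :: l₂) →
      (wind R (u :: l₁ ++ [w]) z ≠ 0 ∨ wind R (u :: w :: l₂) z ≠ 0) →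
      wind R (u :: l₁ ++ [w]) z = c₁ ∨ wind R (u :: w :: l₂) z = 0 := fun hz1 hz2 hne =>
    no_pocket (hR.inj.ne huw)
      (fun z hz hzu hzw => ⟨(hL.arc_inter hR hf hzu hzw).2 hz, hc₁ z hz hzw hzu⟩)
      (fun z hz hzu hzw => ⟨(hL.arc_inter hR hf hzu hzw).1 hz, hc₂ z hz hzu hzw⟩) hz1 hz2 hne
  -- values off the diagonal suffice
  have hred : ∀ σ : ℝ, (σ = 1 ∨ σ = -1) → (∀ z, z ∉ bd R (u :: l₁ ++ [w]) →
      z ∉ bd R (u :: w :: l₂) →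
      wind R (u :: l₁ ++ [w]) z + wind R (u :: w :: l₂) z = 0 ∨
      wind R (u :: l₁ ++ [w]) z + wind R (u :: w :: l₂) z = σ * (2 * Real.pi)) →
      ∃ σ, Oriented R (u :: l₁ ++ w :: l₂) σ := by
    intro σ hσ h
    refine ⟨σ, hL, hσ, fun z hz => ?_⟩
    by_cases hd : z ∈ segment ℝ (R u) (R w)
    · have hzu : R u ≠ z := by rintro rfl; exact hz (vertex_mem_bd (by simp))
      have hzw : R w ≠ z := by rintro rfl; exact hz (vertex_mem_bd (by simp))
      have hdo := mem_openSegment_of_ne_left_right hzu hzw hd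
      obtain ⟨y, y', hy, -, ⟨a1, a2⟩, -⟩ := diag_sides hR h1 h2 hdo (wind_eventually hz)
      rw [← hy.2, wind_cut u l₁ w l₂ (notMem_bd_of_cut a1 a2).2]
      exact h y a1 a2
    · have := notMem_bd_cut hz hd
      rw [wind_cut u l₁ w l₂ hd]
      exact h z this.1 this.2
  obtain ⟨m, hm⟩ := openSegment_nonempty (R u) (R w)
  obtain ⟨y, y', -, -, ⟨a1, a2⟩, a3, a4, ⟨b1, b2⟩, b3, b4⟩ :=
    diag_sides hR h1 h2 hm (P := fun _ => True) (by simp)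
  have hpi := Real.pi_pos
  have hσ1 := h1.sign_ne
  have hσ2 := h2.sign_ne
  have hp2 : (2 * Real.pi) ≠ 0 := by positivity
  -- If `c₁ = 0`, each arc lies outside the other part: the parts lie side by side and have equal
  -- orientation. Otherwise the second part lies inside the first, the orientations are opposite,
  -- and its winding cancels that of the first part.
  by_cases hc0 : c₁ = 0
  · subst hc0
    have hs : σ₁ = σ₂ := by
      by_contra hs
      rw [if_neg hs] at b4
      rcases hpocket b1 b2 (Or.inl (by rw [b3]; exact mul_ne_zero hσ1 hp2)) with h | h
      · rw [b3] at h; exact mul_ne_zero hσ1 hp2 h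
      · rw [b4] at h; exact mul_ne_zero hσ2 hp2 h
    subst hs
    refine hred σ₁ h1.sign fun z hz1 hz2 => ?_
    rcases h1.wind_mem z hz1 with w1 | w1 <;> rcases h2.wind_mem z hz2 with w2 | w2 <;>
      rw [w1, w2]
    · simp
    · simp
    · simp
    · exfalso
      have hne := mul_ne_zero hσ1 hp2
      rcases hpocket hz1 hz2 (Or.inl (by rw [w1]; exact hne)) with h | h
      · rw [w1] at h; exact hne h
      · rw [w2] at h; exact hne h
  · have hs : σ₁ ≠ σ₂ := by
      intro hs
      rw [if_pos hs] at a4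
      have hne := mul_ne_zero hσ2 hp2
      rcases hpocket a1 a2 (Or.inr (by rw [a4]; exact hne)) with h | h
      · rw [a3] at h; exact hc0 h.symm
      · rw [a4] at h; exact hne h
    have hs' : σ₂ = -σ₁ := by
      rcases h1.sign with h | h <;> rcases h2.sign with h' | h' <;> subst h <;> subst h' <;>
        simp at hs ⊢
    refine hred σ₁ h1.sign fun z hz1 hz2 => ?_
    rcases h1.wind_mem z hz1 with w1 | w1 <;> rcases h2.wind_mem z hz2 with w2 | w2 <;>
      rw [w1, w2]
    · simp
    · exfalso
      have hne := mul_ne_zero hσ2 hp2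
      rcases hpocket hz1 hz2 (Or.inr (by rw [w2]; exact hne)) with h | h
      · rw [w1] at h; exact hc0 h.symm
      · rw [w2] at h; exact hne h
    · simp
    · left; rw [hs']; ring

theorem rot_swap (u : ι) (l₁ : List ι) (w : ι) (l₂ : List ι) :
    Rot (u :: l₁ ++ w :: l₂) (w :: l₂ ++ u :: l₁) := rot_append (u :: l₁) (w :: l₂)

theorem rot_left (u : ι) (l₁ : List ι) (w : ι) : Rot (u :: l₁ ++ [w]) (w :: u :: l₁) :=
  rot_append (u :: l₁) [w]

theorem rot_right (u w : ι) (l₂ : List ι) : Rot (u :: w :: l₂) (w :: l₂ ++ [u]) :=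
  rot_append [u] (w :: l₂)

theorem Rot.free {L L' : List ι} {u w : ι} (h : Rot L L') : Free R L u w ↔ Free R L' u w := by
  simp only [Free, h.bd]

theorem Rot.extreme {L L' : List ι} {v : ι} (h : Rot L L') (hv : Extreme R L v) :
    Extreme R L' v := by
  obtain ⟨hm, e, he⟩ := hv
  exact ⟨h.mem_iff.1 hm, e, fun x hx => he x (h.mem_iff.2 hx)⟩

/-- An extreme vertex that is not an end of the diagonal lies on one of the two arcs. Exchanging the
parts, if necessary, puts it on the first. -/
theorem Simple.oriented_of_cut (hR : GP R) {u w : ι} {l₁ l₂ : List ι}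
    (hL : Simple R (u :: l₁ ++ w :: l₂)) (hf : Free R (u :: l₁ ++ w :: l₂) u w) {σ₁ σ₂ : ℝ}
    (h1 : Oriented R (u :: l₁ ++ [w]) σ₁) (h2 : Oriented R (u :: w :: l₂) σ₂)
    {v : ι} (hv : Extreme R (u :: l₁ ++ w :: l₂) v) (hvu : v ≠ u) (hvw : v ≠ w) :
    ∃ σ, Oriented R (u :: l₁ ++ w :: l₂) σ := by
  have hm := hv.1
  simp only [List.mem_append, List.mem_cons, hvu, hvw, false_or] at hm
  rcases hm with hm | hm
  · exact hL.oriented_of_cut_aux hR hf h1 h2 hv hm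
  · have hr := rot_swap u l₁ w l₂
    obtain ⟨σ, hσ⟩ := (hr.simple hL).oriented_of_cut_aux hR (hr.free.1 hf).symm
      ((rot_right u w l₂).oriented h2) ((rot_left u l₁ w).oriented h1) (hr.extreme hv) hm
    exact ⟨σ, hr.symm.oriented hσ⟩

end PlanarCycle

namespace PlanarCycle

variable {ι : Type*} {R : ι → ℂ}

/-! ### Triangles -/

theorem term_bound {e : ι × ι} {z : ℂ} (h : z ∉ segment ℝ (R e.1) (R e.2)) :
    |term R z e| < Real.pi ∧ (0 < term R z e ↔ 0 < cr (R e.1 - z) (R e.2 - z)) ∧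
      (term R z e < 0 ↔ cr (R e.1 - z) (R e.2 - z) < 0) := by
  have hs := ratio_mem_slitPlane h
  have hza : R e.1 - z ≠ 0 := by
    intro h0
    rw [sub_eq_zero.1 h0] at h
    exact h (left_mem_segment ℝ _ _)
  refine ⟨?_, arg_pos_iff hza hs, arg_neg_iff' hza⟩
  rw [abs_lt]
  exact ⟨Complex.neg_pi_lt_arg _,
    lt_of_le_of_ne (Complex.arg_le_pi _) (Complex.mem_slitPlane_iff_arg.1 hs).1⟩

theorem cyc_triangle (a b c : ι) : cyc [a, b, c] = [(a, b), (b, c), (c, a)] := rfl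

theorem cr_sum (a b c z : ℂ) :
    cr (a - z) (b - z) + cr (b - z) (c - z) + cr (c - z) (a - z) = cr (b - a) (c - a) := by
  simp [cr]; ring

/-- Three angles smaller than `π` in absolute value add up to `0` or `±2π`. A full turn forces all
three to have the same sign, and the three cross products add up to the signed area `ori`, which
determines this sign. -/
theorem triangle_aux {a b c : ι} {σ : ℝ} (hσ : σ = 1 ∨ σ = -1) (ho : 0 < σ * ori R a b c) {z : ℂ}
    (hz : z ∉ bd R [a, b, c]) :
    (wind R [a, b, c] z = 0 ∨ wind R [a, b, c] z = σ * (2 * Real.pi)) ∧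
    (wind R [a, b, c] z ≠ 0 ↔ 0 < σ * cr (R a - z) (R b - z) ∧ 0 < σ * cr (R b - z) (R c - z) ∧
      0 < σ * cr (R c - z) (R a - z)) := by
  have h1 := term_bound (R := R) (e := (a, b)) (z := z) fun h => hz ⟨_, by simp [cyc_triangle], h⟩
  have h2 := term_bound (R := R) (e := (b, c)) (z := z) fun h => hz ⟨_, by simp [cyc_triangle], h⟩
  have h3 := term_bound (R := R) (e := (c, a)) (z := z) fun h => hz ⟨_, by simp [cyc_triangle], h⟩
  have hw : wind R [a, b, c] z = term R z (a, b) + term R z (b, c) + term R z (c, a) := by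
    simp [wind, cyc_triangle]; ring
  have hs := cr_sum (R a) (R b) (R c) z
  rw [← ori] at hs
  obtain ⟨k, hk⟩ := wind_int hz
  simp only at h1 h2 h3
  rw [abs_lt] at h1 h2 h3
  set A := term R z (a, b)
  set B := term R z (b, c)
  set C := term R z (c, a)
  have hpi := Real.pi_pos
  have hkr : (-2 : ℝ) < k ∧ (k:ℝ) < 2 := by constructor <;> nlinarith [h1.1.1, h1.1.2, h2.1.1, h2.1.2, h3.1.1, h3.1.2]
  have hk2 : -2 < k ∧ k < 2 := by exact_mod_cast hkr
  have hk3 : k = -1 ∨ k = 0 ∨ k = 1 := by omega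
  rw [hw] at hk ⊢
  obtain ⟨⟨a1, a2⟩, a3, a4⟩ := h1
  obtain ⟨⟨b1, b2⟩, b3, b4⟩ := h2
  obtain ⟨⟨c1, c2⟩, c3, c4⟩ := h3
  rcases hσ with rfl | rfl
  · simp only [one_mul] at ho ⊢
    rw [← a3, ← b3, ← c3]
    rcases hk3 with rfl | rfl | rfl
    · exfalso
      push_cast at hk
      have := a4.1 (by linarith)
      have := b4.1 (by linarith)
      have := c4.1 (by linarith)
      linarith
    · push_cast at hk
      rw [hk]
      refine ⟨Or.inl (by simp), ?_⟩
      simp only [zero_mul, ne_eq, not_true_eq_false, false_iff, not_and, not_lt]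
      intro h h'
      linarith
    · push_cast at hk
      rw [one_mul] at hk
      refine ⟨Or.inr hk, ?_⟩
      rw [hk]
      have : (2 * Real.pi) ≠ 0 := by positivity
      simp only [this, ne_eq, not_false_eq_true, true_iff]
      exact ⟨by linarith, by linarith, by linarith⟩
  · simp only [neg_mul, one_mul, neg_pos] at ho ⊢
    rw [← a4, ← b4, ← c4]
    rcases hk3 with rfl | rfl | rfl
    · push_cast at hk
      have hk' : A + B + C = -(2 * Real.pi) := by linarith
      refine ⟨Or.inr hk', ?_⟩
      rw [hk']
      have : -(2 * Real.pi) ≠ 0 := by linarith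
      simp only [this, ne_eq, not_false_eq_true, true_iff]
      exact ⟨by linarith, by linarith, by linarith⟩
    · push_cast at hk
      rw [hk]
      refine ⟨Or.inl (by simp), ?_⟩
      simp only [zero_mul, ne_eq, not_true_eq_false, false_iff, not_and, not_lt]
      intro h h'
      linarith
    · exfalso
      push_cast at hk
      have := a3.1 (by linarith)
      have := b3.1 (by linarith)
      have := c3.1 (by linarith)
      linarith

theorem cr_eq_zero_of_mem_segment {a b z : ℂ} (h : z ∈ segment ℝ a b) : cr (a - z) (b - z) = 0 := by
  obtain ⟨t, -, -, rfl⟩ := mem_segment_param h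
  simp [cr]; ring

/-- The interior of a triangle. -/
theorem mem_inside_triangle {a b c : ι} {σ : ℝ} (hσ : σ = 1 ∨ σ = -1) (ho : 0 < σ * ori R a b c)
    {z : ℂ} :
    z ∈ inside R [a, b, c] ↔ 0 < σ * cr (R a - z) (R b - z) ∧ 0 < σ * cr (R b - z) (R c - z) ∧
      0 < σ * cr (R c - z) (R a - z) := by
  constructor
  · rintro ⟨h1, h2⟩
    exact (triangle_aux hσ ho h1).2.1 h2
  · intro h
    have hz : z ∉ bd R [a, b, c] := by
      rintro ⟨e, he, hz⟩
      have h0 := cr_eq_zero_of_mem_segment hz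
      simp only [cyc_triangle, List.mem_cons, List.not_mem_nil, or_false] at he
      rcases he with rfl | rfl | rfl <;> simp [h0] at h
    exact ⟨hz, (triangle_aux hσ ho hz).2.2 h⟩

theorem triangle_oriented (hR : GP R) {a b c : ι} (hL : Simple R [a, b, c]) :
    ∃ σ, Oriented R [a, b, c] σ := by
  have hnd := hL.nodup
  simp at hnd
  have h0 := hR.noncol a b c hnd.1.1 hnd.1.2 hnd.2
  rcases h0.lt_or_gt with h | h
  · exact ⟨-1, hL, Or.inr rfl, fun z hz => (triangle_aux (Or.inr rfl) (by linarith) hz).1⟩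
  · exact ⟨1, hL, Or.inl rfl, fun z hz => (triangle_aux (Or.inl rfl) (by linarith) hz).1⟩

/-! ### Extreme vertices -/

theorem exists_mem_ne_ne {L : List ι} (hd : L.Nodup) (h3 : 3 ≤ L.length) (a b : ι) :
    ∃ c ∈ L, c ≠ a ∧ c ≠ b := by
  classical
  by_contra! h
  have hsub : L.toFinset ⊆ {a, b} := by
    intro x hx
    simp only [List.mem_toFinset] at hx
    by_cases hxa : x = a
    · simp [hxa]
    · simp [h x hx hxa]
  have := Finset.card_le_card hsub
  rw [List.toFinset_card_of_nodup hd] at this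
  have := this.trans Finset.card_le_two
  omega

/-- A maximum of a strictly convex function over the vertices is an extreme vertex. Adding to `|x|²`
a multiple of a function that vanishes on the line `AB` leaves the values at `A` and `B` alone; the
factor `s` is chosen so that a third vertex `C` exceeds both. -/
theorem exists_extreme (hR : GP R) {L : List ι} (hd : L.Nodup) (h3 : 3 ≤ L.length) {A B : ι}
    (hAB : A ≠ B) : ∃ v, Extreme R L v ∧ v ≠ A ∧ v ≠ B := by
  classical
  obtain ⟨C, hC, hCA, hCB⟩ := exists_mem_ne_ne hd h3 A B
  have h0 := hR.noncol A B C hAB hCA.symm hCB.symm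
  rw [ori] at h0
  set d := R B - R A with hdd
  -- a strictly convex function
  set s : ℝ := (Complex.normSq (R A) + Complex.normSq (R B) + 1) / (2 * cr d (R C - R A)) with hs
  set φ : ι → ℝ := fun x => Complex.normSq (R x) + 2 * s * cr d (R x - R A) with hφ
  obtain ⟨v, hv, hmax⟩ := Finset.exists_max_image L.toFinset φ ⟨C, by simpa using hC⟩
  simp only [List.mem_toFinset] at hv hmax
  have hφC : φ C = Complex.normSq (R C) + (Complex.normSq (R A) + Complex.normSq (R B) + 1) := by
    simp only [hφ, hs]
    field_simp
  have hφA : φ A = Complex.normSq (R A) := by simp [hφ, cr]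
  have hφB : φ B = Complex.normSq (R B) := by
    simp only [hφ]; rw [← hdd, cr_self]; ring
  have n1 := Complex.normSq_nonneg (R A)
  have n2 := Complex.normSq_nonneg (R B)
  have n3 := Complex.normSq_nonneg (R C)
  have hCv := hmax C hC
  -- The supporting direction is the gradient of `φ` at `v`, turned by a quarter turn and rescaled
  -- to match the cross product: `φ x - φ v` is `|x - v|²` minus twice the required cross product.
  refine ⟨v, ⟨hv, Complex.I * R v - s * d, fun x hx hxv => ?_⟩, ?_, ?_⟩
  · have hle := hmax x hx
    have hpos : 0 < Complex.normSq (R x - R v) :=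
      Complex.normSq_pos.2 (sub_ne_zero.2 (hR.inj.ne hxv))
    have : φ x - φ v = Complex.normSq (R x - R v) -
        2 * cr (Complex.I * R v - s * d) (R x - R v) := by
      simp only [hφ, Complex.normSq_apply, cr]
      simp
      ring
    linarith
  · rintro rfl; linarith
  · rintro rfl; linarith

/-! ### Existence of diagonals -/

/-- Takes the first zero of two affine functions that start positive. It locates the point where a
segment leaves an angular sector. -/
theorem exists_exit {a₀ a₁ b₀ b₁ : ℝ} (ha : 0 < a₀) (hb : 0 < b₀) (h : a₁ < 0 ∨ b₁ < 0) :
    ∃ t : ℝ, 0 ≤ t ∧ t ≤ 1 ∧ 0 ≤ a₀ + t * (a₁ - a₀) ∧ 0 ≤ b₀ + t * (b₁ - b₀) ∧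
      (a₀ + t * (a₁ - a₀) = 0 ∨ b₀ + t * (b₁ - b₀) = 0) := by
  have key : ∀ {a₀ a₁ b₀ b₁ : ℝ}, 0 < a₀ → 0 < b₀ → a₁ < 0 → (b₁ < 0 → a₀ * (b₀ - b₁) ≤ b₀ * (a₀ - a₁)) →
      ∃ t : ℝ, 0 ≤ t ∧ t ≤ 1 ∧ a₀ + t * (a₁ - a₀) = 0 ∧ 0 ≤ b₀ + t * (b₁ - b₀) := by
    intro a₀ a₁ b₀ b₁ ha hb h h'
    have hpos : 0 < a₀ - a₁ := by linarith
    refine ⟨a₀ / (a₀ - a₁), by positivity, by rw [div_le_one hpos]; linarith, ?_, ?_⟩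
    · field_simp; ring
    · have : b₀ + a₀ / (a₀ - a₁) * (b₁ - b₀) = (b₀ * (a₀ - a₁) - a₀ * (b₀ - b₁)) / (a₀ - a₁) := by
        field_simp; ring
      rw [this]
      apply div_nonneg _ hpos.le
      rcases lt_or_ge b₁ 0 with h1 | h1
      · linarith [h' h1]
      · nlinarith
  by_cases hc : a₁ < 0 ∧ (b₁ < 0 → a₀ * (b₀ - b₁) ≤ b₀ * (a₀ - a₁))
  · obtain ⟨t, h0, h1, h2, h3⟩ := key ha hb hc.1 hc.2
    exact ⟨t, h0, h1, h2.ge, h3, Or.inl h2⟩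
  · have hb1 : b₁ < 0 := by
      by_contra hb1
      rcases h with h | h
      · exact hc ⟨h, fun h' => absurd h' hb1⟩
      · exact hb1 h
    obtain ⟨t, h0, h1, h2, h3⟩ := key hb ha hb1 (fun ha1 => by
      by_contra! hlt
      exact hc ⟨ha1, fun _ => hlt.le⟩)
    exact ⟨t, h0, h1, h3, h2.ge, Or.inr h2⟩

/-- Around a vertex `v` with neighbours `p` and `n`: the points of the triangle `pvn` that are closer
to `v` than any other vertex in this triangle are not on the polygon.  The functions `α`, `β` are
the coordinates of a point with respect to `v` and the two edges at `v`. -/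
theorem Simple.ear_free (hR : GP R) {L : List ι} (hL : Simple R L) (h4 : 4 ≤ L.length) {p v n : ι}
    (hp : (p, v) ∈ cyc L) (hn : (v, n) ∈ cyc L) {α β : ℂ → ℝ}
    (hα : α = fun z => cr (z - R v) (R n - R v) / cr (R p - R v) (R n - R v))
    (hβ : β = fun z => cr (R p - R v) (z - R v) / cr (R p - R v) (R n - R v))
    {y : ℂ} (hy1 : 0 < α y) (hy2 : 0 < β y) (hy3 : α y + β y ≤ 1)
    (hS : ∀ x ∈ L, x ≠ p → x ≠ v → x ≠ n → 0 ≤ α (R x) → 0 ≤ β (R x) → α (R x) + β (R x) ≤ 1 →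
      α y + β y < α (R x) + β (R x)) : y ∉ bd R L := by
  have hpn := hL.prev_ne_next hp hn
  have hpv := hL.ne hp
  have hvn := hL.ne hn
  have hk : cr (R p - R v) (R n - R v) ≠ 0 := by
    have := hR.noncol v p n hpv.symm hvn hpn
    rwa [ori] at this
  set p' := R p - R v with hp'
  set n' := R n - R v with hn'
  have hrec : ∀ z, z = R v + α z * p' + β z * n' := by
    intro z
    have h := cr_expand_vec n' p' (z - R v)
    have hk' : (cr p' n' : ℂ) ≠ 0 := by exact_mod_cast hk
    rw [hα, hβ]
    push_cast
    field_simp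
    linear_combination h
  have hαa : ∀ (a b : ℂ) (t : ℝ), α (a + t * (b - a)) = α a + t * (α b - α a) := by
    intro a b t; rw [hα]; simp only [cr]; field_simp; simp; ring
  have hβa : ∀ (a b : ℂ) (t : ℝ), β (a + t * (b - a)) = β a + t * (β b - β a) := by
    intro a b t; rw [hβ]; simp only [cr]; field_simp; simp; ring
  have αp : α (R p) = 1 := by rw [hα]; exact div_self hk
  have βp : β (R p) = 0 := by rw [hβ]; simp only [← hp', cr_self, zero_div]
  have αn : α (R n) = 0 := by rw [hα]; simp only [← hn', cr_self, zero_div]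
  have βn : β (R n) = 1 := by rw [hβ]; exact div_self hk
  have αv : α (R v) = 0 := by rw [hα]; simp [cr]
  have βv : β (R v) = 0 := by rw [hβ]; simp [cr]
  have hsv : ∀ z, α z = 0 → 0 ≤ β z → β z ≤ 1 → z ∈ segment ℝ (R v) (R n) := by
    intro z h1 h2 h3
    rw [hrec z, h1]
    simpa using param_mem_segment h2 h3
  have hsp : ∀ z, β z = 0 → 0 ≤ α z → α z ≤ 1 → z ∈ segment ℝ (R p) (R v) := by
    intro z h1 h2 h3
    rw [hrec z, h1, segment_symm]
    simpa using param_mem_segment h2 h3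
  -- no edge with an end `c` at least as close to `v` as `y`
  have main : ∀ c d, ((c, d) ∈ cyc L ∨ (d, c) ∈ cyc L) → y ∈ segment ℝ (R c) (R d) →
      α (R c) + β (R c) ≤ α y + β y → False := by
    intro c d hcd hy hle
    obtain ⟨t, ht0, ht1, hyt⟩ := mem_segment_param hy
    have hyα := hαa (R c) (R d) t
    have hyβ := hβa (R c) (R d) t
    rw [← hyt] at hyα hyβ
    have hcv : c ≠ v := by
      rintro rfl
      rcases hcd with h | h
      · rw [next_unique hL.nodup h hn, αn] at hyα
        rw [αv] at hyα; linarith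
      · rw [prev_unique hL.nodup h hp, βp] at hyβ
        rw [βv] at hyβ; linarith
    have hdv : d ≠ v := by
      rintro rfl
      rcases hcd with h | h
      · rw [prev_unique hL.nodup h hp, βp] at hyβ
        rw [βv] at hyβ; linarith
      · rw [next_unique hL.nodup h hn, αn] at hyα
        rw [αv] at hyα; linarith
    have hnp : (n, p) ∉ cyc L := by
      intro h
      obtain ⟨l, hl⟩ := exists_rot_edge hL.nodup (by omega) hn
      have hlen := hl.1.length_eq
      have hnd := hl.nodup hL.nodup
      match l, hl, hlen, hnd with
      | [], _, hlen, _ => simp at hlen; omega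
      | [a], _, hlen, _ => simp at hlen; omega
      | a :: b :: l, hl, _, hnd =>
        have e1 : p = a := next_unique hnd (hl.mem_cyc.1 h) (by simp [cyc, path])
        subst e1
        have e2 : v = b := next_unique hnd (hl.mem_cyc.1 hp) (by simp [cyc, path])
        subst e2
        simp at hnd
    have hpn' : (p, n) ∉ cyc L := fun h => hvn (next_unique hL.nodup hp h)
    have hcp : c ≠ p := by
      rintro rfl
      rw [αp] at hyα hle
      rw [βp] at hyβ hle
      have h1 : t * (α (R d) + β (R d) - 1) = 0 := by linarith
      rcases mul_eq_zero.1 h1 with h1 | h1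
      · rw [h1] at hyβ; linarith
      · have hdc : d ≠ c := by
          rintro rfl; rw [βp] at hyβ; linarith
        by_cases hdn : d = n
        · subst hdn
          rcases hcd with h | h
          · exact hpn' h
          · exact hnp h
        · apply hR.noncol c n d hpn hdc.symm (Ne.symm hdn)
          have hd := hrec (R d)
          have h2 : α (R d) = 1 - β (R d) := by linarith
          have hc' : R c = R v + p' := by rw [hp']; ring
          have hn'' : R n = R v + n' := by rw [hn']; ring
          rw [ori, hd, hc', hn'', h2]
          simp [cr]; ring
    have hcn : c ≠ n := by
      rintro rfl
      rw [αn] at hyα hle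
      rw [βn] at hyβ hle
      have h1 : t * (α (R d) + β (R d) - 1) = 0 := by linarith
      rcases mul_eq_zero.1 h1 with h1 | h1
      · rw [h1] at hyα; linarith
      · have hdc : d ≠ c := by
          rintro rfl; rw [αn] at hyα; linarith
        by_cases hdn : d = p
        · subst hdn
          rcases hcd with h | h
          · exact hnp h
          · exact hpn' h
        · apply hR.noncol c p d hpn.symm hdc.symm (Ne.symm hdn)
          have hd := hrec (R d)
          have h2 : α (R d) = 1 - β (R d) := by linarith
          have hc' : R c = R v + n' := by rw [hn']; ring
          have hn'' : R p = R v + p' := by rw [hp']; ring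
          rw [ori, hd, hc', hn'', h2]
          simp [cr]; ring
    have hcL : c ∈ L := by
      rcases hcd with h | h
      · exact (mem_of_mem_cyc h).1
      · exact (mem_of_mem_cyc h).2
    -- By the choice of `y`, no vertex as close to `v` as `y` lies in the triangle, so `c` lies
    -- outside the sector at `v`.
    have hout : α (R c) < 0 ∨ β (R c) < 0 := by
      by_contra! h
      have := hS c hcL hcp hcv hcn h.1 h.2 (by linarith)
      linarith
    obtain ⟨s, hs0, hs1, hsa, hsb, hs⟩ := exists_exit hy1 hy2 hout
    set z := y + s * (R c - y) with hz
    have hzα := hαa y (R c) s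
    have hzβ := hβa y (R c) s
    rw [← hz] at hzα hzβ
    rw [← hzα] at hsa
    rw [← hzβ] at hsb
    rw [← hzα, ← hzβ] at hs
    have hzf : α z + β z ≤ 1 := by
      rw [hzα, hzβ]; nlinarith
    have hzcd : z ∈ segment ℝ (R c) (R d) := by
      have : z = R c + ((t * (1 - s) : ℝ) : ℂ) * (R d - R c) := by
        rw [hz, hyt]; push_cast; ring
      rw [this]
      exact param_mem_segment (mul_nonneg ht0 (by linarith)) (by nlinarith)
    -- the exit point is not the other end
    have hzd : z ≠ R d := by
      intro h
      have h1 : ((t * (1 - s) - 1 : ℝ) : ℂ) * (R d - R c) = 0 := by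
        have : z = R c + ((t * (1 - s) : ℝ) : ℂ) * (R d - R c) := by
          rw [hz, hyt]; push_cast; ring
        push_cast at this ⊢
        linear_combination h - this
      have hdc : R d ≠ R c := by
        apply hR.inj.ne
        rintro rfl
        rcases hcd with h | h <;> exact hL.ne h rfl
      rcases mul_eq_zero.1 h1 with h1 | h1
      · have h2 : t * (1 - s) - 1 = 0 := by exact_mod_cast h1
        have hs00 : s = 0 := by nlinarith
        rw [hs00] at hzα hzβ
        rcases hs with hs | hs <;> linarith
      · exact hdc (sub_eq_zero.1 h1)
    have hmeet : ∀ a b, (a, b) ∈ cyc L → z ∈ segment ℝ (R a) (R b) → c ≠ a → c ≠ b → False := by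
      intro a b hab hzab hca hcb
      rcases hcd with h | h
      · have hne : (c, d) ≠ (a, b) := fun h => hca (congrArg Prod.fst h)
        rcases hL.inter hR h hab hne hzcd hzab with ⟨h, -⟩ | ⟨-, h⟩
        · exact hcb h
        · exact hzd h
      · have hne : (d, c) ≠ (a, b) := fun h => hcb (congrArg Prod.snd h)
        rw [segment_symm] at hzcd
        rcases hL.inter hR h hab hne hzcd hzab with ⟨-, h⟩ | ⟨h, -⟩
        · exact hzd h
        · exact hca h
    -- Going from `y` to `c` the edge leaves the sector at level at most `1`, hence through one of
    -- the two edges at `v`, which a simple polygon forbids.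
    rcases hs with hs | hs
    · exact hmeet v n hn (hsv z hs hsb (by linarith)) hcv hcn
    · exact hmeet p v hp (hsp z hs hsa (by linarith)) hcp hcv
  rintro ⟨⟨c, d⟩, hcd, hy⟩
  obtain ⟨t, ht0, ht1, hyt⟩ := mem_segment_param hy
  have hyα := hαa (R c) (R d) t
  have hyβ := hβa (R c) (R d) t
  simp only at hyt
  rw [← hyt] at hyα hyβ
  -- The level `α + β` is affine along an edge, so one of its ends is at most as high as `y`.
  rcases le_or_gt (α (R c) + β (R c)) (α y + β y) with h | h
  · exact main c d (Or.inl hcd) hy h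
  · refine main d c (Or.inr hcd) (by rwa [segment_symm]) ?_
    have e : α y + β y = (1 - t) * (α (R c) + β (R c)) + t * (α (R d) + β (R d)) := by
      rw [hyα, hyβ]; ring
    by_contra! h'
    rcases ht0.eq_or_lt with rfl | ht0
    · linarith
    · nlinarith [mul_pos ht0 (sub_pos.2 h'), mul_nonneg (sub_nonneg.2 ht1) (sub_pos.2 h).le]

end PlanarCycle

/-! ### Diagonals at a vertex and the Jordan curve theorem. -/

namespace PlanarCycle

variable {ι : Type*} {R : ι → ℂ}

/-- At every vertex of a simple polygon there is a convex region, free of points of the polygon, that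
contains an open diagonal and points arbitrarily close to the vertex. -/
theorem Simple.exists_region (hR : GP R) {L : List ι} (hL : Simple R L) (h4 : 4 ≤ L.length)
    {p v n : ι} (hp : (p, v) ∈ cyc L) (hn : (v, n) ∈ cyc L) :
    ∃ u ∈ L, ∃ w ∈ L, u ≠ w ∧ ∃ C : Set ℂ, Convex ℝ C ∧ Disjoint C (bd R L) ∧
      openSegment ℝ (R u) (R w) ⊆ C ∧
      ∀ᶠ ε : ℝ in 𝓝[>] 0, R v + ε * ((R n - R v) + (R p - R v)) ∈ C := by
  classical
  have hpn := hL.prev_ne_next hp hn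
  have hpv := hL.ne hp
  have hvn := hL.ne hn
  have hk : cr (R p - R v) (R n - R v) ≠ 0 := by
    have := hR.noncol v p n hpv.symm hvn hpn
    rwa [ori] at this
  obtain ⟨α, hα⟩ : ∃ α : ℂ → ℝ, α = fun z => cr (z - R v) (R n - R v) / cr (R p - R v) (R n - R v) :=
    ⟨_, rfl⟩
  obtain ⟨β, hβ⟩ : ∃ β : ℂ → ℝ, β = fun z => cr (R p - R v) (z - R v) / cr (R p - R v) (R n - R v) :=
    ⟨_, rfl⟩
  have hαa : ∀ (a b : ℂ) (t : ℝ), α (a + t * (b - a)) = α a + t * (α b - α a) := by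
    intro a b t; rw [hα]; simp only [cr]; field_simp; simp; ring
  have hβa : ∀ (a b : ℂ) (t : ℝ), β (a + t * (b - a)) = β a + t * (β b - β a) := by
    intro a b t; rw [hβ]; simp only [cr]; field_simp; simp; ring
  have αp : α (R p) = 1 := by rw [hα]; exact div_self hk
  have βp : β (R p) = 0 := by rw [hβ]; simp only [cr_self, zero_div]
  have αn : α (R n) = 0 := by rw [hα]; simp only [cr_self, zero_div]
  have βn : β (R n) = 1 := by rw [hβ]; exact div_self hk
  have αv : α (R v) = 0 := by rw [hα]; simp [cr]
  have βv : β (R v) = 0 := by rw [hβ]; simp [cr]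
  set S : Finset ι := L.toFinset.filter fun x => x ≠ p ∧ x ≠ v ∧ x ≠ n ∧ 0 ≤ α (R x) ∧ 0 ≤ β (R x) ∧
    α (R x) + β (R x) ≤ 1 with hSdef
  have hSmem : ∀ x, x ∈ S ↔ x ∈ L ∧ x ≠ p ∧ x ≠ v ∧ x ≠ n ∧ 0 ≤ α (R x) ∧ 0 ≤ β (R x) ∧
      α (R x) + β (R x) ≤ 1 := by
    intro x; simp [hSdef]
  have hpos : ∀ x ∈ S, 0 < α (R x) ∧ 0 < β (R x) := by
    intro x hx
    obtain ⟨-, h1, h2, h3, h4, h5, -⟩ := (hSmem x).1 hx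
    constructor
    · refine lt_of_le_of_ne h4 fun h => ?_
      have h' : cr (R x - R v) (R n - R v) = 0 := by
        rw [hα] at h
        exact (div_eq_zero_iff.1 h.symm).resolve_right hk
      exact hR.noncol v x n h2.symm hvn h3 h'
    · refine lt_of_le_of_ne h5 fun h => ?_
      have h' : cr (R p - R v) (R x - R v) = 0 := by
        rw [hβ] at h
        exact (div_eq_zero_iff.1 h.symm).resolve_right hk
      exact hR.noncol v p x hpv.symm h2.symm h1.symm h'
  have region : ∀ m : ℝ, 0 < m → (∀ x ∈ S, m ≤ α (R x) + β (R x)) →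
      ∃ C : Set ℂ, C = {z | 0 < α z ∧ 0 < β z ∧ α z + β z ≤ 1 ∧ α z + β z < m} ∧
      Convex ℝ C ∧ Disjoint C (bd R L) ∧
      ∀ᶠ ε : ℝ in 𝓝[>] 0, R v + ε * ((R n - R v) + (R p - R v)) ∈ C := by
    intro m hm hmS
    refine ⟨_, rfl, ?_, ?_, ?_⟩
    · rw [convex_iff_openSegment_subset]
      rintro a ⟨a1, a2, a3, a4⟩ b ⟨b1, b2, b3, b4⟩ z hz
      obtain ⟨t, t0, t1, rfl⟩ := mem_openSegment_param hz
      simp only [Set.mem_ofPred_eq]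
      rw [hαa, hβa]
      have t1' := sub_pos.2 t1
      refine ⟨?_, ?_, ?_, ?_⟩
      · nlinarith [mul_pos t0 b1, mul_pos t1' a1]
      · nlinarith [mul_pos t0 b2, mul_pos t1' a2]
      · nlinarith
      · nlinarith [mul_pos t0 (sub_pos.2 b4), mul_pos t1' (sub_pos.2 a4)]
    · rw [Set.disjoint_left]
      rintro z ⟨z1, z2, z3, z4⟩
      refine hL.ear_free hR h4 hp hn hα hβ z1 z2 z3 fun x hx h1 h2 h3 h4 h5 h6 => ?_
      exact z4.trans_le (hmS x ((hSmem x).2 ⟨hx, h1, h2, h3, h4, h5, h6⟩))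
    · have h1 : ∀ᶠ ε : ℝ in 𝓝[>] (0:ℝ), 0 < ε := self_mem_nhdsWithin
      have h2 : ∀ᶠ ε : ℝ in 𝓝[>] (0:ℝ), ε < min (1 / 2) (m / 2) :=
        nhdsWithin_le_nhds (Iio_mem_nhds (by positivity))
      filter_upwards [h1, h2] with ε h1 h2
      have e1 : α (R v + ε * ((R n - R v) + (R p - R v))) = ε := by
        rw [hα]; beta_reduce; rw [div_eq_iff hk]; simp [cr]; ring
      have e2 : β (R v + ε * ((R n - R v) + (R p - R v))) = ε := by
        rw [hβ]; beta_reduce; rw [div_eq_iff hk]; simp [cr]; ring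
      rw [e1, e2]
      rw [lt_min_iff] at h2
      exact ⟨h1, h1, by linarith, by linarith⟩
  -- If the triangle contains no other vertex, the diagonal joins the neighbours; the bound `2` then
  -- imposes nothing beyond `α + β ≤ 1`. Otherwise it joins `v` to a vertex of least level.
  rcases S.eq_empty_or_nonempty with hS | hS
  · obtain ⟨C, hC, c1, c2, c3⟩ := region 2 (by norm_num) (by simp [hS])
    refine ⟨p, (mem_of_mem_cyc hp).1, n, (mem_of_mem_cyc hn).2, hpn, C, c1, c2, ?_, c3⟩
    intro z hz
    obtain ⟨t, t0, t1, rfl⟩ := mem_openSegment_param hz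
    rw [hC]
    simp only [Set.mem_ofPred_eq]
    rw [hαa, hβa, αp, βp, αn, βn]
    exact ⟨by linarith, by linarith, by linarith, by linarith⟩
  · obtain ⟨x, hx, hmin⟩ := Finset.exists_min_image S (fun x => α (R x) + β (R x)) hS
    obtain ⟨x1, x2⟩ := hpos x hx
    obtain ⟨hxL, -, hxv, -, -, -, hx3⟩ := (hSmem x).1 hx
    obtain ⟨C, hC, c1, c2, c3⟩ := region (α (R x) + β (R x)) (by linarith) hmin
    refine ⟨v, (mem_of_mem_cyc hp).2, x, hxL, hxv.symm, C, c1, c2, ?_, c3⟩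
    intro z hz
    obtain ⟨t, t0, t1, rfl⟩ := mem_openSegment_param hz
    rw [hC]
    simp only [Set.mem_ofPred_eq]
    rw [hαa, hβa, αv, βv]
    have := mul_pos t0 x1
    have := mul_pos t0 x2
    refine ⟨by linarith, by linarith, by nlinarith, by nlinarith⟩

/-- The Jordan curve theorem for simple polygons in general position. -/
theorem Simple.oriented (hR : GP R) {L : List ι} (hL : Simple R L) : ∃ σ, Oriented R L σ := by
  induction hlen : L.length using Nat.strong_induction_on generalizing L with
  | _ k ih =>
  subst hlen
  have h3 := hL.three_le
  rcases h3.eq_or_lt with h3 | h4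
  · match L, h3 with
    | [a, b, c], _ => exact triangle_oriented hR hL
  -- Any vertex will do: the diagonal only has to miss the boundary, and may run outside the
  -- polygon.
  · obtain ⟨v, hv⟩ : ∃ v, v ∈ L := List.exists_mem_of_ne_nil L (by rintro rfl; simp at h4)
    obtain ⟨p, hp⟩ := exists_prev hv
    obtain ⟨n, hn⟩ := exists_next hv
    obtain ⟨u, hu, w, hw, huw, C, -, hC, hsub, -⟩ := hL.exists_region hR h4 hp hn
    obtain ⟨l₁, l₂, hr⟩ := exists_rot_two hu hw huw
    have hL' := hr.simple hL
    have hf : Free R (u :: l₁ ++ w :: l₂) u w := by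
      rw [Free, ← hr.bd]; exact hC.mono_left hsub
    obtain ⟨s1, s2⟩ := hL'.cut hR hf
    obtain ⟨n1, n2⟩ := hf.ne_nil
    have hlen := hr.1.length_eq
    have := List.length_pos_iff.2 n1
    have := List.length_pos_iff.2 n2
    simp at hlen
    obtain ⟨σ₁, o1⟩ := ih _ (by simp; omega) s1 rfl
    obtain ⟨σ₂, o2⟩ := ih _ (by simp; omega) s2 rfl
    obtain ⟨v, hv, hvu, hvw⟩ := exists_extreme hR hL.nodup hL.three_le huw
    obtain ⟨σ, hσ⟩ := hL'.oriented_of_cut hR hf o1 o2 (hr.extreme hv) hvu hvw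
    exact ⟨σ, hr.symm.oriented hσ⟩

/-! ### Corners and interior diagonals -/

variable (R) in
/-- The corners (convex vertices) of a polygon of orientation `σ`. -/
def Corner (σ : ℝ) (L : List ι) : Set ι :=
  {x | ∃ p n, (p, x) ∈ cyc L ∧ (x, n) ∈ cyc L ∧ 0 < σ * ori R p x n}

theorem Simple.mem_corner {L : List ι} (hL : Simple R L) {σ : ℝ} {p x n : ι}
    (hp : (p, x) ∈ cyc L) (hn : (x, n) ∈ cyc L) : x ∈ Corner R σ L ↔ 0 < σ * ori R p x n := by
  constructor
  · rintro ⟨p', n', hp', hn', h⟩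
    rwa [prev_unique hL.nodup hp hp', next_unique hL.nodup hn hn']
  · exact fun h => ⟨p, n, hp, hn, h⟩

theorem corner_subset (σ : ℝ) (L : List ι) : Corner R σ L ⊆ {x | x ∈ L} := by
  rintro x ⟨p, n, hp, -, -⟩
  exact (mem_of_mem_cyc hp).2

theorem finite_corner (σ : ℝ) (L : List ι) : (Corner R σ L).Finite :=
  (List.finite_toSet L).subset (corner_subset σ L)

theorem Rot.corner {L L' : List ι} (h : Rot L L') (σ : ℝ) : Corner R σ L = Corner R σ L' := by
  ext x
  simp only [Corner, Set.mem_ofPred_eq, h.mem_cyc]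

theorem Oriented.ori_ne (hR : GP R) {L : List ι} {σ : ℝ} (hL : Oriented R L σ) {p x n : ι}
    (hp : (p, x) ∈ cyc L) (hn : (x, n) ∈ cyc L) : σ * ori R p x n ≠ 0 :=
  mul_ne_zero hL.sign_ne
    (hR.noncol p x n (hL.simple.ne hp) (hL.simple.prev_ne_next hp hn) (hL.simple.ne hn))

/-- At a reflex vertex the backward prolongation of an incident edge starts into the interior. At an
extreme vertex it starts beyond the supporting line, where the angle function is zero. -/
theorem Oriented.extreme_corner (hR : GP R) {L : List ι} {σ : ℝ} (hL : Oriented R L σ) {v : ι}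
    (hv : Extreme R L v) : v ∈ Corner R σ L := by
  obtain ⟨p, hp⟩ := exists_prev hv.1
  obtain ⟨n, hn⟩ := exists_next hv.1
  rw [hL.simple.mem_corner hp hn]
  refine lt_of_le_of_ne ?_ (hL.ori_ne hR hp hn).symm
  by_contra! hneg
  have hvn := hL.simple.ne hn
  have hk := hR.noncol p v n (hL.simple.ne hp) (hL.simple.prev_ne_next hp hn) hvn
  obtain ⟨e, he⟩ := hv.2
  rw [ori_eq] at hneg hk
  have hn0 : R n - R v ≠ 0 := sub_ne_zero.2 (hR.inj.ne hvn.symm)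
  have hmem := hL.sector_mem hR hp hn (e := -(R n - R v)) (offRay_neg hn0)
    (offRay_of_cr_ne_zero (by rw [cr_neg_right, cr_swap, neg_neg]; exact hk))
    (Or.inr ⟨hneg, Or.inr (by rw [cr_neg_left]; linarith)⟩)
  have hpos : ∀ᶠ ε : ℝ in 𝓝[>] (0:ℝ), 0 < ε := self_mem_nhdsWithin
  obtain ⟨ε, h1, h2⟩ := (hmem.and hpos).exists
  refine h1.2 (wind_zero_of_halfplane (e := e) fun x hx => ?_).2
  have hnm := he n (mem_of_mem_cyc hn).2 hvn.symm
  have : R x - (R v + ε * -(R n - R v)) = (R x - R v) + ε * (R n - R v) := by ring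
  rw [this, cr_add_right, cr_smul_right]
  have := mul_pos h2 hnm
  by_cases hxv : x = v
  · subst hxv
    have : cr e (R x - R x) = 0 := by simp [cr]
    linarith
  · have := he x hx hxv
    linarith

/-- Extreme vertices are corners, and one can always be found away from two given vertices. This
lower bound drives all the corner counts. -/
theorem Oriented.three_le_corner (hR : GP R) {L : List ι} {σ : ℝ} (hL : Oriented R L σ) :
    3 ≤ (Corner R σ L).ncard := by
  have hnd := hL.simple.nodup
  have h3 := hL.simple.three_le
  obtain ⟨a, ha⟩ : ∃ a, a ∈ L := List.exists_mem_of_ne_nil L (by rintro rfl; simp at h3)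
  obtain ⟨b, -, hb, -⟩ := exists_mem_ne_ne hnd h3 a a
  obtain ⟨v₁, e₁, -, -⟩ := exists_extreme hR hnd h3 hb
  obtain ⟨b', -, hb', -⟩ := exists_mem_ne_ne hnd h3 v₁ v₁
  obtain ⟨v₂, e₂, -, h12⟩ := exists_extreme hR hnd h3 hb'
  obtain ⟨v₃, e₃, h31, h32⟩ := exists_extreme hR hnd h3 h12.symm
  have : 2 < (Corner R σ L).ncard := by
    rw [Set.two_lt_ncard_iff (finite_corner σ L)]
    exact ⟨v₁, v₂, v₃, hL.extreme_corner hR e₁, hL.extreme_corner hR e₂, hL.extreme_corner hR e₃,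
      h12.symm, h31.symm, h32.symm⟩
  omega

variable (R) in
/-- An interior diagonal of a polygon. -/
structure IDiag (L : List ι) (u w : ι) : Prop where
  left_mem : u ∈ L
  right_mem : w ∈ L
  ne : u ≠ w
  sub : openSegment ℝ (R u) (R w) ⊆ inside R L

theorem IDiag.symm {L : List ι} {u w : ι} (h : IDiag R L u w) : IDiag R L w u :=
  ⟨h.right_mem, h.left_mem, h.ne.symm, by rw [openSegment_symm]; exact h.sub⟩

theorem IDiag.free {L : List ι} {u w : ι} (h : IDiag R L u w) : Free R L u w :=
  Set.disjoint_left.2 fun _ hz => (h.sub hz).1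

theorem Rot.idiag {L L' : List ι} {u w : ι} (hr : Rot L L') (h : IDiag R L u w) :
    IDiag R L' u w :=
  ⟨hr.mem_iff.1 h.left_mem, hr.mem_iff.1 h.right_mem, h.ne, hr.inside (R := R) ▸ h.sub⟩

/-- Uses the region of `Simple.exists_region` at an extreme vertex. The vertex is a corner, so
points of the region close to it are interior; the region is connected and misses the boundary, so
all of it is interior. -/
theorem Oriented.exists_idiag (hR : GP R) {L : List ι} {σ : ℝ} (hL : Oriented R L σ)
    (h4 : 4 ≤ L.length) : ∃ u w, IDiag R L u w := by
  have hnd := hL.simple.nodup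
  obtain ⟨a, ha⟩ : ∃ a, a ∈ L := List.exists_mem_of_ne_nil L (by rintro rfl; simp at h4)
  obtain ⟨b, -, hb, -⟩ := exists_mem_ne_ne hnd (by omega) a a
  obtain ⟨v, hv, -, -⟩ := exists_extreme hR hnd (by omega) hb
  have hc := hL.extreme_corner hR hv
  obtain ⟨p, hp⟩ := exists_prev hv.1
  obtain ⟨n, hn⟩ := exists_next hv.1
  rw [hL.simple.mem_corner hp hn, ori_eq] at hc
  obtain ⟨u, hu, w, hw, huw, C, hconv, hdis, hsub, hev⟩ := hL.simple.exists_region hR h4 hp hn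
  refine ⟨u, w, hu, hw, huw, fun z hz => ?_⟩
  set n' := R n - R v
  set p' := R p - R v
  have hk : cr n' p' ≠ 0 := fun h => by rw [h, mul_zero] at hc; exact lt_irrefl _ hc
  have c1 : cr n' (n' + p') = cr n' p' := by rw [cr_add_right, cr_self, zero_add]
  have c2 : cr (n' + p') p' = cr n' p' := by simp [cr]; ring
  have hin := hL.sector_mem hR hp hn (e := n' + p') (offRay_of_cr_ne_zero (by rwa [c1]))
    (offRay_of_cr_ne_zero (by rw [cr_swap, c2]; exact neg_ne_zero.2 hk))
    (Or.inl ⟨hc, by rwa [c1], by rwa [c2]⟩)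
  obtain ⟨ε, h1, h2⟩ := (hin.and hev).exists
  refine ⟨Set.disjoint_left.1 hdis (hsub hz), ?_⟩
  rw [wind_eq_of_isPreconnected hconv.isPreconnected hdis (hsub hz) h2]
  exact h1.2

theorem Oriented.exists_inside_near (hR : GP R) {L : List ι} {σ : ℝ} (hL : Oriented R L σ) {z : ℂ}
    (hz : z ∈ bd R L) {U : Set ℂ} (hU : IsOpen U) (hzU : z ∈ U) : ∃ y ∈ U, y ∈ inside R L := by
  obtain ⟨⟨a, b⟩, he, hz⟩ := hz
  rw [← closure_openSegment, mem_closure_iff] at hz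
  obtain ⟨m, hmU, hm⟩ := hz U hU hzU
  have hev := (tendsto_line m (σ * (Complex.I * (R b - R a)))).eventually (hU.mem_nhds hmU)
  obtain ⟨δ, h1, h2⟩ := (hev.and (hL.edge hR he hm)).exists
  refine ⟨_, h1, h2.1.1, ?_⟩
  rw [h2.1.2]
  have := hL.sign_ne
  positivity

/-- Cutting a polygon along an interior diagonal. -/
theorem Oriented.cut (hR : GP R) {u w : ι} {l₁ l₂ : List ι} {σ : ℝ}
    (hL : Oriented R (u :: l₁ ++ w :: l₂) σ) (hd : IDiag R (u :: l₁ ++ w :: l₂) u w) :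
    (Oriented R (u :: l₁ ++ [w]) σ ∧ Oriented R (u :: w :: l₂) σ) ∧
      (inside R (u :: l₁ ++ [w]) ⊆ inside R (u :: l₁ ++ w :: l₂) ∧
        inside R (u :: w :: l₂) ⊆ inside R (u :: l₁ ++ w :: l₂)) ∧
      Disjoint (inside R (u :: l₁ ++ [w])) (inside R (u :: w :: l₂)) ∧
      ∀ z ∈ inside R (u :: l₁ ++ w :: l₂), z ∉ openSegment ℝ (R u) (R w) →
        z ∈ inside R (u :: l₁ ++ [w]) ∨ z ∈ inside R (u :: w :: l₂) := by
  have hf := hd.free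
  obtain ⟨s1, s2⟩ := hL.simple.cut hR hf
  obtain ⟨σ₁, o1⟩ := s1.oriented hR
  obtain ⟨σ₂, o2⟩ := s2.oriented hR
  have hpi := Real.pi_pos
  have hne : σ * (2 * Real.pi) ≠ 0 := mul_ne_zero hL.sign_ne (by positivity)
  obtain ⟨m, hm⟩ := openSegment_nonempty (R u) (R w)
  have hmin := hd.sub hm
  obtain ⟨y, y', hy, hy', ⟨a1, a2⟩, a3, a4, ⟨b1, b2⟩, b3, b4⟩ :=
    diag_sides hR o1 o2 hm (wind_eventually hmin.1)
  have hy2 := hy.2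
  rw [wind_cut u l₁ w l₂ (notMem_bd_of_cut a1 a2).2, a3, a4, hL.wind_eq hmin] at hy2
  -- With opposite orientations both parts would have angle zero on one side of the diagonal,
  -- although the diagonal runs through the interior of the whole.
  have hs : σ₁ = σ₂ := by
    by_contra hs
    rw [if_neg hs] at hy2
    exact hne (by linarith)
  subst hs
  rw [if_pos rfl, zero_add] at hy2
  have hs : σ₁ = σ := mul_right_cancel₀ (by positivity) hy2
  subst hs
  -- A common interior point would have total angle `4πσ` in the whole polygon.
  have hdis : ∀ z, z ∈ inside R (u :: l₁ ++ [w]) → z ∈ inside R (u :: w :: l₂) → False := by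
    intro z h1 h2
    have h := notMem_bd_of_cut h1.1 h2.1
    have h' := hL.wind_mem z h.1
    rw [wind_cut u l₁ w l₂ h.2, o1.wind_eq h1, o2.wind_eq h2] at h'
    rcases h' with h' | h'
    · exact hne (by linarith)
    · exact hne (by linarith)
  refine ⟨⟨o1, o2⟩, ⟨?_, ?_⟩, Set.disjoint_left.2 hdis, ?_⟩
  · intro z hz
    have hz2 : z ∉ bd R (u :: w :: l₂) := fun h => by
      obtain ⟨y, hy1, hy2⟩ := o2.exists_inside_near hR h (isOpen_inside _) hz
      exact hdis y hy1 hy2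
    have h := notMem_bd_of_cut hz.1 hz2
    refine ⟨h.1, ?_⟩
    rw [wind_cut u l₁ w l₂ h.2]
    have hw2 : wind R (u :: w :: l₂) z = 0 := by
      by_contra h0
      exact hdis z hz ⟨hz2, h0⟩
    rw [hw2, add_zero]
    exact hz.2
  · intro z hz
    have hz2 : z ∉ bd R (u :: l₁ ++ [w]) := fun h => by
      obtain ⟨y, hy1, hy2⟩ := o1.exists_inside_near hR h (isOpen_inside _) hz
      exact hdis y hy2 hy1
    have h := notMem_bd_of_cut hz2 hz.1
    refine ⟨h.1, ?_⟩
    rw [wind_cut u l₁ w l₂ h.2]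
    have hw2 : wind R (u :: l₁ ++ [w]) z = 0 := by
      by_contra h0
      exact hdis z ⟨hz2, h0⟩ hz
    rw [hw2, zero_add]
    exact hz.2
  · intro z hz hzd
    have hzs : z ∉ segment ℝ (R u) (R w) := by
      intro h
      have hzu : R u ≠ z := by rintro rfl; exact hz.1 (vertex_mem_bd (by simp))
      have hzw : R w ≠ z := by rintro rfl; exact hz.1 (vertex_mem_bd (by simp))
      exact hzd (mem_openSegment_of_ne_left_right hzu hzw h)
    have h := notMem_bd_cut hz.1 hzs
    have hw := hz.2
    rw [wind_cut u l₁ w l₂ hzs] at hw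
    by_cases h0 : wind R (u :: l₁ ++ [w]) z = 0
    · rw [h0, zero_add] at hw
      exact Or.inr ⟨h.2, hw⟩
    · exact Or.inl ⟨h.1, h0⟩

end PlanarCycle

namespace PlanarCycle

variable {ι : Type*} {R : ι → ℂ}

/-! ### Counting corners -/

theorem mem_cyc_left_iff {u w : ι} {l₁ l₂ : List ι} (hnd : (u :: l₁ ++ w :: l₂).Nodup) {x y : ι}
    (hx : x ∈ l₁) :
    ((y, x) ∈ cyc (u :: l₁ ++ [w]) ↔ (y, x) ∈ cyc (u :: l₁ ++ w :: l₂)) ∧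
      ((x, y) ∈ cyc (u :: l₁ ++ [w]) ↔ (x, y) ∈ cyc (u :: l₁ ++ w :: l₂)) := by
  rw [List.cons_append, List.nodup_cons, List.nodup_append, List.nodup_cons] at hnd
  obtain ⟨hu, -, ⟨hw2, -⟩, hdis⟩ := hnd
  have hxu : x ≠ u := by rintro rfl; exact hu (by simp [hx])
  have hxw : x ≠ w := by rintro rfl; exact hdis x hx x (by simp) rfl
  have hx2 : x ∉ l₂ := fun h => hdis x hx x (by simp [h]) rfl
  rw [cyc_left, cyc_split]
  simp only [List.mem_append, List.mem_singleton, Prod.mk.injEq, hxu, hxw, and_false, false_and,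
    or_false]
  constructor
  · refine ⟨Or.inl, fun h => h.resolve_right fun h => ?_⟩
    have := (path_mem h).2
    simp [hxu, hx2] at this
  · refine ⟨Or.inl, fun h => h.resolve_right fun h => ?_⟩
    have := (path_mem h).1
    simp [hxu, hxw, hx2] at this

theorem mem_cyc_right_iff {u w : ι} {l₁ l₂ : List ι} (hnd : (u :: l₁ ++ w :: l₂).Nodup) {x y : ι}
    (hx : x ∈ l₂) :
    ((y, x) ∈ cyc (u :: w :: l₂) ↔ (y, x) ∈ cyc (u :: l₁ ++ w :: l₂)) ∧
      ((x, y) ∈ cyc (u :: w :: l₂) ↔ (x, y) ∈ cyc (u :: l₁ ++ w :: l₂)) := by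
  have hr := rot_swap u l₁ w l₂
  have h := mem_cyc_left_iff (hr.nodup hnd) (y := y) hx
  rw [(rot_right u w l₂).mem_cyc, (rot_right u w l₂).mem_cyc, hr.mem_cyc, hr.mem_cyc]
  exact h

theorem ncard_eq_diff_pair {S : Set ι} (hS : S.Finite) {u w : ι} (huw : u ≠ w) :
    open Classical in
    S.ncard = (S \ {u, w}).ncard + ((if u ∈ S then 1 else 0) + if w ∈ S then 1 else 0) := by
  classical
  have h1 := Set.ncard_inter_add_ncard_sdiff_eq_ncard S {u, w} hS
  rw [← h1, add_comm]
  congr 1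
  by_cases hu : u ∈ S <;> by_cases hw : w ∈ S
  · rw [Set.inter_eq_right.2 (by rintro x (rfl | rfl) <;> assumption), Set.ncard_pair huw]
    simp [hu, hw]
  · have : S ∩ {u, w} = {u} := by
      ext x; simp only [Set.mem_inter_iff, Set.mem_insert_iff, Set.mem_singleton_iff]
      constructor
      · rintro ⟨h, rfl | rfl⟩
        · rfl
        · exact absurd h hw
      · rintro rfl; exact ⟨hu, Or.inl rfl⟩
    rw [this, Set.ncard_singleton]; simp [hu, hw]
  · have : S ∩ {u, w} = {w} := by
      ext x; simp only [Set.mem_inter_iff, Set.mem_insert_iff, Set.mem_singleton_iff]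
      constructor
      · rintro ⟨h, rfl | rfl⟩
        · exact absurd h hu
        · rfl
      · rintro rfl; exact ⟨hw, Or.inr rfl⟩
    rw [this, Set.ncard_singleton]; simp [hu, hw]
  · have : S ∩ {u, w} = ∅ := by
      ext x; simp only [Set.mem_inter_iff, Set.mem_insert_iff, Set.mem_singleton_iff]
      constructor
      · rintro ⟨h, rfl | rfl⟩
        · exact absurd h hu
        · exact absurd h hw
      · rintro ⟨⟩
    rw [this, Set.ncard_empty]; simp [hu, hw]

/-- How the number of corners changes when a polygon is cut along a diagonal. -/
theorem corner_count {u w : ι} {l₁ l₂ : List ι} (hnd : (u :: l₁ ++ w :: l₂).Nodup) (σ : ℝ) :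
    open Classical in
    (Corner R σ (u :: l₁ ++ [w])).ncard + (Corner R σ (u :: w :: l₂)).ncard +
      ((if u ∈ Corner R σ (u :: l₁ ++ w :: l₂) then 1 else 0) +
        if w ∈ Corner R σ (u :: l₁ ++ w :: l₂) then 1 else 0) =
    (Corner R σ (u :: l₁ ++ w :: l₂)).ncard +
      (((if u ∈ Corner R σ (u :: l₁ ++ [w]) then 1 else 0) +
        if w ∈ Corner R σ (u :: l₁ ++ [w]) then 1 else 0) +
      ((if u ∈ Corner R σ (u :: w :: l₂) then 1 else 0) +
        if w ∈ Corner R σ (u :: w :: l₂) then 1 else 0)) := by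
  classical
  have huw : u ≠ w := by rintro rfl; simp at hnd
  have hdis : ∀ x, x ∈ l₁ → x ∈ l₂ → False := by
    intro x h1 h2
    rw [List.cons_append, List.nodup_cons, List.nodup_append] at hnd
    exact hnd.2.2.2 x h1 x (by simp [h2]) rfl
  have hl : ∀ x, x ∈ u :: l₁ ++ w :: l₂ → x ∉ ({u, w} : Set ι) → x ∈ l₁ ∨ x ∈ l₂ := by
    intro x hx hx'
    simp only [Set.mem_insert_iff, Set.mem_singleton_iff, not_or] at hx'
    simpa [hx'.1, hx'.2] using hx
  have hu : u ∉ l₁ ∧ u ∉ l₂ := by simp at hnd; tauto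
  have hw : w ∉ l₁ ∧ w ∉ l₂ := by
    rw [List.nodup_append, List.nodup_cons] at hnd
    exact ⟨fun h => hnd.2.2 w (by simp [h]) w (by simp) rfl,
      (List.nodup_cons.1 hnd.2.1).1⟩
  -- Vertices other than the ends of the diagonal keep both neighbours, so only the ends can change
  -- between corner and reflex.
  have e1 : Corner R σ (u :: l₁ ++ [w]) \ {u, w} =
      {x | x ∈ Corner R σ (u :: l₁ ++ w :: l₂) ∧ x ∈ l₁} := by
    ext x
    simp only [Set.mem_sdiff, Set.mem_ofPred_eq]
    constructor
    · rintro ⟨⟨p, n, hp, hn, ho⟩, hx⟩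
      have hm := (mem_of_mem_cyc hp).2
      have hx1 : x ∈ l₁ := by
        simp only [Set.mem_insert_iff, Set.mem_singleton_iff, not_or] at hx
        simpa [hx.1, hx.2] using hm
      exact ⟨⟨p, n, (mem_cyc_left_iff hnd hx1).1.1 hp, (mem_cyc_left_iff hnd hx1).2.1 hn, ho⟩, hx1⟩
    · rintro ⟨⟨p, n, hp, hn, ho⟩, hx1⟩
      refine ⟨⟨p, n, (mem_cyc_left_iff hnd hx1).1.2 hp, (mem_cyc_left_iff hnd hx1).2.2 hn, ho⟩, ?_⟩
      rintro (rfl | rfl)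
      · exact hu.1 hx1
      · exact hw.1 hx1
  have e2 : Corner R σ (u :: w :: l₂) \ {u, w} =
      {x | x ∈ Corner R σ (u :: l₁ ++ w :: l₂) ∧ x ∈ l₂} := by
    ext x
    simp only [Set.mem_sdiff, Set.mem_ofPred_eq]
    constructor
    · rintro ⟨⟨p, n, hp, hn, ho⟩, hx⟩
      have hm := (mem_of_mem_cyc hp).2
      have hx1 : x ∈ l₂ := by
        simp only [Set.mem_insert_iff, Set.mem_singleton_iff, not_or] at hx
        simpa [hx.1, hx.2] using hm
      exact ⟨⟨p, n, (mem_cyc_right_iff hnd hx1).1.1 hp, (mem_cyc_right_iff hnd hx1).2.1 hn, ho⟩,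
        hx1⟩
    · rintro ⟨⟨p, n, hp, hn, ho⟩, hx1⟩
      refine ⟨⟨p, n, (mem_cyc_right_iff hnd hx1).1.2 hp, (mem_cyc_right_iff hnd hx1).2.2 hn, ho⟩,
        ?_⟩
      rintro (rfl | rfl)
      · exact hu.2 hx1
      · exact hw.2 hx1
  have e3 : Corner R σ (u :: l₁ ++ w :: l₂) \ {u, w} =
      {x | x ∈ Corner R σ (u :: l₁ ++ w :: l₂) ∧ x ∈ l₁} ∪
        {x | x ∈ Corner R σ (u :: l₁ ++ w :: l₂) ∧ x ∈ l₂} := by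
    ext x
    simp only [Set.mem_sdiff, Set.mem_union, Set.mem_ofPred_eq, ← and_or_left]
    constructor
    · rintro ⟨h, hx⟩
      exact ⟨h, hl x (corner_subset σ _ h) hx⟩
    · rintro ⟨h, hx⟩
      refine ⟨h, ?_⟩
      rintro (rfl | rfl)
      · tauto
      · tauto
  have hfin := finite_corner (R := R) σ (u :: l₁ ++ w :: l₂)
  have e4 := Set.ncard_union_eq (s := {x | x ∈ Corner R σ (u :: l₁ ++ w :: l₂) ∧ x ∈ l₁})
    (t := {x | x ∈ Corner R σ (u :: l₁ ++ w :: l₂) ∧ x ∈ l₂})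
    (Set.disjoint_left.2 fun x h1 h2 => hdis x h1.2 h2.2)
    (hfin.subset fun x h => h.1) (hfin.subset fun x h => h.1)
  rw [ncard_eq_diff_pair (finite_corner (R := R) σ (u :: l₁ ++ [w])) huw,
    ncard_eq_diff_pair (finite_corner (R := R) σ (u :: w :: l₂)) huw,
    ncard_eq_diff_pair hfin huw, e1, e2, e3, e4]
  omega

theorem IDiag.insec (hR : GP R) {L : List ι} {σ : ℝ} (hL : Oriented R L σ) {u w p n : ι}
    (hd : IDiag R L u w) (hp : (p, u) ∈ cyc L) (hn : (u, n) ∈ cyc L) :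
    InSec σ (R n - R u) (R p - R u) (R w - R u) := by
  have hf := hd.free.notMem_cyc
  have hwn : n ≠ w := by rintro rfl; exact hf.1 hn
  have hwp : p ≠ w := by rintro rfl; exact hf.2 hp
  have h1 := hR.noncol u n w (hL.simple.ne hn) hd.ne hwn
  have h2 := hR.noncol u p w (hL.simple.ne hp).symm hd.ne hwp
  refine hL.insec_of_frequently hR hp hn (offRay_of_cr_ne_zero h1) (offRay_of_cr_ne_zero h2) ?_
  apply Eventually.frequently
  have hpos : ∀ᶠ ε : ℝ in 𝓝[>] (0:ℝ), 0 < ε := self_mem_nhdsWithin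
  have hlt : ∀ᶠ ε : ℝ in 𝓝[>] (0:ℝ), ε < 1 := nhdsWithin_le_nhds (Iio_mem_nhds one_pos)
  filter_upwards [hpos, hlt] with ε h1 h2
  exact hd.sub (param_mem_openSegment h1 h2)

/-- The edges at the first end of a diagonal, in the polygon and in both parts. -/
theorem cut_edges {u w : ι} {l₁ l₂ : List ι} (hnd : (u :: l₁ ++ w :: l₂).Nodup) {p n : ι}
    (hp : (p, u) ∈ cyc (u :: l₁ ++ w :: l₂)) (hn : (u, n) ∈ cyc (u :: l₁ ++ w :: l₂)) :
    (u, n) ∈ cyc (u :: l₁ ++ [w]) ∧ (w, u) ∈ cyc (u :: l₁ ++ [w]) ∧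
      (p, u) ∈ cyc (u :: w :: l₂) ∧ (u, w) ∈ cyc (u :: w :: l₂) := by
  have huw : u ≠ w := by rintro rfl; simp at hnd
  have hu : u ∉ l₁ ∧ u ∉ l₂ := by simp at hnd; tauto
  rw [cyc_split] at hp hn
  rw [cyc_left, cyc_right]
  refine ⟨?_, by simp, ?_, by simp⟩
  · rcases List.mem_append.1 hn with h | h
    · exact List.mem_append_left _ h
    · cases l₂ with
      | nil =>
        simp [path, huw] at h
      | cons c l₂ =>
        exfalso
        have : ∀ (a : ι) (l : List ι), u ≠ a → u ∉ l → (u, n) ∉ path a (l ++ [u]) := by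
          intro a l
          induction l generalizing a with
          | nil => intro h _; simp [path, h]
          | cons b l ih =>
            intro h h'
            simp only [List.mem_cons, not_or] at h'
            simp only [List.cons_append, path, List.mem_cons, Prod.mk.injEq, h, false_and, false_or]
            exact ih b h'.1 h'.2
        exact this w (c :: l₂) huw hu.2 h
  · rcases List.mem_append.1 hp with h | h
    · have := (path_mem h).2
      simp [hu.1, huw] at this
    · exact List.mem_cons_of_mem _ h

/-- The diagonal divides the interior angle at `u`. If the angle is below `π`, so are both pieces;
as it is below `2π` in any case, at least one piece is. -/
theorem Oriented.cut_corner (hR : GP R) {u w : ι} {l₁ l₂ : List ι} {σ : ℝ}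
    (hL : Oriented R (u :: l₁ ++ w :: l₂) σ) (hd : IDiag R (u :: l₁ ++ w :: l₂) u w) :
    (u ∈ Corner R σ (u :: l₁ ++ w :: l₂) →
      u ∈ Corner R σ (u :: l₁ ++ [w]) ∧ u ∈ Corner R σ (u :: w :: l₂)) ∧
    (u ∈ Corner R σ (u :: l₁ ++ [w]) ∨ u ∈ Corner R σ (u :: w :: l₂)) := by
  obtain ⟨⟨o1, o2⟩, -⟩ := hL.cut hR hd
  obtain ⟨p, hp⟩ := exists_prev hd.left_mem
  obtain ⟨n, hn⟩ := exists_next hd.left_mem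
  have hs := hd.insec hR hL hp hn
  obtain ⟨a1, a2, a3, a4⟩ := cut_edges hL.simple.nodup hp hn
  rw [hL.simple.mem_corner hp hn, o1.simple.mem_corner a2 a1, o2.simple.mem_corner a3 a4, ori_eq,
    ori_eq, ori_eq]
  rcases hs with ⟨h0, h1, h2⟩ | ⟨h0, h⟩
  · exact ⟨fun _ => ⟨h1, h2⟩, Or.inl h1⟩
  · exact ⟨fun h' => absurd h' h0.not_gt, h⟩

theorem Oriented.cut_corner' (hR : GP R) {u w : ι} {l₁ l₂ : List ι} {σ : ℝ}
    (hL : Oriented R (u :: l₁ ++ w :: l₂) σ) (hd : IDiag R (u :: l₁ ++ w :: l₂) u w) :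
    (w ∈ Corner R σ (u :: l₁ ++ w :: l₂) →
      w ∈ Corner R σ (u :: l₁ ++ [w]) ∧ w ∈ Corner R σ (u :: w :: l₂)) ∧
    (w ∈ Corner R σ (u :: l₁ ++ [w]) ∨ w ∈ Corner R σ (u :: w :: l₂)) := by
  have hr := rot_swap u l₁ w l₂
  have h := (hr.oriented hL).cut_corner hR (hr.idiag hd).symm
  rw [← hr.corner, ← (rot_right u w l₂).corner, ← (rot_left u l₁ w).corner] at h
  tauto

/-! ### Connectedness of the interior; triangles at an edge -/

theorem convex_cr_pos (a b : ℂ) (σ : ℝ) : Convex ℝ {z | 0 < σ * cr (a - z) (b - z)} := by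
  rw [convex_iff_openSegment_subset]
  intro x hx y hy z hz
  obtain ⟨t, t0, t1, rfl⟩ := mem_openSegment_param hz
  have : σ * cr (a - (x + t * (y - x))) (b - (x + t * (y - x))) =
      (1 - t) * (σ * cr (a - x) (b - x)) + t * (σ * cr (a - y) (b - y)) := by
    simp [cr]; ring
  simp only [Set.mem_ofPred_eq] at hx hy ⊢
  rw [this]
  have := mul_pos t0 hy
  have := mul_pos (sub_pos.2 t1) hx
  linarith

/-- By induction both parts are connected, and the open diagonal lies in the closure of each, so it
glues them together. A triangle is an intersection of half planes. -/
theorem Oriented.isPreconnected_inside (hR : GP R) {L : List ι} {σ : ℝ} (hL : Oriented R L σ) :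
    IsPreconnected (inside R L) := by
  induction hlen : L.length using Nat.strong_induction_on generalizing L σ with
  | _ k ih =>
  subst hlen
  have h3 := hL.simple.three_le
  rcases h3.eq_or_lt with h3 | h4
  · match L, h3, hL with
    | [a, b, c], _, hL =>
      have hnd := hL.simple.nodup
      simp at hnd
      have h0 := hR.noncol a b c hnd.1.1 hnd.1.2 hnd.2
      obtain ⟨τ, hτ, ho⟩ : ∃ τ : ℝ, (τ = 1 ∨ τ = -1) ∧ 0 < τ * ori R a b c := by
        rcases h0.lt_or_gt with h | h
        · exact ⟨-1, Or.inr rfl, by linarith⟩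
        · exact ⟨1, Or.inl rfl, by linarith⟩
      have : inside R [a, b, c] = {z | 0 < τ * cr (R a - z) (R b - z)} ∩
          ({z | 0 < τ * cr (R b - z) (R c - z)} ∩ {z | 0 < τ * cr (R c - z) (R a - z)}) := by
        ext z; exact mem_inside_triangle hτ ho
      rw [this]
      exact ((convex_cr_pos _ _ _).inter ((convex_cr_pos _ _ _).inter
        (convex_cr_pos _ _ _))).isPreconnected
  · obtain ⟨u, w, hd⟩ := hL.exists_idiag hR h4
    obtain ⟨l₁, l₂, hr⟩ := exists_rot_two hd.left_mem hd.right_mem hd.ne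
    have hd' := hr.idiag hd
    have hL' := hr.oriented hL
    obtain ⟨⟨o1, o2⟩, ⟨i1, i2⟩, -, hcov⟩ := hL'.cut hR hd'
    obtain ⟨n1, n2⟩ := hd'.free.ne_nil
    have hlen := hr.1.length_eq
    have := List.length_pos_iff.2 n1
    have := List.length_pos_iff.2 n2
    simp at hlen
    have c1 := ih _ (by simp; omega) o1 rfl
    have c2 := ih _ (by simp; omega) o2 rfl
    have hcl : ∀ M : List ι, Oriented R M σ → segment ℝ (R u) (R w) ⊆ bd R M →
        openSegment ℝ (R u) (R w) ⊆ closure (inside R M) := by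
      intro M hM hsub z hz
      rw [mem_closure_iff]
      intro U hU hzU
      obtain ⟨y, h1, h2⟩ := hM.exists_inside_near hR
        (hsub (openSegment_subset_segment _ _ _ hz)) hU hzU
      exact ⟨y, h1, h2⟩
    have d1 := hcl _ o1 (by rw [bd_left]; exact Set.subset_union_right)
    have d2 := hcl _ o2 (by rw [bd_right]; exact Set.subset_union_right)
    have e1 : IsPreconnected (inside R (u :: l₁ ++ [w]) ∪ openSegment ℝ (R u) (R w)) :=
      c1.subset_closure Set.subset_union_left (Set.union_subset subset_closure d1)
    have e2 : IsPreconnected (inside R (u :: w :: l₂) ∪ openSegment ℝ (R u) (R w)) :=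
      c2.subset_closure Set.subset_union_left (Set.union_subset subset_closure d2)
    obtain ⟨m, hm⟩ := openSegment_nonempty (R u) (R w)
    have e3 := e1.union m (Or.inr hm) (Or.inr hm) e2
    rw [hr.inside]
    convert e3 using 1
    ext z
    constructor
    · intro hz
      by_cases hzd : z ∈ openSegment ℝ (R u) (R w)
      · exact Or.inl (Or.inr hzd)
      · rcases hcov z hz hzd with h | h
        · exact Or.inl (Or.inl h)
        · exact Or.inr (Or.inl h)
    · rintro ((h | h) | (h | h))
      · exact i1 h
      · exact hd'.sub h
      · exact i2 h
      · exact hd'.sub h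

/-- The three vertices give the same orientation sign up to rotation, and at least one is a corner.
-/
theorem Oriented.triangle_ori (hR : GP R) {a b c : ι} {σ : ℝ} (hL : Oriented R [a, b, c] σ) :
    0 < σ * ori R a b c := by
  have h3 := hL.three_le_corner hR
  obtain ⟨x, hx⟩ : (Corner R σ [a, b, c]).Nonempty := by
    rw [← Set.ncard_pos (finite_corner σ _)]; omega
  have hm : x = a ∨ x = b ∨ x = c := by simpa using corner_subset σ _ hx
  rcases hm with rfl | rfl | rfl
  · rw [hL.simple.mem_corner (p := c) (n := b) (by simp [cyc_triangle]) (by simp [cyc_triangle]),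
      ori_rot] at hx
    exact hx
  · rw [hL.simple.mem_corner (p := a) (n := c) (by simp [cyc_triangle]) (by simp [cyc_triangle])]
      at hx
    exact hx
  · rw [hL.simple.mem_corner (p := b) (n := a) (by simp [cyc_triangle]) (by simp [cyc_triangle]),
      ← ori_rot] at hx
    exact hx

theorem IDiag.mono {L M : List ι} {u w : ι} (h : IDiag R M u w) (hv : ∀ x ∈ M, x ∈ L)
    (hi : inside R M ⊆ inside R L) : IDiag R L u w :=
  ⟨hv _ h.left_mem, hv _ h.right_mem, h.ne, h.sub.trans hi⟩

/-- Every edge of a polygon belongs to a triangle made from edges and interior diagonals. -/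
theorem Oriented.exists_apex (hR : GP R) {L : List ι} {σ : ℝ} (hL : Oriented R L σ) {a b : ι}
    (hab : (a, b) ∈ cyc L) :
    ∃ c ∈ L, c ≠ a ∧ c ≠ b ∧ ((b, c) ∈ cyc L ∨ IDiag R L b c) ∧
      ((c, a) ∈ cyc L ∨ IDiag R L c a) ∧ inside R [a, b, c] ⊆ inside R L ∧
      0 < σ * ori R a b c := by
  induction hlen : L.length using Nat.strong_induction_on generalizing L with
  | _ k ih =>
  subst hlen
  have h3 := hL.simple.three_le
  rcases h3.eq_or_lt with h3 | h4
  · obtain ⟨l, hr⟩ := exists_rot_edge hL.simple.nodup (by omega) hab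
    have hlen := hr.1.length_eq
    match l, hr, hlen with
    | [], _, hlen => simp at hlen; omega
    | _ :: _ :: _, _, hlen => simp at hlen; omega
    | [c], hr, _ =>
      have hL' := hr.oriented hL
      have hnd := hL'.simple.nodup
      simp at hnd
      refine ⟨c, hr.mem_iff.2 (by simp), Ne.symm hnd.1.2, Ne.symm hnd.2, Or.inl ?_, Or.inl ?_, ?_,
        hL'.triangle_ori hR⟩
      · rw [hr.mem_cyc]; simp [cyc_triangle]
      · rw [hr.mem_cyc]; simp [cyc_triangle]
      · rw [hr.inside]
  · obtain ⟨u, w, hd⟩ := hL.exists_idiag hR h4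
    -- Induction applies to the part that contains the edge. A side of the triangle along the cut
    -- becomes a diagonal of the whole polygon.
    have main : ∀ u w l₁ l₂, Rot L (u :: l₁ ++ w :: l₂) → IDiag R L u w →
        (a, b) ∈ cyc (u :: l₁ ++ [w]) → ∃ c ∈ L, c ≠ a ∧ c ≠ b ∧
        ((b, c) ∈ cyc L ∨ IDiag R L b c) ∧ ((c, a) ∈ cyc L ∨ IDiag R L c a) ∧
        inside R [a, b, c] ⊆ inside R L ∧ 0 < σ * ori R a b c := by
      intro u w l₁ l₂ hr hd hab
      have hd' := hr.idiag hd
      obtain ⟨⟨o1, -⟩, ⟨i1, -⟩, -⟩ := (hr.oriented hL).cut hR hd'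
      obtain ⟨n1, n2⟩ := hd'.free.ne_nil
      have hlen := hr.1.length_eq
      have := List.length_pos_iff.2 n2
      simp at hlen
      rw [← hr.inside] at i1
      have hmem : ∀ x ∈ u :: l₁ ++ [w], x ∈ L := by
        intro x hx
        rw [hr.mem_iff]
        simp at hx ⊢; tauto
      obtain ⟨c, hc, h1, h2, h3, h4, h5, h6⟩ := ih _ (by simp; omega) o1 hab rfl
      refine ⟨c, hmem c hc, h1, h2, ?_, ?_, h5.trans i1, h6⟩
      · rcases h3 with h | h
        · rcases mem_cyc_left l₂ h with h | h
          · exact Or.inl (hr.mem_cyc.2 h)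
          · cases h; exact Or.inr hd.symm
        · exact Or.inr (h.mono hmem i1)
      · rcases h4 with h | h
        · rcases mem_cyc_left l₂ h with h | h
          · exact Or.inl (hr.mem_cyc.2 h)
          · cases h; exact Or.inr hd.symm
        · exact Or.inr (h.mono hmem i1)
    obtain ⟨l₁, l₂, hr⟩ := exists_rot_two hd.left_mem hd.right_mem hd.ne
    have hab' := hr.mem_cyc.1 hab
    rw [cyc_split, List.mem_append] at hab'
    rcases hab' with h | h
    · exact main u w l₁ l₂ hr hd (by rw [cyc_left]; exact List.mem_append_left _ h)
    · exact main w u l₂ l₁ (hr.trans (rot_swap _ _ _ _)) hd.symm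
        (by rw [cyc_left]; exact List.mem_append_left _ h)

end PlanarCycle

namespace PlanarCycle

variable {ι : Type*} {R : ι → ℂ}

/-! ### Diagonals avoiding a given corner -/

/-- The other diagonal of a convex quadrilateral. -/
theorem openSegment_subset_flip {x y z q : ι} {σ : ℝ} (hσ : σ = 1 ∨ σ = -1)
    (h1 : 0 < σ * ori R y x q) (h2 : 0 < σ * ori R x z q) (h3 : 0 < σ * ori R y x z)
    (h4 : 0 < σ * ori R z q y) :
    openSegment ℝ (R y) (R z) ⊆
      inside R [y, x, q] ∪ openSegment ℝ (R x) (R q) ∪ inside R [x, z, q] := by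
  intro w hw
  obtain ⟨t, t0, t1, hwt⟩ := mem_openSegment_param hw
  have t1' := sub_pos.2 t1
  have e1 : σ * cr (R y - w) (R x - w) = t * (σ * ori R y x z) := by
    rw [hwt]; simp [cr, ori]; ring
  have e2 : σ * cr (R q - w) (R y - w) = t * (σ * ori R z q y) := by
    rw [hwt]; simp [cr, ori]; ring
  have e3 : σ * cr (R x - w) (R z - w) = (1 - t) * (σ * ori R y x z) := by
    rw [hwt]; simp [cr, ori]; ring
  have e4 : σ * cr (R z - w) (R q - w) = (1 - t) * (σ * ori R z q y) := by
    rw [hwt]; simp [cr, ori]; ring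
  have p1 := mul_pos t0 h3
  have p2 := mul_pos t0 h4
  have p3 := mul_pos t1' h3
  have p4 := mul_pos t1' h4
  rw [← e1] at p1
  rw [← e2] at p2
  rw [← e3] at p3
  rw [← e4] at p4
  -- The side of the line `xq` on which the point lies decides between the two triangles and their
  -- common side.
  rcases lt_trichotomy (σ * cr (R x - w) (R q - w)) 0 with h | h | h
  · refine Or.inr ((mem_inside_triangle hσ h2).2 ⟨p3, p4, ?_⟩)
    rw [cr_swap]; linarith
  · refine Or.inl (Or.inr ?_)
    have hs : (0:ℝ) < σ * cr (R x - w) (R z - w) + σ * cr (R z - w) (R q - w) := add_pos p3 p4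
    refine ⟨_, _, div_pos p4 hs, div_pos p3 hs, by rw [← add_div, add_comm, div_self hs.ne'], ?_⟩
    rw [div_eq_inv_mul, div_eq_inv_mul, mul_smul, mul_smul _ (σ * cr (R x - w) (R z - w)),
      ← smul_add, inv_smul_eq_iff₀ hs.ne']
    have hcr : cr (R x - w) (R q - w) = 0 := by
      rcases hσ with rfl | rfl
      · linarith
      · linarith
    have := cr_expand_vec (R x - w) (R q - w) (R z - w)
    have hv : (cr (R z - w) (R q - w) : ℂ) * (R x - w) + cr (R x - w) (R z - w) * (R q - w) = 0 := by
      have e : cr (R q - w) (R x - w) = 0 := by rw [cr_swap, hcr, neg_zero]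
      rw [e, cr_swap (R z - w) (R x - w), cr_swap (R q - w) (R z - w)] at this
      push_cast at this
      linear_combination this
    simp only [Complex.real_smul]
    push_cast
    linear_combination (σ : ℂ) * hv
  · exact Or.inl (Or.inl ((mem_inside_triangle hσ h1).2 ⟨p1, h, p2⟩))

/-- At a corner the interior angle is below `π`, so every edge or diagonal other than the leaving
edge lies strictly on the interior side of that edge. -/
theorem Oriented.cr_nonneg_of_corner (hR : GP R) {M : List ι} {σ : ℝ} (hM : Oriented R M σ)
    {q n y : ι} (hq : q ∈ Corner R σ M) (hn : (q, n) ∈ cyc M)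
    (hy : ((q, y) ∈ cyc M ∨ (y, q) ∈ cyc M) ∨ IDiag R M q y) (hne : y ≠ n) :
    0 < σ * cr (R n - R q) (R y - R q) := by
  obtain ⟨p, hp⟩ := exists_prev (mem_of_mem_cyc hn).1
  have hc := (hM.simple.mem_corner hp hn).1 hq
  rw [ori_eq] at hc
  rcases hy with (hy | hy) | hy
  · exact absurd (next_unique hM.simple.nodup hy hn) hne
  · rwa [prev_unique hM.simple.nodup hy hp]
  · rcases hy.insec hR hM hp hn with h | h
    · exact h.2.1
    · exact absurd hc h.1.not_gt

/-- Consider triangles on the two edges `yx` and `xz`. If one has its apex away from `q`, one of its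
sides is the required diagonal. If both have apex `q`, they form a quadrilateral `yxzq` that is
convex at `x` and at `q`, because both are corners, and the diagonal `xq` can be flipped to `yz`. -/
theorem Oriented.exists_idiag_avoiding (hR : GP R) {M : List ι} {σ : ℝ} (hM : Oriented R M σ)
    {q x y z : ι} (hq : q ∈ Corner R σ M) (hx : x ∈ Corner R σ M) (hxq : x ≠ q)
    (hyx : (y, x) ∈ cyc M) (hxz : (x, z) ∈ cyc M) (hyq : y ≠ q) (hzq : z ≠ q) :
    ∃ u v, IDiag R M u v ∧ u ≠ q ∧ v ≠ q := by
  have hnd := hM.simple.nodup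
  have hqM : q ∈ M := corner_subset σ M hq
  have hyz := hM.simple.prev_ne_next hyx hxz
  -- Otherwise the polygon would be the triangle `yxz`, which does not contain `q`.
  have hzy : (z, y) ∉ cyc M := by
    intro h
    obtain ⟨l, hl⟩ := exists_rot_edge hnd (by have := hM.simple.three_le; omega) hyx
    have hnd' := hl.nodup hnd
    have hq' := hl.mem_iff.1 hqM
    match l, hl, hnd', hq' with
    | [], hl, hnd', hq' => simp [hxq.symm, hyq.symm] at hq'
    | c :: l, hl, hnd', hq' =>
      have hc : (x, c) ∈ cyc (y :: x :: c :: l) := by simp [cyc, path]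
      obtain rfl := next_unique hnd hxz (hl.mem_cyc.2 hc)
      match l, hl, hnd', hq' with
      | [], hl, hnd', hq' => simp [hxq.symm, hyq.symm, hzq.symm] at hq'
      | d :: l, hl, hnd', hq' =>
        have hd : (z, d) ∈ cyc (y :: x :: z :: d :: l) := by simp [cyc, path]
        obtain rfl := next_unique hnd h (hl.mem_cyc.2 hd)
        simp at hnd'
  obtain ⟨c, hcM, hcy, hcx, hxc, hcy', hsub, ho⟩ := hM.exists_apex hR hyx
  obtain ⟨c', hcM', hcx', hcz', hzc, hcx'', hsub', ho'⟩ := hM.exists_apex hR hxz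
  by_cases hcq : c = q
  swap
  · rcases hxc with h | h
    · obtain rfl := next_unique hnd h hxz
      exact ⟨c, y, hcy'.resolve_left hzy, hcq, hyq⟩
    · exact ⟨x, c, h, hxq, hcq⟩
  by_cases hcq' : c' = q
  swap
  · rcases hcx'' with h | h
    · obtain rfl := prev_unique hnd h hyx
      exact ⟨z, c', hzc.resolve_left hzy, hzq, hcq'⟩
    · exact ⟨c', x, h, hcq', hxq⟩
  subst hcq
  subst hcq'
  refine ⟨y, z, ⟨(mem_of_mem_cyc hyx).1, (mem_of_mem_cyc hxz).2, hyz, ?_⟩, hyq, hzq⟩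
  have hxc' : IDiag R M x c' := hxc.resolve_left fun h => hzq (next_unique hnd hxz h)
  have h3 := (hM.simple.mem_corner hyx hxz).1 hx
  -- Convexity at `q`: all of `y`, `x`, `z` lie within an angle below `π` there. Expanding `x` in
  -- terms of `y` and `z`, as seen by the functional of the leaving edge, shows that the turn from
  -- `y` to `z` has the sign of its two pieces.
  have h4 : 0 < σ * ori R z c' y := by
    obtain ⟨n, hn⟩ := exists_next hqM
    have hxn : x ≠ n := by
      rintro rfl; exact hyq (prev_unique hnd hyx hn)
    have fx := hM.cr_nonneg_of_corner hR hq hn (Or.inr hxc'.symm) hxn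
    have hy' : ((c', y) ∈ cyc M ∨ (y, c') ∈ cyc M) ∨ IDiag R M c' y := by tauto
    have hz' : ((c', z) ∈ cyc M ∨ (z, c') ∈ cyc M) ∨ IDiag R M c' z :=
      hzc.elim (fun h => Or.inl (Or.inr h)) fun h => Or.inr h.symm
    have fy := hM.cr_nonneg_of_corner hR hq hn hy'
    have fz := hM.cr_nonneg_of_corner hR hq hn hz'
    rw [ori_rot, ori_rot] at ho
    rw [← ori_rot] at ho'
    rw [ori_eq]
    have key := cr_expand (R n - R c') (R z - R c') (R y - R c') (R x - R c')
    have e1 : ori R c' y x = cr (R y - R c') (R x - R c') := rfl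
    have e2 : ori R c' x z = cr (R x - R c') (R z - R c') := rfl
    rw [e1] at ho
    rw [e2] at ho'
    have hss : σ * σ = 1 := by rcases hM.sign with rfl | rfl <;> norm_num
    have : 0 < (σ * cr (R y - R c') (R z - R c')) * (σ * cr (R n - R c') (R x - R c')) := by
      have e : (σ * cr (R y - R c') (R z - R c')) * (σ * cr (R n - R c') (R x - R c')) =
        (σ * cr (R x - R c') (R z - R c')) * (σ * cr (R n - R c') (R y - R c')) +
        (σ * cr (R y - R c') (R x - R c')) * (σ * cr (R n - R c') (R z - R c')) := by
        linear_combination (σ * σ) * key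
      rw [e]
      by_cases hyn : y = n
      · have hzn : z ≠ n := fun h => hyz (hyn.trans h.symm)
        have e0 : cr (R n - R c') (R y - R c') = 0 := by rw [hyn, cr_self]
        rw [e0]
        have := mul_pos ho (fz hzn)
        linarith
      · have h1 := mul_pos ho' (fy hyn)
        by_cases hzn : z = n
        · have e0 : cr (R n - R c') (R z - R c') = 0 := by rw [hzn, cr_self]
          rw [e0]; linarith
        · have := mul_pos ho (fz hzn)
          linarith
    exact pos_of_mul_pos_left this fx.le
  refine (openSegment_subset_flip hM.sign ho ho' h3 h4).trans ?_
  rintro w ((h | h) | h)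
  · exact hsub h
  · exact hxc'.sub h
  · exact hsub' h

/-- A diagonal at the end of another diagonal stays on its side. -/
theorem IDiag.cut_right (hR : GP R) {u t w : ι} {l₁ l₂ : List ι} {σ : ℝ}
    (hL : Oriented R (u :: l₁ ++ t :: l₂) σ) (hd : IDiag R (u :: l₁ ++ t :: l₂) u t)
    (hw : IDiag R (u :: l₁ ++ t :: l₂) t w) (hm : w ∈ l₂) : IDiag R (u :: t :: l₂) t w := by
  obtain ⟨⟨o1, o2⟩, ⟨i1, i2⟩, -, hcov⟩ := hL.cut hR hd
  have hnd := hL.simple.nodup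
  have hwL : w ∉ u :: l₁ ++ [t] := by
    intro h
    rw [List.append_cons, List.nodup_append] at hnd
    exact hnd.2.2 w h w hm rfl
  have hwu : u ≠ w := by rintro rfl; simp at hwL
  refine ⟨by simp, by simp [hm], hw.ne, fun z hz => ?_⟩
  have hzo : ∀ z ∈ openSegment ℝ (R t) (R w), z ∉ segment ℝ (R u) (R t) := by
    intro z hz hz'
    rw [segment_symm] at hz'
    exact ne_of_mem_openSegment_left (hR.inj.ne hw.ne) hz
      (hR.inter_share hw.ne hd.ne.symm hwu.symm (openSegment_subset_segment _ _ _ hz) hz')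
  have hoff : ∀ z ∈ openSegment ℝ (R t) (R w), z ∉ bd R (u :: l₁ ++ [t]) := fun z hz =>
    (notMem_bd_cut (hw.sub hz).1 (hzo z hz)).1
  refine (hcov z (hw.sub hz) fun h => hzo z hz (openSegment_subset_segment _ _ _ h)).resolve_left ?_
  intro hz1
  -- Were one point of the new diagonal in the wrong part, connectedness would put its far end `w`
  -- into the interior of that part, hence of the whole polygon, although `w` is a boundary vertex.
  have hwb : R w ∉ bd R (u :: l₁ ++ [t]) := by
    rintro ⟨⟨a, b⟩, he, h⟩
    obtain ⟨h1, h2⟩ := mem_of_mem_cyc he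
    exact hR.notMem_segment (x := w) (y := a) (w := b) (by rintro rfl; exact hwL h1)
      (by rintro rfl; exact hwL h2) h
  have hc := wind_eq_of_isPreconnected (R := R) (L := u :: l₁ ++ [t])
    (S := insert (R w) (openSegment ℝ (R t) (R w)))
    ((convex_openSegment _ _).isPreconnected.subset_closure (Set.subset_insert _ _)
      (Set.insert_subset (by rw [closure_openSegment]; exact right_mem_segment _ _ _)
        subset_closure))
    (by
      rw [Set.disjoint_left]
      rintro y (rfl | hy)
      · exact hwb
      · exact hoff y hy) (Set.mem_insert _ _) (Set.mem_insert_of_mem _ hz)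
  have : R w ∈ inside R (u :: l₁ ++ t :: l₂) := i1 ⟨hwb, by rw [hc]; exact hz1.2⟩
  exact this.1 (vertex_mem_bd (by simp [hm]))

end PlanarCycle

namespace PlanarCycle

variable {ι : Type*} {R : ι → ℂ}

/-! ### Cutting off everything that is not needed -/

/-- Cutting without rotating the list, so that a block `B` is deleted and everything else keeps its
place. -/
theorem Oriented.cut_off (hR : GP R) {A B D : List ι} {u v : ι} {σ : ℝ}
    (hL : Oriented R (A ++ u :: B ++ v :: D) σ) (hd : IDiag R (A ++ u :: B ++ v :: D) u v) :
    B ≠ [] ∧ Oriented R (A ++ u :: v :: D) σ ∧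
      inside R (A ++ u :: v :: D) ⊆ inside R (A ++ u :: B ++ v :: D) ∧
      inside R (u :: B ++ [v]) ⊆ inside R (A ++ u :: B ++ v :: D) ∧
      (∀ z ∈ inside R (A ++ u :: B ++ v :: D), z ∉ openSegment ℝ (R u) (R v) →
        z ∈ inside R (u :: B ++ [v]) ∨ z ∈ inside R (A ++ u :: v :: D)) ∧
      ∀ e ∈ cyc (A ++ u :: v :: D), e ∈ cyc (A ++ u :: B ++ v :: D) ∨ e = (u, v) := by
  have hr : Rot (A ++ u :: B ++ v :: D) (u :: B ++ v :: (D ++ A)) := by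
    have := rot_append A (u :: B ++ v :: D)
    simpa using this
  have hr' : Rot (u :: v :: (D ++ A)) (A ++ u :: v :: D) := by
    have := rot_append (u :: v :: D) A
    simpa using this
  have hd' := hr.idiag hd
  obtain ⟨⟨o1, o2⟩, ⟨i1, i2⟩, -, hcov⟩ := (hr.oriented hL).cut hR hd'
  rw [hr.inside, ← hr'.inside]
  refine ⟨hd'.free.ne_nil.1, hr'.oriented o2, i2, i1, hcov, fun e he => ?_⟩
  rw [hr.mem_cyc]
  exact mem_cyc_right B (hr'.mem_cyc.2 he)

theorem exists_split_two {M : List ι} {u v : ι} (hu : u ∈ M) (hv : v ∈ M) (hne : u ≠ v) :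
    ∃ A B C, M = A ++ u :: B ++ v :: C ∨ M = A ++ v :: B ++ u :: C := by
  obtain ⟨s, t, rfl⟩ := List.append_of_mem hu
  rcases List.mem_append.1 hv with h | h
  · obtain ⟨a, b, rfl⟩ := List.append_of_mem h
    exact ⟨a, b, t, Or.inr (by simp)⟩
  · simp only [List.mem_cons, hne.symm, false_or] at h
    obtain ⟨a, b, rfl⟩ := List.append_of_mem h
    exact ⟨s, a, b, Or.inl (by simp)⟩

theorem last_mem_path {a w q : ι} {l : List ι} (h : l.getLast? = some w) :
    (w, q) ∈ path a (l ++ [q]) := by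
  obtain ⟨i, rfl⟩ := List.getLast?_eq_some_iff.1 h
  rw [List.append_assoc, List.singleton_append, path_append]
  simp [path]

/-- As long as the part at `pq` has a corner other than `p`, `q` and the predecessor of `q`,
`exists_idiag_avoiding` gives a diagonal not ending at `q` along which vertices can be cut off. The
edge arriving at `q` survives, so `q` remains a corner and the process continues until no such
corner is left. -/
theorem Oriented.exists_fan (hR : GP R) {p q : ι} {l₁ l₂ : List ι} {σ : ℝ}
    (hL : Oriented R (p :: l₁ ++ q :: l₂) σ) (hd : IDiag R (p :: l₁ ++ q :: l₂) p q)
    (hq : q ∈ Corner R σ (p :: l₁ ++ [q])) :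
    ∃ l, l ≠ [] ∧ l.Sublist l₁ ∧ l.getLast? = l₁.getLast? ∧ Oriented R (p :: l ++ q :: l₂) σ ∧
      IDiag R (p :: l ++ q :: l₂) p q ∧
      (∀ e ∈ path p (l ++ [q]), e ∈ cyc (p :: l₁ ++ [q]) ∨ IDiag R (p :: l₁ ++ [q]) e.1 e.2) ∧
      ∀ x ∈ l, x ∈ Corner R σ (p :: l ++ [q]) → l.getLast? = some x := by
  induction hlen : l₁.length using Nat.strong_induction_on generalizing l₁ with
  | _ k ih =>
  subst hlen
  obtain ⟨⟨o1, o2⟩, ⟨i1, i2⟩, -, -⟩ := hL.cut hR hd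
  have hnd := o1.simple.nodup
  have hne := hd.free.ne_nil.1
  by_cases hx : ∃ x ∈ l₁, x ∈ Corner R σ (p :: l₁ ++ [q]) ∧ l₁.getLast? ≠ some x
  swap
  · push Not at hx
    refine ⟨l₁, hne, List.Sublist.refl _, rfl, hL, hd, fun e he => Or.inl ?_, hx⟩
    rw [cyc_left]
    exact List.mem_append_left _ he
  obtain ⟨x, hx1, hxC, hxl⟩ := hx
  have hqp : (q, p) ∈ cyc (p :: l₁ ++ [q]) := by rw [cyc_left]; simp
  obtain ⟨w, hw⟩ : ∃ w, l₁.getLast? = some w := by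
    cases h : l₁.getLast? with
    | none => simp at h; exact absurd h hne
    | some w => exact ⟨w, rfl⟩
  have hwq : (w, q) ∈ cyc (p :: l₁ ++ [q]) := by
    rw [cyc_left]; exact List.mem_append_left _ (last_mem_path hw)
  have hxq : x ≠ q := by
    rintro rfl
    rw [List.nodup_append] at hnd
    exact hnd.2.2 x (by simp [hx1]) x (by simp) rfl
  obtain ⟨y, hy⟩ := exists_prev (corner_subset σ _ hxC)
  obtain ⟨z, hz⟩ := exists_next (corner_subset σ _ hxC)
  have hyq : y ≠ q := by
    rintro rfl
    obtain rfl := next_unique hnd hy hqp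
    simp [hx1] at hnd
  have hzq : z ≠ q := by
    rintro rfl
    obtain rfl := prev_unique hnd hz hwq
    exact hxl hw
  obtain ⟨u, v, huv, huq, hvq⟩ := o1.exists_idiag_avoiding hR hq hxC hxq hy hz hyq hzq
  have hum : u ∈ p :: l₁ := by simpa [huq] using huv.left_mem
  have hvm : v ∈ p :: l₁ := by simpa [hvq] using huv.right_mem
  obtain ⟨u, v, huv, A, B, C, hABC⟩ : ∃ u v, IDiag R (p :: l₁ ++ [q]) u v ∧ ∃ A B C,
      p :: l₁ = A ++ u :: B ++ v :: C := by
    obtain ⟨A, B, C, h | h⟩ := exists_split_two hum hvm huv.ne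
    · exact ⟨u, v, huv, A, B, C, h⟩
    · exact ⟨v, u, huv.symm, A, B, C, h⟩
  obtain ⟨l, hl⟩ : ∃ l, p :: l = A ++ u :: v :: C := by
    cases A with
    | nil =>
      simp only [List.nil_append, List.cons_append, List.cons.injEq] at hABC
      exact ⟨v :: C, by simp [hABC.1]⟩
    | cons a A =>
      simp only [List.cons_append, List.cons.injEq] at hABC
      exact ⟨A ++ u :: v :: C, by simp [hABC.1]⟩
  have hLm : ∀ X, p :: l₁ ++ X = A ++ u :: B ++ v :: (C ++ X) := by intro X; rw [hABC]; simp
  have hlm : ∀ X, p :: l ++ X = A ++ u :: v :: (C ++ X) := by intro X; rw [hl]; simp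
  have hsubl : l.Sublist l₁ := by
    rw [← List.cons_sublist_cons (a := p), hl, hABC]
    simp only [List.append_assoc, List.cons_append]
    refine (List.Sublist.refl _).append (List.Sublist.cons_cons _ ?_)
    exact List.sublist_append_right _ _
  have huvL : IDiag R (p :: l₁ ++ q :: l₂) u v := huv.mono (fun x hx => by simp at hx ⊢; tauto) i1
  obtain ⟨hB, oF, iF, iF', -, eF⟩ : B ≠ [] ∧ Oriented R (p :: l ++ [q]) σ ∧
      inside R (p :: l ++ [q]) ⊆ inside R (p :: l₁ ++ [q]) ∧
      inside R (u :: B ++ [v]) ⊆ inside R (p :: l₁ ++ [q]) ∧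
      (∀ z ∈ inside R (p :: l₁ ++ [q]), z ∉ openSegment ℝ (R u) (R v) →
        z ∈ inside R (u :: B ++ [v]) ∨ z ∈ inside R (p :: l ++ [q])) ∧
      ∀ e ∈ cyc (p :: l ++ [q]), e ∈ cyc (p :: l₁ ++ [q]) ∨ e = (u, v) := by
    rw [hLm] at o1 huv ⊢
    rw [hlm]
    exact o1.cut_off hR huv
  obtain ⟨-, oL', -, -, covL', -⟩ : B ≠ [] ∧ Oriented R (p :: l ++ q :: l₂) σ ∧
      inside R (p :: l ++ q :: l₂) ⊆ inside R (p :: l₁ ++ q :: l₂) ∧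
      inside R (u :: B ++ [v]) ⊆ inside R (p :: l₁ ++ q :: l₂) ∧
      (∀ z ∈ inside R (p :: l₁ ++ q :: l₂), z ∉ openSegment ℝ (R u) (R v) →
        z ∈ inside R (u :: B ++ [v]) ∨ z ∈ inside R (p :: l ++ q :: l₂)) ∧
      ∀ e ∈ cyc (p :: l ++ q :: l₂), e ∈ cyc (p :: l₁ ++ q :: l₂) ∨ e = (u, v) := by
    rw [hLm] at hL huvL ⊢
    rw [hlm]
    exact hL.cut_off hR huvL
  -- The piece cut off lies inside the part bounded by `pq`, so it contains no point of this
  -- diagonal.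
  have hd' : IDiag R (p :: l ++ q :: l₂) p q := by
    refine ⟨by simp, by simp, hd.ne, fun z hz => ?_⟩
    have hzb : z ∈ bd R (p :: l₁ ++ [q]) := by
      rw [bd_left]; exact Or.inr (openSegment_subset_segment _ _ _ hz)
    refine (covL' z (hd.sub hz) fun h => (huv.sub h).1 hzb).resolve_left fun h => (iF' h).1 hzb
  have hlast : l.getLast? = l₁.getLast? := by
    have e1 : (p :: l).getLast? = (p :: l₁).getLast? := by
      rw [hl, hABC]; simp [List.getLast?_append, List.getLast?_cons]
    have hl0 : l ≠ [] := by rintro rfl; have := congrArg List.length hl; simp at this; omega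
    obtain ⟨a, l', rfl⟩ := List.exists_cons_of_ne_nil hl0
    obtain ⟨b, l'', rfl⟩ := List.exists_cons_of_ne_nil hne
    simpa only [List.getLast?_cons_cons] using e1
  have hqF : q ∈ Corner R σ (p :: l ++ [q]) := by
    rw [oF.simple.mem_corner (p := w) (n := p)]
    · exact (o1.simple.mem_corner hwq hqp).1 hq
    · rw [cyc_left]; exact List.mem_append_left _ (last_mem_path (hlast.trans hw))
    · rw [cyc_left]; simp
  have hlt : l.length < l₁.length := by
    have h1 := congrArg List.length hl
    have h2 := congrArg List.length hABC
    have := List.length_pos_iff.2 hB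
    simp at h1 h2
    omega
  obtain ⟨m, m1, m2, m3, m4, m0, m5, m6⟩ := ih _ hlt oL' hd' hqF rfl
  refine ⟨m, m1, m2.trans hsubl, m3.trans hlast, m4, m0, fun e he => ?_, m6⟩
  rcases m5 e he with h | h
  · rcases eF e h with h | rfl
    · exact Or.inl h
    · exact Or.inr huv
  · refine Or.inr (h.mono (fun x hx => ?_) iF)
    simp only [List.cons_append, List.mem_cons, List.mem_append] at hx ⊢
    rcases hx with h | h | h
    · exact Or.inl h
    · exact Or.inr (Or.inl (hsubl.subset h))
    · exact Or.inr (Or.inr h)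

/-! ### Diagonals that keep the other end pointed -/

variable (R) in
/-- If `t` is a reflex vertex of `L` then it becomes reflex in one of the two parts into which `L`
is cut along the diagonal from `p` to `t`. -/
def Good (σ : ℝ) (L : List ι) (p t : ι) : Prop :=
  ∃ x y, (x, t) ∈ cyc L ∧ (t, y) ∈ cyc L ∧
    (0 < σ * ori R x t y ∨ ¬0 < σ * ori R x t p ∨ ¬0 < σ * ori R p t y)

theorem Rot.good {L L' : List ι} (hr : Rot L L') {σ : ℝ} {p t : ι} (h : Good R σ L p t) :
    Good R σ L' p t := by
  obtain ⟨x, y, hx, hy, h⟩ := h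
  exact ⟨x, y, hr.mem_cyc.1 hx, hr.mem_cyc.1 hy, h⟩

theorem Oriented.cut_next (hR : GP R) {p t : ι} {l₁ l₂ : List ι} {σ : ℝ}
    (hL : Oriented R (p :: l₁ ++ t :: l₂) σ) (hd : IDiag R (p :: l₁ ++ t :: l₂) p t) {x y : ι}
    (hx : (x, t) ∈ cyc (p :: l₁ ++ t :: l₂)) (hy : (t, y) ∈ cyc (p :: l₁ ++ t :: l₂)) :
    (t ∈ Corner R σ (p :: l₁ ++ [t]) ↔ 0 < σ * ori R x t p) ∧
      (t ∈ Corner R σ (p :: t :: l₂) ↔ 0 < σ * ori R p t y) := by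
  obtain ⟨⟨o1, o2⟩, -⟩ := hL.cut hR hd
  have hr := rot_swap p l₁ t l₂
  obtain ⟨a1, a2, a3, a4⟩ := cut_edges (hr.nodup hL.simple.nodup) (hr.mem_cyc.1 hx)
    (hr.mem_cyc.1 hy)
  rw [← (rot_right p t l₂).mem_cyc] at a1 a2
  rw [← (rot_left p l₁ t).mem_cyc] at a3 a4
  exact ⟨o1.simple.mem_corner a3 a4, o2.simple.mem_corner a2 a1⟩

theorem Oriented.good_iff (hR : GP R) {p t : ι} {l₁ l₂ : List ι} {σ : ℝ}
    (hL : Oriented R (p :: l₁ ++ t :: l₂) σ) (hd : IDiag R (p :: l₁ ++ t :: l₂) p t) :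
    Good R σ (p :: l₁ ++ t :: l₂) p t ↔ (t ∈ Corner R σ (p :: l₁ ++ t :: l₂) ∨
      t ∉ Corner R σ (p :: l₁ ++ [t]) ∨ t ∉ Corner R σ (p :: t :: l₂)) := by
  constructor
  · rintro ⟨x, y, hx, hy, h⟩
    obtain ⟨e1, e2⟩ := hL.cut_next hR hd hx hy
    rwa [e1, e2, hL.simple.mem_corner hx hy]
  · intro h
    obtain ⟨x, hx⟩ := exists_prev hd.right_mem
    obtain ⟨y, hy⟩ := exists_next hd.right_mem
    obtain ⟨e1, e2⟩ := hL.cut_next hR hd hx hy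
    rw [e1, e2, hL.simple.mem_corner hx hy] at h
    exact ⟨x, y, hx, hy, h⟩

end PlanarCycle

/-! ### Finding a good diagonal when the parts have four and three corners. -/

namespace PlanarCycle

variable {ι : Type*} {R : ι → ℂ}

theorem ncard_corner_triangle_le (σ : ℝ) (a b c : ι) : (Corner R σ [a, b, c]).ncard ≤ 3 := by
  classical
  refine (Set.ncard_le_ncard (t := (({a, b, c} : Finset ι) : Set ι)) ?_ (Finset.finite_toSet _)).trans ?_
  · intro x hx; simpa using corner_subset σ _ hx
  · rw [Set.ncard_coe_finset]; exact Finset.card_le_three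

/-- After trimming with `exists_fan`, every vertex strictly between `p` and `q` on the trimmed
boundary, except possibly the last, is reflex in the trimmed polygon. If only one vertex `f` is
left, then `pf` is good or leads to the same situation with a smaller first part. If there are more,
the diagonal to the first of them is good. -/
theorem Oriented.exists_good_of_four (hR : GP R) {p q : ι} {l₁ l₂ : List ι} {σ : ℝ}
    (hL : Oriented R (p :: l₁ ++ q :: l₂) σ) (hd : IDiag R (p :: l₁ ++ q :: l₂) p q)
    (hp : p ∉ Corner R σ (p :: l₁ ++ q :: l₂)) (hq : q ∉ Corner R σ (p :: l₁ ++ q :: l₂))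
    (hp1 : p ∈ Corner R σ (p :: l₁ ++ [q])) (hp2 : p ∈ Corner R σ (p :: q :: l₂))
    (hq1 : q ∈ Corner R σ (p :: l₁ ++ [q])) (hq2 : q ∈ Corner R σ (p :: q :: l₂))
    (h4 : (Corner R σ (p :: l₁ ++ [q])).ncard = 4) (h3 : (Corner R σ (p :: q :: l₂)).ncard = 3) :
    ∃ t, IDiag R (p :: l₁ ++ q :: l₂) p t ∧ Good R σ (p :: l₁ ++ q :: l₂) p t := by
  classical
  induction hlen : l₁.length using Nat.strong_induction_on generalizing l₁ l₂ q with
  | _ k ih =>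
  subst hlen
  have hnd := hL.simple.nodup
  obtain ⟨⟨o1, o2⟩, ⟨i1, i2⟩, -, -⟩ := hL.cut hR hd
  have hcount := corner_count (R := R) hnd σ
  rw [h4, h3, if_neg hp, if_neg hq, if_pos hp1, if_pos hp2, if_pos hq1, if_pos hq2] at hcount
  obtain ⟨l, hl0, hsub, hlast, oL', dL', hedge, hrefl⟩ := hL.exists_fan hR hd hq1
  have hnd' := oL'.simple.nodup
  match l, hl0 with
  | [f], _ =>
    have hlast' : l₁.getLast? = some f := hlast.symm
    -- If `pf` were an edge, the part would be a triangle, contradicting its four corners.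
    have hf : (p, f) ∉ cyc (p :: l₁ ++ [q]) := by
      intro h
      obtain ⟨m, hm⟩ := List.getLast?_eq_some_iff.1 hlast'
      cases m with
      | nil =>
        subst hm
        have := ncard_corner_triangle_le (R := R) σ p f q
        have h4' : (Corner R σ [p, f, q]).ncard = 4 := h4
        omega
      | cons a m =>
        subst hm
        have h' : (p, a) ∈ cyc (p :: (a :: m ++ [f]) ++ [q]) := by simp [cyc, path]
        obtain rfl := next_unique o1.simple.nodup h h'
        simp at hnd
    have hpf1 : IDiag R (p :: l₁ ++ [q]) p f :=
      (hedge (p, f) (by simp [path])).resolve_left hf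
    have hpf : IDiag R (p :: l₁ ++ q :: l₂) p f :=
      hpf1.mono (fun x hx => by simp at hx ⊢; tauto) i1
    by_cases hg : Good R σ (p :: l₁ ++ q :: l₂) p f
    · exact ⟨f, hpf, hg⟩
    obtain ⟨m, rfl⟩ := List.getLast?_eq_some_iff.1 hlast'
    have e1 : p :: (m ++ [f]) ++ q :: l₂ = p :: m ++ f :: (q :: l₂) := by simp
    have e2 : p :: (m ++ [f]) ++ [q] = p :: m ++ f :: [q] := by simp
    have hfC1 : f ∈ Corner R σ (p :: (m ++ [f]) ++ [q]) ↔ f ∈ Corner R σ (p :: (m ++ [f]) ++ q :: l₂) := by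
      obtain ⟨x, hx⟩ := exists_prev hpf1.right_mem
      obtain ⟨y, hy⟩ := exists_next hpf1.right_mem
      have := fun z => mem_cyc_left_iff hnd (x := f) (y := z) (by simp)
      rw [o1.simple.mem_corner hx hy, hL.simple.mem_corner ((this x).1.1 hx) ((this y).2.1 hy)]
    rw [e1] at hpf hg hL hp hcount hfC1 ⊢
    rw [e2] at hpf1 o1 hp1 h4 hfC1
    rw [hL.good_iff hR hpf] at hg
    push Not at hg
    obtain ⟨g1, g2, g3⟩ := hg
    have c1 := corner_count (R := R) o1.simple.nodup σ
    have c2 := corner_count (R := R) hL.simple.nodup σ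
    obtain ⟨⟨oA, oB⟩, -⟩ := hL.cut hR hpf
    obtain ⟨⟨oA', oF⟩, -⟩ := o1.cut hR hpf1
    have hpA := (o1.cut_corner hR hpf1).1 hp1
    have hF := le_antisymm (ncard_corner_triangle_le (R := R) σ p f q) (oF.three_le_corner hR)
    have hfF : f ∈ Corner R σ [p, f, q] := by
      obtain ⟨s, hs⟩ := o1.cut_corner' hR hpf1
      by_contra hcon
      have hsub' : Corner R σ [p, f, q] ⊆ (({p, q} : Finset ι) : Set ι) := by
        intro x hx
        have := corner_subset σ _ hx
        simp at this ⊢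
        rcases this with rfl | rfl | rfl
        · exact Or.inl rfl
        · exact absurd hx hcon
        · exact Or.inr rfl
      have := Set.ncard_le_ncard hsub' (Finset.finite_toSet _)
      rw [Set.ncard_coe_finset, hF] at this
      have := Finset.card_le_two (a := p) (b := q)
      omega
    have hB3 := oB.three_le_corner hR
    -- If `pf` is not good, counting in the part with four corners, cut into the piece before `f`
    -- and the triangle `pfq`, leaves four corners for that piece. Counting in the whole polygon and
    -- the bound of three for the other piece then force that piece to have exactly three corners,
    -- `p` among them: the same hypotheses with `f` in place of `q`.
    rw [h4, if_pos hp1, if_neg (fun h => g1 (hfC1.1 h)), if_pos hpA.1, if_pos g2, if_pos hpA.2,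
      if_pos hfF, hF] at c1
    rw [if_neg hp, if_neg g1, if_pos hpA.1, if_pos g2, if_pos g3] at c2
    have hpB : p ∈ Corner R σ (p :: f :: q :: l₂) := by
      by_contra h
      rw [if_neg h] at c2
      omega
    rw [if_pos hpB] at c2
    exact ih _ (by simp) hL hpf hp g1 hpA.1 hpB g2 g3 (by omega) (by omega) rfl
  | f₁ :: f₂ :: l, _ =>
    have hne : ∀ x, (f₁ :: f₂ :: l).getLast? = some x → x ∈ f₂ :: l := by
      intro x hx
      rw [List.getLast?_cons_cons] at hx
      exact List.mem_of_getLast? hx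
    have hnd1 : f₁ ∉ f₂ :: l := by
      intro h
      have := hnd'.sublist (l₁ := f₁ :: f₂ :: l) (by simp)
      simp at this h
      tauto
    -- `f₁` is not the last vertex of the trimmed list, so it is reflex there.
    have hf1F : f₁ ∉ Corner R σ (p :: (f₁ :: f₂ :: l) ++ [q]) := fun h =>
      hnd1 (hne _ (hrefl f₁ (by simp) h))
    obtain ⟨w, hw⟩ : ∃ w, (f₁ :: f₂ :: l).getLast? = some w := by
      rw [List.getLast?_eq_getLast_of_ne_nil (by simp)]; exact ⟨_, rfl⟩
    obtain ⟨x₀, hx₀⟩ := exists_prev hd.left_mem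
    obtain ⟨y₀, hy₀⟩ := exists_next hd.right_mem
    have hx₀2 : (x₀, p) ∈ path q (l₂ ++ [p]) := by
      rcases List.mem_append.1 (cyc_split p l₁ q l₂ ▸ hx₀) with h | h
      · have := (path_mem h).2
        simp [hd.ne] at this hnd
        tauto
      · exact h
    have hy₀2 : (q, y₀) ∈ path q (l₂ ++ [p]) := by
      rcases List.mem_append.1 (cyc_split p l₁ q l₂ ▸ hy₀) with h | h
      · obtain ⟨z, hz⟩ : ∃ z, (q, z) ∈ path q (l₂ ++ [p]) := by
          cases l₂ <;> simp [path]
        have : (q, z) ∈ cyc (p :: l₁ ++ q :: l₂) := by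
          rw [cyc_split]; exact List.mem_append_right _ hz
        rwa [next_unique hnd hy₀ this]
      · exact h
    -- If `p f₁` were an edge, `p` and `q` would have the same neighbours in the whole trimmed
    -- polygon as in the original one and stay reflex. Its corners would be at most `w` and the
    -- single corner of the second part other than `p` and `q`: fewer than three.
    have hpf1 : IDiag R (p :: l₁ ++ [q]) p f₁ := by
      refine (hedge (p, f₁) (by simp [path])).resolve_left fun h => ?_
      have hpL : (p, f₁) ∈ cyc (p :: l₁ ++ q :: l₂) :=
        (mem_cyc_left l₂ h).resolve_right fun h => by
          simp only [Prod.mk.injEq] at h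
          exact hd.ne h.1
      have hpn : p ∉ Corner R σ (p :: (f₁ :: f₂ :: l) ++ q :: l₂) := by
        rw [oL'.simple.mem_corner (p := x₀) (n := f₁)]
        · rwa [hL.simple.mem_corner hx₀ hpL] at hp
        · rw [cyc_split]; exact List.mem_append_right _ hx₀2
        · simp [cyc, path]
      have hqn : q ∉ Corner R σ (p :: (f₁ :: f₂ :: l) ++ q :: l₂) := by
        have hwq : (w, q) ∈ cyc (p :: l₁ ++ q :: l₂) := by
          rw [cyc_split]; exact List.mem_append_left _ (last_mem_path (hlast.symm.trans hw))
        rw [oL'.simple.mem_corner (p := w) (n := y₀)]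
        · rwa [hL.simple.mem_corner hwq hy₀] at hq
        · rw [cyc_split]; exact List.mem_append_left _ (last_mem_path hw)
        · rw [cyc_split]; exact List.mem_append_right _ hy₀2
      have hsubC : Corner R σ (p :: (f₁ :: f₂ :: l) ++ q :: l₂) ⊆
          insert w (Corner R σ (p :: q :: l₂) \ {p, q}) := by
        rintro x ⟨y, z, hy, hz, ho⟩
        have hxC : x ∈ Corner R σ (p :: (f₁ :: f₂ :: l) ++ q :: l₂) := ⟨y, z, hy, hz, ho⟩
        have hxp : x ≠ p := by rintro rfl; exact hpn hxC
        have hxq : x ≠ q := by rintro rfl; exact hqn hxC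
        have hm : x ∈ f₁ :: f₂ :: l ∨ x ∈ l₂ := by
          have := (mem_of_mem_cyc hz).1
          simp [hxp, hxq] at this ⊢
          tauto
        rcases hm with hm | hm
        · left
          have := fun z => mem_cyc_left_iff hnd' (y := z) hm
          have := hrefl x hm ⟨y, z, (this y).1.2 hy, (this z).2.2 hz, ho⟩
          rw [hw] at this
          exact (Option.some.inj this).symm
        · right
          have := fun z => mem_cyc_right_iff hnd' (y := z) hm
          refine ⟨⟨y, z, (this y).1.2 hy, (this z).2.2 hz, ho⟩, ?_⟩
          simp [hxp, hxq]
      have hfin : (Corner R σ (p :: q :: l₂) \ {p, q}).Finite := (finite_corner σ _).sdiff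
      have h1 := Set.ncard_le_ncard hsubC (hfin.insert w)
      have h2 := Set.ncard_insert_le w (Corner R σ (p :: q :: l₂) \ {p, q})
      have h3' := ncard_eq_diff_pair (finite_corner (R := R) σ (p :: q :: l₂)) hd.ne
      rw [if_pos hp2, if_pos hq2, h3] at h3'
      have := oL'.three_le_corner hR
      omega
    have hf1l : f₁ ∈ l₁ := hsub.subset (by simp)
    have hpf : IDiag R (p :: l₁ ++ q :: l₂) p f₁ :=
      hpf1.mono (fun x hx => by simp at hx ⊢; tauto) i1
    refine ⟨f₁, hpf, ?_⟩
    obtain ⟨a, b, rfl⟩ := List.append_of_mem hf1l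
    have hf2 : f₂ ∈ b := by
      have hnda : f₁ ∉ a := by
        intro h
        have := hnd.sublist (l₁ := a ++ f₁ :: b) (by simp)
        rw [List.nodup_append] at this
        exact this.2.2 f₁ h f₁ (by simp) rfl
      have hs : (f₂ :: l).Sublist b := by
        have : ∀ a : List ι, f₁ ∉ a → (f₁ :: f₂ :: l).Sublist (a ++ f₁ :: b) →
            (f₂ :: l).Sublist b := by
          intro a
          induction a with
          | nil => intro _ h; simpa using h
          | cons c a iha =>
            intro h1 h2
            simp only [List.mem_cons, not_or] at h1
            refine iha h1.2 ?_
            rw [List.cons_append] at h2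
            exact h2.of_cons_of_ne h1.1
        exact this a hnda hsub
      exact hs.subset (by simp)
    have e1 : p :: (a ++ f₁ :: b) ++ q :: l₂ = p :: a ++ f₁ :: (b ++ q :: l₂) := by simp
    have e2 : p :: (a ++ f₁ :: b) ++ [q] = p :: a ++ f₁ :: (b ++ [q]) := by simp
    obtain ⟨x, hx⟩ := exists_prev hpf1.right_mem
    obtain ⟨y, hy⟩ := exists_next hpf1.right_mem
    have hedges := fun z => mem_cyc_left_iff hnd (x := f₁) (y := z) hf1l
    -- Goodness comes from the part behind `f₁`: `f₁` is to be shown reflex there.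
    refine ⟨x, y, (hedges x).1.1 hx, (hedges y).2.1 hy, Or.inr (Or.inr ?_)⟩
    have hf1F' : ¬0 < σ * ori R p f₁ f₂ := by
      have oF : Simple R (p :: (f₁ :: f₂ :: l) ++ [q]) := (oL'.cut hR dL').1.1.simple
      rwa [oF.mem_corner (p := p) (n := f₂) (by simp [cyc, path]) (by simp [cyc, path])] at hf1F
    -- If `f₁f₂` is a diagonal, it stays inside the part behind `p f₁`. Were `f₁` a corner of that
    -- part, it would be a corner of the piece in which its neighbours are `p` and `f₂`, against the
    -- trimming.
    rcases hedge (f₁, f₂) (by simp [path]) with h | h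
    · rwa [next_unique o1.simple.nodup hy h]
    · rw [e2] at o1 hpf1 h hx hy
      have hD := IDiag.cut_right hR o1 hpf1 h (by simp [hf2])
      have oD := (o1.cut hR hpf1).1.2
      rw [← (o1.cut_next hR hpf1 hx hy).2]
      obtain ⟨c, d, hr⟩ := exists_rot_two hD.left_mem hD.right_mem hD.ne
      have hp' : (p, f₁) ∈ cyc (p :: f₁ :: (b ++ [q])) := by simp [cyc, path]
      obtain ⟨z, hz⟩ := exists_next hD.left_mem
      have oD' := hr.oriented oD
      have hD' := hr.idiag hD
      obtain ⟨-, -, c1, c2⟩ := cut_edges oD'.simple.nodup (hr.mem_cyc.1 hp') (hr.mem_cyc.1 hz)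
      rw [hr.corner]
      intro hc
      have := ((oD'.cut_corner hR hD').1 hc).2
      rw [(oD'.cut hR hD').1.2.simple.mem_corner c1 c2] at this
      exact hf1F' this

end PlanarCycle

namespace PlanarCycle

variable {ι : Type*} {R : ι → ℂ}

/-! ### Reversing a polygon -/

/-- Two lists that describe the same cyclic sequence, in opposite directions. -/
def Rev (L L' : List ι) : Prop := L.Perm L' ∧ (cyc L').Perm ((cyc L).map Prod.swap)

theorem rev_cons (a : ι) (l : List ι) : Rev (a :: l) (a :: l.reverse) :=
  ⟨(List.reverse_perm l).symm.cons a, cyc_reverse a l⟩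

theorem Rev.symm {L L' : List ι} (h : Rev L L') : Rev L' L := by
  refine ⟨h.1.symm, ?_⟩
  have := h.2.map Prod.swap
  simpa using this.symm

theorem Rev.mem_cyc {L L' : List ι} (h : Rev L L') {x y : ι} : (x, y) ∈ cyc L' ↔ (y, x) ∈ cyc L := by
  rw [h.2.mem_iff]; simp

theorem Rev.bd {L L' : List ι} (h : Rev L L') : bd R L' = bd R L := by
  ext z
  constructor
  · rintro ⟨⟨a, b⟩, he, hz⟩
    exact ⟨(b, a), h.mem_cyc.1 he, by rw [segment_symm]; exact hz⟩
  · rintro ⟨⟨a, b⟩, he, hz⟩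
    exact ⟨(b, a), h.mem_cyc.2 he, by rw [segment_symm]; exact hz⟩

theorem Rev.wind {L L' : List ι} (h : Rev L L') {z : ℂ} (hz : z ∉ PlanarCycle.bd R L) :
    PlanarCycle.wind R L' z = -PlanarCycle.wind R L z := by
  have e : PlanarCycle.wind R L' z = (((cyc L).map Prod.swap).map (term R z)).sum := (h.2.map _).sum_eq
  have e' : PlanarCycle.wind R L z = ((cyc L).map (term R z)).sum := rfl
  rw [e, e', List.sum_neg, List.map_map, List.map_map]
  congr 1
  refine List.map_congr_left fun x hx => ?_
  exact term_swap fun hs => hz ⟨x, hx, hs⟩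

theorem Rev.inside {L L' : List ι} (h : Rev L L') : inside R L' = inside R L := by
  ext z
  simp only [PlanarCycle.inside, Set.mem_ofPred_eq, h.bd]
  refine and_congr_right fun hz => ?_
  rw [h.wind hz, neg_ne_zero]

theorem Rev.oriented {L L' : List ι} (h : Rev L L') {σ : ℝ} (hL : Oriented R L σ) :
    Oriented R L' (-σ) where
  simple :=
    { nodup := h.1.nodup_iff.1 hL.simple.nodup
      three_le := h.1.length_eq ▸ hL.simple.three_le
      disjoint := fun a b c d h1 h2 n1 n2 n3 n4 => by
        have := hL.simple.disjoint b a d c (h.mem_cyc.1 h1) (h.mem_cyc.1 h2) n4 n3 n2 n1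
        rwa [segment_symm ℝ (R a), segment_symm ℝ (R c)] }
  sign := by rcases hL.sign with rfl | rfl <;> simp
  wind_mem := fun z hz => by
    rw [h.bd] at hz
    rw [h.wind hz]
    rcases hL.wind_mem z hz with e | e
    · exact Or.inl (by rw [e, neg_zero])
    · exact Or.inr (by rw [e]; ring)

theorem ori_reverse (i j k : ι) : ori R k j i = -ori R i j k := by
  rw [ori_rot, ori_rot, ori_swap]

theorem Rev.corner {L L' : List ι} (h : Rev L L') (σ : ℝ) : Corner R (-σ) L' = Corner R σ L := by
  ext x
  constructor
  · rintro ⟨p, n, hp, hn, ho⟩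
    exact ⟨n, p, h.mem_cyc.1 hn, h.mem_cyc.1 hp, by rw [ori_reverse]; linarith⟩
  · rintro ⟨p, n, hp, hn, ho⟩
    exact ⟨n, p, h.mem_cyc.2 hn, h.mem_cyc.2 hp, by rw [ori_reverse]; linarith⟩

theorem Rev.idiag {L L' : List ι} (h : Rev L L') {u w : ι} (hd : IDiag R L u w) : IDiag R L' u w :=
  ⟨h.1.mem_iff.1 hd.left_mem, h.1.mem_iff.1 hd.right_mem, hd.ne, by rw [h.inside]; exact hd.sub⟩

theorem Rev.good {L L' : List ι} (h : Rev L L') {σ : ℝ} {p t : ι} (hg : Good R σ L p t) :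
    Good R (-σ) L' p t := by
  obtain ⟨x, y, hx, hy, ho⟩ := hg
  refine ⟨y, x, h.mem_cyc.2 hy, h.mem_cyc.2 hx, ?_⟩
  rw [ori_reverse x t y, ori_reverse p t y, ori_reverse x t p, neg_mul_neg, neg_mul_neg, neg_mul_neg]
  tauto

/-! ### The diagonal at a reflex vertex of a pseudo-triangle -/

/-- A first diagonal at `p` is good, or leaves a smaller pseudo-triangle in which `p` is still
reflex, or leads to the case of four and three corners. A diagonal found inside a part ends strictly
between `p` and `q`, so its end has the same neighbours in the whole polygon and goodness carries
over. -/
theorem Oriented.exists_good (hR : GP R) {L : List ι} {p : ι} {σ : ℝ} (hL : Oriented R L σ)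
    (h3 : (Corner R σ L).ncard = 3) (hpL : p ∈ L) (hp : p ∉ Corner R σ L) :
    ∃ t, IDiag R L p t ∧ Good R σ L p t := by
  classical
  induction hlen : L.length using Nat.strong_induction_on generalizing L with
  | _ k ih =>
  subst hlen
  -- In a triangle on the edge leaving `p`, the other side at `p` cannot be an edge of the polygon,
  -- since `p` would then be a corner.
  obtain ⟨q, hq⟩ : ∃ q, IDiag R L p q := by
    obtain ⟨b, hb⟩ := exists_next hpL
    obtain ⟨c, -, -, -, -, h, -, ho⟩ := hL.exists_apex hR hb
    rcases h with h | h
    · refine absurd ((hL.simple.mem_corner h hb).2 ?_) hp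
      rwa [ori_rot]
    · exact ⟨c, h.symm⟩
  obtain ⟨l₁, l₂, hr⟩ := exists_rot_two hq.left_mem hq.right_mem hq.ne
  have hd := hr.idiag hq
  suffices ∃ t, IDiag R (p :: l₁ ++ q :: l₂) p t ∧ Good R σ (p :: l₁ ++ q :: l₂) p t by
    obtain ⟨t, h1, h2⟩ := this
    exact ⟨t, hr.symm.idiag h1, hr.symm.good h2⟩
  have hlen := hr.1.length_eq
  replace hL := hr.oriented hL
  rw [hr.corner] at h3 hp
  have hnd := hL.simple.nodup
  obtain ⟨n1, n2⟩ := hd.free.ne_nil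
  have := List.length_pos_iff.2 n1
  have := List.length_pos_iff.2 n2
  simp at hlen
  by_cases hg : Good R σ (p :: l₁ ++ q :: l₂) p q
  · exact ⟨q, hd, hg⟩
  have hg' := hg
  rw [hL.good_iff hR hd] at hg'
  push Not at hg'
  obtain ⟨g1, g2, g3⟩ := hg'
  obtain ⟨⟨o1, o2⟩, ⟨i1, i2⟩, -⟩ := hL.cut hR hd
  have hcount := corner_count (R := R) hnd σ
  -- The numbers of corners of the two parts now add up to five plus the number of parts that have
  -- `p` as a corner, and each is at least three.
  rw [h3, if_neg hp, if_neg g1, if_pos g2, if_pos g3] at hcount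
  have t1 := o1.three_le_corner hR
  have t2 := o2.three_le_corner hR
  by_cases hp1 : p ∈ Corner R σ (p :: l₁ ++ [q])
  swap
  · obtain ⟨t, ht, x, y, hx, hy, ho⟩ := ih _ (by simp; omega) o1
      (by rw [if_neg hp1] at hcount; split_ifs at hcount <;> omega) (by simp) hp1 rfl
    have htl : t ∈ l₁ := by
      have htp := ht.ne.symm
      have htq : t ≠ q := by
        rintro rfl
        exact ht.free.notMem_cyc.2 (by rw [cyc_left]; simp)
      simpa [htp, htq] using ht.right_mem
    have he := fun z => mem_cyc_left_iff hnd (x := t) (y := z) htl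
    exact ⟨t, ht.mono (fun x hx => by simp at hx ⊢; tauto) i1, x, y, (he x).1.1 hx,
      (he y).2.1 hy, ho⟩
  by_cases hp2 : p ∈ Corner R σ (p :: q :: l₂)
  swap
  · obtain ⟨t, ht, x, y, hx, hy, ho⟩ := ih _ (by simp; omega) o2
      (by rw [if_neg hp2] at hcount; split_ifs at hcount; omega) (by simp) hp2 rfl
    have htl : t ∈ l₂ := by
      have htp := ht.ne.symm
      have htq : t ≠ q := by
        rintro rfl
        exact ht.free.notMem_cyc.1 (by rw [cyc_right]; simp)
      simpa [htp, htq] using ht.right_mem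
    have he := fun z => mem_cyc_right_iff hnd (x := t) (y := z) htl
    exact ⟨t, ht.mono (fun x hx => by simp at hx ⊢; tauto) i2, x, y, (he x).1.1 hx,
      (he y).2.1 hy, ho⟩
  rw [if_pos hp1, if_pos hp2] at hcount
  by_cases h4 : (Corner R σ (p :: l₁ ++ [q])).ncard = 4
  · exact hL.exists_good_of_four hR hd hp g1 hp1 hp2 g2 g3 h4 (by omega)
  -- The remaining split is three and four; reversing the direction exchanges the parts.
  have r0 : Rev (p :: l₁ ++ q :: l₂) (p :: l₂.reverse ++ q :: l₁.reverse) := by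
    have := rev_cons p (l₁ ++ q :: l₂)
    simpa using this
  have r1 : Rev (p :: q :: l₂) (p :: l₂.reverse ++ [q]) := by
    have := rev_cons p (q :: l₂)
    simpa using this
  have r2 : Rev (p :: l₁ ++ [q]) (p :: q :: l₁.reverse) := by
    have := rev_cons p (l₁ ++ [q])
    simpa using this
  obtain ⟨t, h1, h2⟩ := (r0.oriented hL).exists_good_of_four hR (r0.idiag hd)
    (by rwa [r0.corner]) (by rwa [r0.corner]) (by rwa [r1.corner]) (by rwa [r2.corner])
    (by rwa [r1.corner]) (by rwa [r2.corner]) (by rw [r1.corner]; omega) (by rw [r2.corner]; omega)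
  refine ⟨t, r0.symm.idiag h1, ?_⟩
  have := r0.symm.good h2
  rwa [neg_neg] at this

/-- Goodness makes the end `t` contribute exactly one new corner, so the corners of the parts number
four plus the number of parts with `p` as a corner. Since each part has at least three, equality
holds throughout. -/
theorem Oriented.cut_good (hR : GP R) {p t : ι} {l₁ l₂ : List ι} {σ : ℝ}
    (hL : Oriented R (p :: l₁ ++ t :: l₂) σ) (hd : IDiag R (p :: l₁ ++ t :: l₂) p t)
    (h3 : (Corner R σ (p :: l₁ ++ t :: l₂)).ncard = 3) (hp : p ∉ Corner R σ (p :: l₁ ++ t :: l₂))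
    (hg : Good R σ (p :: l₁ ++ t :: l₂) p t) :
    (Corner R σ (p :: l₁ ++ [t])).ncard = 3 ∧ (Corner R σ (p :: t :: l₂)).ncard = 3 ∧
      p ∈ Corner R σ (p :: l₁ ++ [t]) ∧ p ∈ Corner R σ (p :: t :: l₂) := by
  classical
  rw [hL.good_iff hR hd] at hg
  obtain ⟨⟨o1, o2⟩, -⟩ := hL.cut hR hd
  have hcount := corner_count (R := R) hL.simple.nodup σ
  have hc := hL.cut_corner' hR hd
  have t1 := o1.three_le_corner hR
  have t2 := o2.three_le_corner hR
  rw [h3, if_neg hp] at hcount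
  generalize (Corner R σ (p :: l₁ ++ [t])).ncard = k₁ at hcount t1 ⊢
  generalize (Corner R σ (p :: t :: l₂)).ncard = k₂ at hcount t2 ⊢
  by_cases c0 : t ∈ Corner R σ (p :: l₁ ++ t :: l₂) <;>
  by_cases c1 : t ∈ Corner R σ (p :: l₁ ++ [t]) <;>
  by_cases c2 : t ∈ Corner R σ (p :: t :: l₂) <;>
  by_cases c3 : p ∈ Corner R σ (p :: l₁ ++ [t]) <;>
  by_cases c4 : p ∈ Corner R σ (p :: t :: l₂) <;>
  simp only [c0, c1, c2, c3, c4, if_true, if_false] at hcount hc hg ⊢ <;>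
  simp at hg hc ⊢ <;> omega

end PlanarCycle

namespace PlanarCycle

variable {ι : Type*} {R : ι → ℂ}

/-! ### Subdivisions of a polygon into pseudo-triangles -/

variable (R) in
/-- The straight-line drawing of a graph. -/
def draw (G : SimpleGraph ι) : Set ℂ := {z | ∃ i j, G.Adj i j ∧ z ∈ segment ℝ (R i) (R j)}

variable (R) in
/-- All edges at `v` lie in an open half plane. -/
def Pointed (G : SimpleGraph ι) (v : ι) : Prop := ∃ e : ℂ, ∀ j, G.Adj v j → 0 < cr e (R j - R v)

variable (R) in
/-- `L` bounds a pseudo-triangular face of the drawing of `G`. -/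
structure Face (G : SimpleGraph ι) (L : List ι) : Prop where
  adj : ∀ a b, (a, b) ∈ cyc L → G.Adj a b
  pseudo : ∃ σ, Oriented R L σ ∧ (Corner R σ L).ncard = 3
  empty : Disjoint (inside R L) (draw R G)

variable (R) in
/-- `G` subdivides the polygon `B` into pseudo-triangles. -/
structure Subdivision (B : List ι) (G : SimpleGraph ι) : Prop where
  boundary : ∀ a b, (a, b) ∈ cyc B → G.Adj a b
  nonCrossing : ∀ i j k l, G.Adj i j → G.Adj k l → i ≠ k → i ≠ l → j ≠ k → j ≠ l →
    Disjoint (segment ℝ (R i) (R j)) (segment ℝ (R k) (R l))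
  diagonal : ∀ i j, G.Adj i j → (i, j) ∈ cyc B ∨ (j, i) ∈ cyc B ∨
    openSegment ℝ (R i) (R j) ⊆ inside R B
  faces : ∀ z ∈ inside R B, z ∉ draw R G → ∃ L, Face R G L ∧ z ∈ inside R L

theorem bd_subset_draw {G : SimpleGraph ι} {L : List ι} (h : ∀ a b, (a, b) ∈ cyc L → G.Adj a b) :
    bd R L ⊆ draw R G := by
  rintro z ⟨⟨a, b⟩, he, hz⟩
  exact ⟨a, b, h a b he, hz⟩

theorem Pointed.anti {G H : SimpleGraph ι} (h : G ≤ H) {v : ι} (hv : Pointed R H v) :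
    Pointed R G v := by
  obtain ⟨e, he⟩ := hv
  exact ⟨e, fun j hj => he j (h hj)⟩

theorem offRay_of_separated {e v d : ℂ} (h1 : 0 < cr e v) (h2 : cr e d < 0) : OffRay v d := by
  by_cases h : cr v d = 0
  swap
  · exact offRay_of_cr_ne_zero h
  have hv : v ≠ 0 := by rintro rfl; simp [cr] at h1
  have hr : d / v = (((d / v).re : ℝ) : ℂ) := by
    apply Complex.ext
    · simp
    · rw [ratio_im, h]; simp
  have hd : d = ((d / v).re : ℝ) * v := by rw [← hr, div_mul_cancel₀ _ hv]
  rw [hd, cr_smul_right] at h2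
  rw [OffRay, Complex.mem_slitPlane_iff]
  left
  rw [Complex.neg_re]
  by_contra! hcon
  have := mul_nonneg (neg_nonpos.1 hcon) h1.le
  linarith

theorem eventually_notMem_draw [Finite ι] (hR : GP R) {G : SimpleGraph ι} {p : ι} {d : ℂ}
    (hd : ∀ j, G.Adj p j → OffRay (R j - R p) d) :
    ∀ᶠ ε : ℝ in 𝓝[>] 0, R p + ε * d ∉ draw R G := by
  have hpos : ∀ᶠ ε : ℝ in 𝓝[>] (0:ℝ), 0 < ε := self_mem_nhdsWithin
  have hfar : ∀ i j, ∀ᶠ ε : ℝ in 𝓝[>] (0:ℝ), i ≠ p → j ≠ p →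
      R p + ε * d ∉ segment ℝ (R i) (R j) := by
    intro i j
    by_cases hi : i = p
    · exact Eventually.of_forall fun _ h => absurd hi h
    by_cases hj : j = p
    · exact Eventually.of_forall fun _ _ h => absurd hj h
    have := (tendsto_line (R p) d).eventually
      ((isClosed_segment (R i) (R j)).isOpen_compl.mem_nhds
        (hR.notMem_segment (Ne.symm hi) (Ne.symm hj)))
    exact this.mono fun ε h _ _ => h
  filter_upwards [hpos, eventually_all.2 fun i => eventually_all.2 fun j => hfar i j] with ε h0 hf
  have key : ∀ j, G.Adj p j → R p + ε * d ∉ segment ℝ (R p) (R j) := by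
    intro j hj h
    obtain ⟨s, hs, -, h⟩ := mem_segment_param h
    exact (hd j hj).smul_ne hs h0 (add_left_cancel h)
  rintro ⟨i, j, hij, hz⟩
  by_cases hi : i = p
  · subst hi; exact key j hij hz
  by_cases hj : j = p
  · subst hj; rw [segment_symm] at hz; exact key i hij.symm hz
  exact hf i j hi hj hz

theorem vertex_mem_draw {G : SimpleGraph ι} {i j : ι} (h : G.Adj i j) : R i ∈ draw R G :=
  ⟨i, j, h, left_mem_segment ℝ _ _⟩

theorem vertex_mem_of_mem_bd (hR : GP R) {L : List ι} {p : ι} (h : R p ∈ bd R L) : p ∈ L := by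
  obtain ⟨⟨a, b⟩, he, hz⟩ := h
  by_contra hp
  obtain ⟨h1, h2⟩ := mem_of_mem_cyc he
  exact hR.notMem_segment (x := p) (y := a) (w := b) (by rintro rfl; exact hp h1)
    (by rintro rfl; exact hp h2) hz

/-- A preconnected set off the boundary that meets the interior lies in the interior. -/
theorem subset_inside_of_isPreconnected {L : List ι} {S : Set ℂ} (hS : IsPreconnected S)
    (hd : Disjoint S (bd R L)) {z : ℂ} (hz : z ∈ S) (hz' : z ∈ inside R L) : S ⊆ inside R L :=
  fun y hy => ⟨Set.disjoint_left.1 hd hy, by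
    rw [wind_eq_of_isPreconnected hS hd hy hz]; exact hz'.2⟩

/-- At a pointed reflex vertex of the boundary there is a face for which it is reflex. -/
theorem Subdivision.exists_face [Finite ι] (hR : GP R) {B : List ι} {σ : ℝ} (hB : Oriented R B σ)
    {G : SimpleGraph ι} (hG : Subdivision R B G) {p : ι} (hpB : p ∈ B) (hp : p ∉ Corner R σ B)
    (hpt : Pointed R G p) :
    ∃ L τ, Face R G L ∧ Oriented R L τ ∧ (Corner R τ L).ncard = 3 ∧ p ∈ L ∧ p ∉ Corner R τ L ∧
      inside R L ⊆ inside R B := by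
  obtain ⟨e, he⟩ := hpt
  obtain ⟨x, hx⟩ := exists_prev hpB
  obtain ⟨n, hn⟩ := exists_next hpB
  have hGn := hG.boundary _ _ hn
  have hGx := (hG.boundary _ _ hx).symm
  -- The backward prolongation of a boundary edge points out of the half plane that contains all
  -- edges at `p`, and into the interior of `B` because `p` is reflex.
  set d : ℂ := -(R n - R p) with hd
  have hed : cr e d < 0 := by rw [hd, cr_neg_right]; have := he n hGn; linarith
  have hoff : ∀ j, G.Adj p j → OffRay (R j - R p) d := fun j hj => offRay_of_separated (he j hj) hed
  have hk : σ * cr (R n - R p) (R x - R p) < 0 := by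
    rw [hB.simple.mem_corner hx hn] at hp
    have := hB.ori_ne hR hx hn
    rw [ori_eq] at hp this
    exact lt_of_le_of_ne (not_lt.1 hp) this
  have hin := hB.sector_mem hR hx hn (hoff n hGn) (hoff x hGx)
    (Or.inr ⟨hk, Or.inr (by rw [hd, cr_neg_left]; linarith)⟩)
  have hpos : ∀ᶠ ε : ℝ in 𝓝[>] (0:ℝ), 0 < ε := self_mem_nhdsWithin
  have hev := hin.and (eventually_notMem_draw hR hoff)
  obtain ⟨δ, hδ, hδ'⟩ := mem_nhdsGT_iff_exists_Ioo_subset.1 hev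
  rw [Set.mem_Ioi] at hδ
  have hδ2 : δ / 2 ∈ Set.Ioo 0 δ := ⟨by linarith, by linarith⟩
  obtain ⟨L, hL, hzL⟩ := hG.faces _ (hδ' hδ2).1 (hδ' hδ2).2
  obtain ⟨τ, oL, hL3⟩ := hL.pseudo
  set S : Set ℂ := (fun ε : ℝ => R p + ε * d) '' Set.Ioo 0 δ with hS
  have hSc : IsPreconnected S := isPreconnected_Ioo.image _ (by fun_prop)
  have hSd : Disjoint S (draw R G) := by
    rw [Set.disjoint_left]
    rintro _ ⟨ε, hε, rfl⟩
    exact (hδ' hε).2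
  have hbd := bd_subset_draw (R := R) hL.adj
  have hSL : S ⊆ inside R L := subset_inside_of_isPreconnected hSc (hSd.mono_right hbd)
    ⟨δ / 2, hδ2, rfl⟩ hzL
  have hevL : ∀ᶠ ε : ℝ in 𝓝[>] (0:ℝ), R p + ε * d ∈ inside R L := by
    refine mem_nhdsGT_iff_exists_Ioo_subset.2 ⟨δ, hδ, fun ε hε => hSL ⟨ε, hε, rfl⟩⟩
  -- Interior points of `L` accumulate at `p`. If `p` were off the boundary of `L`, it would be an
  -- interior point of the face, although it belongs to the drawing.
  have hpL : p ∈ L := by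
    refine vertex_mem_of_mem_bd hR ?_
    by_contra hpb
    have h1 := (tendsto_line (R p) d).eventually (wind_eventually hpb)
    obtain ⟨ε, h2, h3⟩ := (hevL.and h1).exists
    exact Set.disjoint_left.1 hL.empty ⟨hpb, by rw [← h3.2]; exact h2.2⟩ (vertex_mem_draw hGn)
  -- At a corner of `L`, the direction `d` would be a positive combination of the two edge
  -- directions and would lie in their half plane.
  refine ⟨L, τ, hL, oL, hL3, hpL, fun hc => ?_, ?_⟩
  · obtain ⟨P, hP⟩ := exists_prev hpL
    obtain ⟨N, hN⟩ := exists_next hpL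
    have hGN := hL.adj _ _ hN
    have hGP := (hL.adj _ _ hP).symm
    rw [oL.simple.mem_corner hP hN, ori_eq] at hc
    rcases oL.insec_of_frequently hR hP hN (hoff N hGN) (hoff P hGP) hevL.frequently with
      ⟨-, h1, h2⟩ | ⟨h, -⟩
    · have key := cr_expand e (R P - R p) (R N - R p) d
      have e1 := mul_pos h2 (he N hGN)
      have e2 := mul_pos h1 (he P hGP)
      have e3 := mul_pos hc (neg_pos.2 hed)
      have : (τ * cr (R N - R p) (R P - R p)) * -cr e d =
        -((τ * cr d (R P - R p)) * cr e (R N - R p) +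
          (τ * cr (R N - R p) d) * cr e (R P - R p)) := by linear_combination -τ * key
      linarith
    · exact h.not_gt hc
  · exact subset_inside_of_isPreconnected (oL.isPreconnected_inside hR)
      (hL.empty.mono_right (bd_subset_draw hG.boundary)) hzL (hδ' hδ2).1

/-- Adjacency in the graph `G` together with the edge `pt`. -/
theorem adj_sup_edge {G : SimpleGraph ι} {p t : ι} (hpt : p ≠ t) {i j : ι} :
    (G ⊔ SimpleGraph.edge p t).Adj i j ↔
      G.Adj i j ∨ ((i = p ∧ j = t) ∨ (i = t ∧ j = p)) := by
  rw [SimpleGraph.sup_adj, SimpleGraph.edge_adj]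
  constructor
  · rintro (h | ⟨h, -⟩)
    · exact Or.inl h
    · exact Or.inr h
  · rintro (h | h)
    · exact Or.inl h
    · refine Or.inr ⟨h, ?_⟩
      rcases h with ⟨rfl, rfl⟩ | ⟨rfl, rfl⟩
      · exact hpt
      · exact hpt.symm

theorem draw_sup_edge {G : SimpleGraph ι} {p t : ι} (hpt : p ≠ t) :
    draw R (G ⊔ SimpleGraph.edge p t) = draw R G ∪ segment ℝ (R p) (R t) := by
  ext z
  constructor
  · rintro ⟨i, j, h, hz⟩
    rcases (adj_sup_edge hpt).1 h with h | ⟨rfl, rfl⟩ | ⟨rfl, rfl⟩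
    · exact Or.inl ⟨i, j, h, hz⟩
    · exact Or.inr hz
    · rw [segment_symm] at hz; exact Or.inr hz
  · rintro (⟨i, j, h, hz⟩ | h)
    · exact ⟨i, j, (adj_sup_edge hpt).2 (Or.inl h), hz⟩
    · exact ⟨p, t, (adj_sup_edge hpt).2 (Or.inr (Or.inl ⟨rfl, rfl⟩)), h⟩

theorem Face.not_adj {G : SimpleGraph ι} {L : List ι} (hL : Face R G L) {p t : ι}
    (hd : IDiag R L p t) : ¬G.Adj p t := by
  intro h
  obtain ⟨z, hz⟩ := openSegment_nonempty (R p) (R t)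
  exact Set.disjoint_left.1 hL.empty (hd.sub hz) ⟨p, t, h, openSegment_subset_segment _ _ _ hz⟩

/-- Adding a diagonal that cuts a face into two pseudo-triangles. -/
theorem Subdivision.sup_edge (hR : GP R) {B : List ι} {G : SimpleGraph ι} (hG : Subdivision R B G)
    {L : List ι} {τ : ℝ} (hL : Face R G L) (oL : Oriented R L τ) (hL3 : (Corner R τ L).ncard = 3)
    {p t : ι} (hp : p ∉ Corner R τ L) (hd : IDiag R L p t) (hg : Good R τ L p t)
    (hLB : inside R L ⊆ inside R B) : Subdivision R B (G ⊔ SimpleGraph.edge p t) where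
  boundary a b h := (adj_sup_edge hd.ne).2 (Or.inl (hG.boundary a b h))
  nonCrossing := by
    have key : ∀ i j, G.Adj i j → i ≠ p → i ≠ t → j ≠ p → j ≠ t →
        Disjoint (segment ℝ (R i) (R j)) (segment ℝ (R p) (R t)) := by
      intro i j hij h1 h2 h3 h4
      rw [Set.disjoint_left]
      intro z hz hz'
      rw [← insert_endpoints_openSegment] at hz'
      rcases hz' with rfl | rfl | hz'
      · exact hR.notMem_segment h1.symm h3.symm hz
      · exact hR.notMem_segment h2.symm h4.symm hz
      · exact Set.disjoint_left.1 hL.empty (hd.sub hz') ⟨i, j, hij, hz⟩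
    intro i j k l hij hkl h1 h2 h3 h4
    rcases (adj_sup_edge hd.ne).1 hij with hij' | ⟨rfl, rfl⟩ | ⟨rfl, rfl⟩ <;>
    rcases (adj_sup_edge hd.ne).1 hkl with hkl' | ⟨rfl, rfl⟩ | ⟨rfl, rfl⟩
    · exact hG.nonCrossing i j k l hij' hkl' h1 h2 h3 h4
    · exact key i j hij' h1 h2 h3 h4
    · rw [segment_symm ℝ (R k)]; exact key i j hij' h2 h1 h4 h3
    · exact (key k l hkl' h1.symm h3.symm h2.symm h4.symm).symm
    · exact absurd rfl h1
    · exact absurd rfl h2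
    · rw [segment_symm ℝ (R i)]; exact (key k l hkl' h3.symm h1.symm h4.symm h2.symm).symm
    · exact absurd rfl h2
    · exact absurd rfl h1
  diagonal i j hij := by
    rcases (adj_sup_edge hd.ne).1 hij with hij | ⟨rfl, rfl⟩ | ⟨rfl, rfl⟩
    · exact hG.diagonal i j hij
    · exact Or.inr (Or.inr (hd.sub.trans hLB))
    · exact Or.inr (Or.inr (hd.symm.sub.trans hLB))
  faces z hz hzd := by
    rw [draw_sup_edge hd.ne] at hzd
    obtain ⟨M, hM, hzM⟩ := hG.faces z hz fun h => hzd (Or.inl h)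
    -- An old face that misses the new diagonal stays a face. One that meets it is connected and
    -- free of boundary points of `L`, so it lies inside `L`, and one of the two parts of `L` takes
    -- its place.
    by_cases hdis : Disjoint (inside R M) (segment ℝ (R p) (R t))
    · refine ⟨M, ⟨fun a b h => (adj_sup_edge hd.ne).2 (Or.inl (hM.adj a b h)), hM.pseudo, ?_⟩, hzM⟩
      rw [draw_sup_edge hd.ne]
      exact Set.disjoint_union_right.2 ⟨hM.empty, hdis⟩
    obtain ⟨y, hyM, hy⟩ := Set.not_disjoint_iff.1 hdis
    obtain ⟨x, hx⟩ := exists_next hd.left_mem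
    obtain ⟨x', hx'⟩ := exists_next hd.right_mem
    have hyL : y ∈ inside R L := by
      rw [← insert_endpoints_openSegment] at hy
      rcases hy with rfl | rfl | hy
      · exact absurd (vertex_mem_draw (hL.adj _ _ hx)) (Set.disjoint_left.1 hM.empty hyM)
      · exact absurd (vertex_mem_draw (hL.adj _ _ hx')) (Set.disjoint_left.1 hM.empty hyM)
      · exact hd.sub hy
    obtain ⟨μ, oM, -⟩ := hM.pseudo
    have hzL : z ∈ inside R L := subset_inside_of_isPreconnected (oM.isPreconnected_inside hR)
      (hM.empty.mono_right (bd_subset_draw hL.adj)) hyM hyL hzM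
    obtain ⟨l₁, l₂, hr⟩ := exists_rot_two hd.left_mem hd.right_mem hd.ne
    have hd' := hr.idiag hd
    have oL' := hr.oriented oL
    rw [hr.corner] at hL3 hp
    obtain ⟨c1, c2, -, -⟩ := oL'.cut_good hR hd' hL3 hp (hr.good hg)
    obtain ⟨⟨o1, o2⟩, ⟨i1, i2⟩, -, hcov⟩ := oL'.cut hR hd'
    rw [← hr.inside] at i1 i2 hcov
    have f1 : Face R (G ⊔ SimpleGraph.edge p t) (p :: l₁ ++ [t]) := by
      refine ⟨fun a b h => (adj_sup_edge hd.ne).2 ?_, ⟨τ, o1, c1⟩, ?_⟩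
      · rcases mem_cyc_left l₂ h with h | h
        · exact Or.inl (hL.adj _ _ (hr.mem_cyc.2 h))
        · cases h; exact Or.inr (Or.inr ⟨rfl, rfl⟩)
      · rw [draw_sup_edge hd.ne]
        refine Set.disjoint_union_right.2 ⟨hL.empty.mono_left i1, ?_⟩
        rw [Set.disjoint_left]
        intro w hw hw'
        exact hw.1 (by rw [bd_left]; exact Or.inr hw')
    have f2 : Face R (G ⊔ SimpleGraph.edge p t) (p :: t :: l₂) := by
      refine ⟨fun a b h => (adj_sup_edge hd.ne).2 ?_, ⟨τ, o2, c2⟩, ?_⟩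
      · rcases mem_cyc_right l₁ h with h | h
        · exact Or.inl (hL.adj _ _ (hr.mem_cyc.2 h))
        · cases h; exact Or.inr (Or.inl ⟨rfl, rfl⟩)
      · rw [draw_sup_edge hd.ne]
        refine Set.disjoint_union_right.2 ⟨hL.empty.mono_left i2, ?_⟩
        rw [Set.disjoint_left]
        intro w hw hw'
        exact hw.1 (by rw [bd_right]; exact Or.inr hw')
    rcases hcov z hzL fun h => hzd (Or.inr (openSegment_subset_segment _ _ _ h)) with h | h
    · exact ⟨_, f1, h⟩
    · exact ⟨_, f2, h⟩

/-- `p` is reflex in `L` but a corner of both parts, so the directions of its two boundary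
neighbours in `L` and of `t` leave no angle above `π`: `t` lies opposite to the cone spanned by the
other two. -/
theorem not_pointed_sup_edge (hR : GP R) {G : SimpleGraph ι} {L : List ι} {τ : ℝ}
    (hL : Face R G L) (oL : Oriented R L τ) (hL3 : (Corner R τ L).ncard = 3)
    {p t : ι} (hp : p ∉ Corner R τ L) (hd : IDiag R L p t) (hg : Good R τ L p t) :
    ¬Pointed R (G ⊔ SimpleGraph.edge p t) p := by
  rintro ⟨e, he⟩
  obtain ⟨l₁, l₂, hr⟩ := exists_rot_two hd.left_mem hd.right_mem hd.ne
  have hd' := hr.idiag hd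
  have oL' := hr.oriented oL
  obtain ⟨P, hP⟩ := exists_prev hd'.left_mem
  obtain ⟨N, hN⟩ := exists_next hd'.left_mem
  rw [hr.corner] at hL3 hp
  obtain ⟨-, -, c1, c2⟩ := oL'.cut_good hR hd' hL3 hp (hr.good hg)
  obtain ⟨⟨o1, o2⟩, -⟩ := oL'.cut hR hd'
  obtain ⟨a1, a2, a3, a4⟩ := cut_edges oL'.simple.nodup hP hN
  rw [o1.simple.mem_corner a2 a1, ori_eq] at c1
  rw [o2.simple.mem_corner a3 a4, ori_eq] at c2
  rw [oL'.simple.mem_corner hP hN, ori_eq, not_lt] at hp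
  have hGN := he N ((adj_sup_edge hd.ne).2 (Or.inl (hL.adj _ _ (hr.mem_cyc.2 hN))))
  have hGP := he P ((adj_sup_edge hd.ne).2 (Or.inl (hL.adj _ _ (hr.mem_cyc.2 hP)).symm))
  have hGt := he t ((adj_sup_edge hd.ne).2 (Or.inr (Or.inl ⟨rfl, rfl⟩)))
  have key := cr_expand e (R P - R p) (R N - R p) (R t - R p)
  have e1 := mul_pos c2 hGN
  have e2 := mul_pos c1 hGP
  have e3 := mul_nonneg (neg_nonneg.2 hp) hGt.le
  have : -(τ * cr (R N - R p) (R P - R p)) * cr e (R t - R p) =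
    -((τ * cr (R t - R p) (R P - R p)) * cr e (R N - R p) +
      (τ * cr (R N - R p) (R t - R p)) * cr e (R P - R p)) := by linear_combination -τ * key
  linarith

theorem exists_pos_combination {A B : ℝ} (hA : 0 < A) : ∃ δ : ℝ, 0 < δ ∧ 0 < A + δ * B := by
  refine ⟨A / (2 * (|B| + 1)), by positivity, ?_⟩
  have h1 : 0 < |B| + 1 := by positivity
  have h2 : A / (2 * (|B| + 1)) * |B| < A := by
    rw [div_mul_eq_mul_div, div_lt_iff₀ (by positivity)]
    nlinarith [abs_nonneg B]
  have h3 := neg_abs_le B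
  have h4 : A / (2 * (|B| + 1)) * -|B| ≤ A / (2 * (|B| + 1)) * B :=
    mul_le_mul_of_nonneg_left h3 (by positivity)
  linarith

/-- If `t` is a corner of the face, the new edge lies in the cone of two old ones and the old half
plane still works. If `t` is reflex, the angle above `π` at `t` is the one inside the face, and
goodness says that one of its two pieces remains above `π`. -/
theorem Pointed.sup_edge [Finite ι] (hR : GP R) {G : SimpleGraph ι} {L : List ι} {τ : ℝ}
    (hL : Face R G L) (oL : Oriented R L τ) {p t : ι} (hd : IDiag R L p t) (hg : Good R τ L p t)
    (ht : Pointed R G t) : Pointed R (G ⊔ SimpleGraph.edge p t) t := by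
  obtain ⟨e, he⟩ := ht
  obtain ⟨x, y, hx, hy, hg⟩ := hg
  have hGx := (hL.adj _ _ hx).symm
  have hGy := hL.adj _ _ hy
  have hs := hd.symm.insec hR oL hx hy
  have suff : ∀ e' : ℂ, (∀ j, G.Adj t j → 0 < cr e' (R j - R t)) → 0 < cr e' (R p - R t) →
      Pointed R (G ⊔ SimpleGraph.edge p t) t := by
    intro e' h1 h2
    refine ⟨e', fun j hj => ?_⟩
    rcases (adj_sup_edge hd.ne).1 hj with h | ⟨h, -⟩ | ⟨-, rfl⟩
    · exact h1 j h
    · exact absurd h.symm hd.ne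
    · exact h2
  rcases hs with ⟨h0, h1, h2⟩ | ⟨h0, h⟩
  · refine suff e he ?_
    have key := cr_expand e (R x - R t) (R y - R t) (R p - R t)
    have e1 := mul_pos h2 (he y hGy)
    have e2 := mul_pos h1 (he x hGx)
    have : (τ * cr (R y - R t) (R x - R t)) * cr e (R p - R t) =
      (τ * cr (R p - R t) (R x - R t)) * cr e (R y - R t) +
        (τ * cr (R y - R t) (R p - R t)) * cr e (R x - R t) := by linear_combination τ * key
    exact pos_of_mul_pos_right (by rw [this]; exact add_pos e1 e2) h0.le
  · have hxy := oL.simple.prev_ne_next hx hy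
    -- The face is empty, so every other edge at `t` lies in the complementary sector, of angle
    -- below `π`, between `y` and `x`.
    have hnb : ∀ j, G.Adj t j → (j ≠ y → τ * cr (R y - R t) (R j - R t) < 0) ∧
        (j ≠ x → τ * cr (R j - R t) (R x - R t) < 0) := by
      have main : ∀ j, G.Adj t j → j ≠ y → j ≠ x → τ * cr (R y - R t) (R j - R t) < 0 ∧
          τ * cr (R j - R t) (R x - R t) < 0 := by
        intro j hj hjy hjx
        have n1 : cr (R y - R t) (R j - R t) ≠ 0 := hR.noncol t y j hGy.ne hj.ne hjy.symm
        have n2 : cr (R x - R t) (R j - R t) ≠ 0 := hR.noncol t x j hGx.ne hj.ne hjx.symm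
        have hsec := oL.sector hR hx hy (offRay_of_cr_ne_zero n1) (offRay_of_cr_ne_zero n2)
        have hlt : ∀ᶠ ε : ℝ in 𝓝[>] (0:ℝ), ε < 1 := nhdsWithin_le_nhds (Iio_mem_nhds one_pos)
        have hpos : ∀ᶠ ε : ℝ in 𝓝[>] (0:ℝ), 0 < ε := self_mem_nhdsWithin
        obtain ⟨ε, hε, hε0, hε1⟩ := (hsec.and (hpos.and hlt)).exists
        have hnot : ¬InSec τ (R y - R t) (R x - R t) (R j - R t) := fun hin =>
          Set.disjoint_left.1 hL.empty (hε.2.2 hin) ⟨t, j, hj, param_mem_segment hε0.le hε1.le⟩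
        have hτ := oL.sign_ne
        have m1 := mul_ne_zero hτ n1
        have m2 : τ * cr (R j - R t) (R x - R t) ≠ 0 := by
          rw [cr_swap]; exact mul_ne_zero hτ (neg_ne_zero.2 n2)
        rw [InSec] at hnot
        push Not at hnot
        have := hnot.2 h0
        exact ⟨lt_of_le_of_ne this.1 m1, lt_of_le_of_ne this.2 m2⟩
      intro j hj
      constructor
      · intro hjy
        by_cases hjx : j = x
        · subst hjx; exact h0
        · exact (main j hj hjy hjx).1
      · intro hjx
        by_cases hjy : j = y
        · subst hjy; exact h0
        · exact (main j hj hjy hjx).2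
    -- The functionals of the two bounding edges are positive on all edges of `G` at `t`, except
    -- that each vanishes on its own edge. Any positive combination therefore defines an open half
    -- plane containing all of them.
    have hpos : ∀ j, G.Adj t j → ∀ a b : ℝ, 0 < a → 0 < b →
        0 < a * -(τ * cr (R y - R t) (R j - R t)) + b * -(τ * cr (R j - R t) (R x - R t)) := by
      intro j hj a b ha hb
      obtain ⟨g1, g2⟩ := hnb j hj
      by_cases hjy : j = y
      · have := mul_pos hb (neg_pos.2 (g2 (hjy ▸ hxy.symm)))
        rw [hjy, cr_self, ← hjy]
        rw [mul_zero, neg_zero, mul_zero, zero_add]; exact this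
      · have i1 := mul_pos ha (neg_pos.2 (g1 hjy))
        by_cases hjx : j = x
        · rw [hjx, cr_self, ← hjx]
          rw [mul_zero, neg_zero, mul_zero, add_zero]; exact i1
        · exact add_pos i1 (mul_pos hb (neg_pos.2 (g2 hjx)))
    have hvec : ∀ (a b : ℝ) (v : ℂ),
        cr (((-(a * τ) : ℝ) : ℂ) * (R y - R t) + ((b * τ : ℝ) : ℂ) * (R x - R t)) v =
        a * -(τ * cr (R y - R t) v) + b * -(τ * cr v (R x - R t)) := by
      intro a b v
      simp [cr]; ring
    have hfin : ∀ a b : ℝ, 0 < a → 0 < b →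
        0 < a * -(τ * cr (R y - R t) (R p - R t)) + b * -(τ * cr (R p - R t) (R x - R t)) →
        Pointed R (G ⊔ SimpleGraph.edge p t) t := by
      intro a b ha hb hab
      refine suff (((-(a * τ) : ℝ) : ℂ) * (R y - R t) + ((b * τ : ℝ) : ℂ) * (R x - R t))
        (fun j hj => ?_) ?_
      · rw [hvec]; exact hpos j hj a b ha hb
      · rw [hvec]; exact hab
    have e1 : ori R x t p = cr (R p - R t) (R x - R t) := ori_eq R x t p
    have e2 : ori R p t y = cr (R y - R t) (R p - R t) := ori_eq R p t y
    have e0 : ori R x t y = cr (R y - R t) (R x - R t) := ori_eq R x t y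
    rw [e0, e1, e2] at hg
    have hpx : p ≠ x := by rintro rfl; exact hd.free.notMem_cyc.1 hx
    have hpy : p ≠ y := by rintro rfl; exact hd.free.notMem_cyc.2 hy
    have n1 : τ * cr (R y - R t) (R p - R t) ≠ 0 :=
      mul_ne_zero oL.sign_ne (hR.noncol t y p hGy.ne hd.ne.symm hpy.symm)
    have n2 : τ * cr (R p - R t) (R x - R t) ≠ 0 :=
      mul_ne_zero oL.sign_ne (hR.noncol t p x hd.ne.symm hGx.ne hpx)
    -- Goodness makes one of the two functionals positive on the new edge; the other is added with a
    -- small weight `δ`.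
    rcases hg with hg | hg | hg
    · exact absurd hg h0.not_gt
    · have : 0 < -(τ * cr (R p - R t) (R x - R t)) :=
        neg_pos.2 (lt_of_le_of_ne (not_lt.1 hg) n2)
      obtain ⟨δ, hδ, h⟩ := exists_pos_combination (B := -(τ * cr (R y - R t) (R p - R t))) this
      exact hfin δ 1 hδ one_pos (by linarith)
    · have : 0 < -(τ * cr (R y - R t) (R p - R t)) :=
        neg_pos.2 (lt_of_le_of_ne (not_lt.1 hg) n1)
      obtain ⟨δ, hδ, h⟩ := exists_pos_combination (B := -(τ * cr (R p - R t) (R x - R t))) this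
      exact hfin 1 δ one_pos hδ (by linarith)

theorem pointed_sup_edge_iff {G : SimpleGraph ι} {p t v : ι} (hpt : p ≠ t) (hp : v ≠ p)
    (ht : v ≠ t) : Pointed R (G ⊔ SimpleGraph.edge p t) v ↔ Pointed R G v := by
  refine ⟨fun h => h.anti le_sup_left, fun ⟨e, he⟩ => ⟨e, fun j hj => he j ?_⟩⟩
  rcases (adj_sup_edge hpt).1 hj with h | ⟨h, -⟩ | ⟨h, -⟩
  · exact h
  · exact absurd h hp
  · exact absurd h ht

end PlanarCycle

namespace PlanarCycle

variable {ι : Type*} {R : ι → ℂ}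

/-! ### Counting -/

/-- In the first relation no summand is positive, so `b = c = 0`; the second relation then reads `a
* n₁ = 0`. -/
theorem combination_aux {a b c : ℝ} {m₁ m₂ m₃ n₁ n₂ n₃ : ℝ} (hm : a * m₁ + b * m₂ + c * m₃ = 0)
    (hn : a * n₁ + b * n₂ + c * n₃ = 0) (h1 : m₁ ≤ 0) (h2 : 0 < m₂) (h3 : 0 < m₃) (p1 : 0 < n₁)
    (ha : 0 < a) (hb : b ≤ 0) (hc : c ≤ 0) : False := by
  have e1 := mul_nonneg ha.le (neg_nonneg.2 h1)
  have e2 := mul_nonneg (neg_nonneg.2 hb) h2.le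
  have e3 := mul_nonneg (neg_nonneg.2 hc) h3.le
  have hb0 : b = 0 := by
    by_contra h
    have := mul_pos (neg_pos.2 (lt_of_le_of_ne hb h)) h2
    linarith
  have hc0 : c = 0 := by
    by_contra h
    have := mul_pos (neg_pos.2 (lt_of_le_of_ne hc h)) h3
    linarith
  subst hb0
  subst hc0
  have := mul_pos ha p1
  linarith

/-- Among three vectors that lie with a fourth one in half planes, two at a time, all three lie in
one of these half planes. -/
theorem three_half_planes {e₁ e₂ e₃ n t₁ t₂ t₃ : ℂ} (n1 : 0 < cr e₁ n) (n2 : 0 < cr e₂ n)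
    (n3 : 0 < cr e₃ n) (h11 : cr e₁ t₁ ≤ 0) (h12 : 0 < cr e₁ t₂) (h13 : 0 < cr e₁ t₃)
    (h21 : 0 < cr e₂ t₁) (h22 : cr e₂ t₂ ≤ 0) (h23 : 0 < cr e₂ t₃)
    (h31 : 0 < cr e₃ t₁) (h32 : 0 < cr e₃ t₂) (h33 : cr e₃ t₃ ≤ 0) : False := by
  -- The linear dependence of three vectors in the plane. If its coefficients have one sign,
  -- evaluation at `n` is a contradiction; if one coefficient has a sign opposed to the other two,
  -- evaluation at the corresponding `tᵢ` is.
  have key : ∀ v, cr e₂ e₃ * cr e₁ v + cr e₃ e₁ * cr e₂ v + cr e₁ e₂ * cr e₃ v = 0 := by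
    intro v; simp only [cr]; ring
  -- Excludes the degenerate case of parallel `e₁` and `e₂`, so that the dependence is nontrivial.
  have key' : cr e₁ n * cr e₂ t₂ - cr e₂ n * cr e₁ t₂ = -(cr e₁ e₂ * cr t₂ n) := by
    simp only [cr]; ring
  have kn := key n
  have k1 := key t₁
  have k2 := key t₂
  have k3 := key t₃
  have hc : cr e₁ e₂ ≠ 0 := by
    intro h
    rw [h, zero_mul, neg_zero] at key'
    have := mul_pos n2 h12
    have := mul_nonneg n1.le (neg_nonneg.2 h22)
    linarith
  set a := cr e₂ e₃
  set b := cr e₃ e₁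
  set c := cr e₁ e₂
  have p1 : 0 < a → b ≤ 0 → c ≤ 0 → False := combination_aux k1 kn h11 h21 h31 n1
  have q1 : a < 0 → 0 ≤ b → 0 ≤ c → False := fun x y z =>
    combination_aux (n₂ := cr e₂ n) (n₃ := cr e₃ n) (a := -a) (b := -b) (c := -c)
      (by linarith) (by linarith) h11 h21 h31 n1
      (by linarith) (by linarith) (by linarith)
  have p2 : 0 < b → a ≤ 0 → c ≤ 0 → False := fun x y z =>
    combination_aux (n₂ := cr e₁ n) (n₃ := cr e₃ n) (a := b) (b := a) (c := c)
      (by linarith) (by linarith) h22 h12 h32 n2 x y z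
  have q2 : b < 0 → 0 ≤ a → 0 ≤ c → False := fun x y z =>
    combination_aux (n₂ := cr e₁ n) (n₃ := cr e₃ n) (a := -b) (b := -a) (c := -c)
      (by linarith) (by linarith) h22 h12 h32 n2
      (by linarith) (by linarith) (by linarith)
  have p3 : 0 < c → a ≤ 0 → b ≤ 0 → False := fun x y z =>
    combination_aux (n₂ := cr e₁ n) (n₃ := cr e₂ n) (a := c) (b := a) (c := b)
      (by linarith) (by linarith) h33 h13 h23 n3 x y z
  have q3 : c < 0 → 0 ≤ a → 0 ≤ b → False := fun x y z =>
    combination_aux (n₂ := cr e₁ n) (n₃ := cr e₂ n) (a := -c) (b := -a) (c := -b)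
      (by linarith) (by linarith) h33 h13 h23 n3
      (by linarith) (by linarith) (by linarith)
  have r1 : 0 ≤ a → 0 ≤ b → 0 < c → False := fun x y z => by
    have := mul_nonneg x n1.le
    have := mul_nonneg y n2.le
    have := mul_pos z n3
    linarith
  have r2 : a ≤ 0 → b ≤ 0 → c < 0 → False := fun x y z => by
    have := mul_nonneg (neg_nonneg.2 x) n1.le
    have := mul_nonneg (neg_nonneg.2 y) n2.le
    have := mul_pos (neg_pos.2 z) n3
    linarith
  rcases hc.lt_or_gt with hc | hc <;> rcases lt_trichotomy a 0 with ha | ha | ha <;>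
    rcases lt_trichotomy b 0 with hb | hb | hb
  · exact r2 ha.le hb.le hc
  · exact r2 ha.le hb.le hc
  · exact p2 hb ha.le hc.le
  · exact r2 ha.le hb.le hc
  · exact r2 ha.le hb.le hc
  · exact q3 hc ha.ge hb.le
  · exact p1 ha hb.le hc.le
  · exact q3 hc ha.le hb.ge
  · exact q3 hc ha.le hb.le
  · exact p3 hc ha.le hb.le
  · exact p3 hc ha.le hb.le
  · exact q1 ha hb.le hc.le
  · exact p3 hc ha.le hb.le
  · exact r1 ha.ge hb.ge hc
  · exact r1 ha.ge hb.le hc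
  · exact q2 hb ha.le hc.le
  · exact r1 ha.le hb.ge hc
  · exact r1 ha.le hb.le hc

theorem eq_of_sup_edge_eq {G H : SimpleGraph ι} {p t : ι} (hpt : p ≠ t) (hG : ¬G.Adj p t)
    (hH : ¬H.Adj p t) (h : G ⊔ SimpleGraph.edge p t = H ⊔ SimpleGraph.edge p t) : G = H := by
  ext i j
  have h' : (G ⊔ SimpleGraph.edge p t).Adj i j ↔ (H ⊔ SimpleGraph.edge p t).Adj i j := by rw [h]
  rw [adj_sup_edge hpt, adj_sup_edge hpt] at h'
  by_cases he : (i = p ∧ j = t) ∨ (i = t ∧ j = p)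
  · rcases he with ⟨rfl, rfl⟩ | ⟨rfl, rfl⟩
    · exact iff_of_false hG hH
    · exact iff_of_false (fun h => hG h.symm) fun h => hH h.symm
  · simpa [he] using h'

variable (R) in
/-- The subdivisions of `B` into pseudo-triangles with prescribed set of pointed reflex vertices. -/
def subdivisions (σ : ℝ) (B : List ι) (V : Set ι) : Set (SimpleGraph ι) :=
  {G | Subdivision R B G ∧ ∀ i ∈ B, i ∉ Corner R σ B → (Pointed R G i ↔ i ∈ V)}

/-- The map behind the inequality: a good diagonal of the face that is reflex at `p` removes `p`
from the pointed vertices and no other. -/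
theorem exists_sup_edge [Finite ι] (hR : GP R) {B : List ι} {σ : ℝ} (hB : Oriented R B σ)
    {V : Set ι} {p : ι} (hpB : p ∈ B) (hp : p ∉ Corner R σ B) (hpV : p ∈ V) {G : SimpleGraph ι}
    (hG : G ∈ subdivisions R σ B V) :
    ∃ t, p ≠ t ∧ ¬G.Adj p t ∧ ¬Pointed R (G ⊔ SimpleGraph.edge p t) p ∧
      G ⊔ SimpleGraph.edge p t ∈ subdivisions R σ B (V \ {p}) := by
  obtain ⟨hS, hpt⟩ := hG
  obtain ⟨L, τ, hL, oL, hL3, hpL, hpC, hLB⟩ :=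
    hS.exists_face hR hB hpB hp ((hpt p hpB hp).2 hpV)
  obtain ⟨t, hd, hg⟩ := oL.exists_good hR hL3 hpL hpC
  have hnp := not_pointed_sup_edge hR hL oL hL3 hpC hd hg
  refine ⟨t, hd.ne, hL.not_adj hd, hnp, hS.sup_edge hR hL oL hL3 hpC hd hg hLB, ?_⟩
  intro i hi hiC
  by_cases hip : i = p
  · subst hip
    simp [hnp]
  have h1 : Pointed R (G ⊔ SimpleGraph.edge p t) i ↔ Pointed R G i := by
    by_cases hit : i = t
    · subst hit
      exact ⟨fun h => h.anti le_sup_left, fun h => h.sup_edge hR hL oL hd hg⟩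
    · exact pointed_sup_edge_iff hd.ne hip hit
  rw [h1, hpt i hi hiC]
  simp [hip]

/-- It suffices that fibres have at most two elements. Members of one fibre are recovered from the
image by deleting different edges at `p`; each deletion makes `p` pointed, while the image is not
pointed there. Three of them contradict `three_half_planes`. -/
theorem ncard_subdivisions_le [Finite ι] (hR : GP R) {B : List ι} {σ : ℝ} (hB : Oriented R B σ)
    {V : Set ι} {p : ι} (hpB : p ∈ B) (hp : p ∉ Corner R σ B) (hpV : p ∈ V) :
    (subdivisions R σ B V).ncard ≤ 2 * (subdivisions R σ B (V \ {p})).ncard := by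
  classical
  have := Fintype.ofFinite (SimpleGraph ι)
  have : Nonempty ι := ⟨p⟩
  choose! t h1 h2 h3 h4 using fun G (hG : G ∈ subdivisions R σ B V) =>
    exists_sup_edge hR hB hpB hp hpV hG
  rw [Set.ncard_eq_toFinset_card', Set.ncard_eq_toFinset_card']
  refine Finset.card_le_mul_card_image_of_maps_to (f := fun G => G ⊔ SimpleGraph.edge p (t G))
    (fun G hG => ?_) 2 fun H _ => ?_
  · rw [Set.mem_toFinset] at hG ⊢
    exact h4 G hG
  by_contra! hcard
  obtain ⟨G₁, m1, G₂, m2, G₃, m3, d12, d13, d23⟩ := Finset.two_lt_card.1 hcard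
  simp only [Finset.mem_filter, Set.mem_toFinset] at m1 m2 m3
  have hne : ∀ G G', G ∈ subdivisions R σ B V ∧ G ⊔ SimpleGraph.edge p (t G) = H →
      G' ∈ subdivisions R σ B V ∧ G' ⊔ SimpleGraph.edge p (t G') = H → G ≠ G' → t G ≠ t G' := by
    intro G G' m m' hd ht
    refine hd (eq_of_sup_edge_eq (h1 G m.1) (h2 G m.1) (ht ▸ h2 G' m'.1) ?_)
    rw [m.2, ht, m'.2]
  -- A boundary edge at `p` belongs to all graphs of the fibre. This fourth direction is
  -- indispensable: three directions at mutual angles `2π/3` satisfy all the other conditions.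
  obtain ⟨n, hn⟩ := exists_next hpB
  have key : ∀ G, G ∈ subdivisions R σ B V ∧ G ⊔ SimpleGraph.edge p (t G) = H →
      ∃ e : ℂ, 0 < cr e (R n - R p) ∧ cr e (R (t G) - R p) ≤ 0 ∧
      ∀ G', G' ∈ subdivisions R σ B V ∧ G' ⊔ SimpleGraph.edge p (t G') = H → G ≠ G' →
        0 < cr e (R (t G') - R p) := by
    intro G m
    obtain ⟨e, he⟩ := (m.1.2 p hpB hp).2 hpV
    refine ⟨e, he n (m.1.1.boundary _ _ hn), ?_, fun G' m' hd => he _ ?_⟩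
    · by_contra! hcon
      refine h3 G m.1 ⟨e, fun j hj => ?_⟩
      rcases (adj_sup_edge (h1 G m.1)).1 hj with h | ⟨-, rfl⟩ | ⟨h, -⟩
      · exact he j h
      · exact hcon
      · exact absurd h (h1 G m.1)
    · have hH : H.Adj p (t G') := by
        rw [← m'.2]
        exact (adj_sup_edge (h1 G' m'.1)).2 (Or.inr (Or.inl ⟨rfl, rfl⟩))
      rw [← m.2] at hH
      rcases (adj_sup_edge (h1 G m.1)).1 hH with h | ⟨-, h⟩ | ⟨h, -⟩
      · exact h
      · exact absurd h (hne G' G m' m hd.symm)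
      · exact absurd h (h1 G m.1)
  obtain ⟨e₁, a1, b1, c1⟩ := key G₁ m1
  obtain ⟨e₂, a2, b2, c2⟩ := key G₂ m2
  obtain ⟨e₃, a3, b3, c3⟩ := key G₃ m3
  exact three_half_planes a1 a2 a3 b1 (c1 _ m2 d12) (c1 _ m3 d13) (c2 _ m1 d12.symm) b2
    (c2 _ m3 d23) (c3 _ m1 d13.symm) (c3 _ m2 d23.symm) b3

end PlanarCycle

namespace PlanarCycle

variable {ι : Type*} {R : ι → ℂ}

/-! ### Polygons and cyclic lists -/

theorem path_eq_zip (a : ι) (l : List ι) (b : ι) : path a (l ++ [b]) = (a :: l).zip (l ++ [b]) := by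
  induction l generalizing a with
  | nil => rfl
  | cons c l ih => simp [path, ih]

theorem cyc_ofFn {k : ℕ} (c : Fin k → ι) :
    cyc (List.ofFn c) = List.ofFn fun i => (c i, c (finRotate k i)) := by
  cases k with
  | zero => rfl
  | succ k =>
    rw [List.ofFn_succ, cyc, path_eq_zip, ← List.ofFn_succ]
    apply List.ext_getElem
    · simp
    · intro i h1 h2
      simp only [List.getElem_zip, List.getElem_ofFn]
      congr 1
      simp at h2
      rw [List.getElem_append]
      split_ifs with h
      · simp at h
        simp only [List.getElem_ofFn]
        rw [finRotate_of_lt h]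
        rfl
      · simp at h
        obtain rfl : i = k := by omega
        simp only [List.getElem_singleton]
        rw [finRotate_last']
        rfl

theorem mem_cyc_ofFn {k : ℕ} {c : Fin k → ι} {x y : ι} :
    (x, y) ∈ cyc (List.ofFn c) ↔ ∃ i, c i = x ∧ c (finRotate k i) = y := by
  rw [cyc_ofFn, List.mem_ofFn]
  simp

theorem ratio_collinear {a b c : ℂ} (hab : a ≠ b) (h : cr (b - a) (c - a) = 0) :
    Collinear ℝ {a, b, c} := by
  rw [collinear_iff_of_mem (p₀ := a) (by simp)]
  have hv : b - a ≠ 0 := sub_ne_zero.2 hab.symm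
  refine ⟨b - a, ?_⟩
  simp only [Set.mem_insert_iff, Set.mem_singleton_iff]
  rintro p (rfl | rfl | rfl)
  · exact ⟨0, by simp⟩
  · exact ⟨1, by simp⟩
  · refine ⟨((p - a) / (b - a)).re, ?_⟩
    have hr : (p - a) / (b - a) = ((((p - a) / (b - a)).re : ℝ) : ℂ) := by
      apply Complex.ext
      · simp
      · rw [ratio_im, h]; simp
    rw [vadd_eq_add, Complex.real_smul, ← hr, div_mul_cancel₀ _ hv, sub_add_cancel]

end PlanarCycle

/-! ### Translation of polygons, faces and pseudo-triangulations into cyclic lists. -/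

namespace Polygon

open PlanarCycle

variable {n : ℕ}

theorem gp_vertices {R : Polygon ℂ n} (hR : R.IsSimple) (hgen : R.InGeneralPosition) :
    GP R.vertices where
  inj := hR.injective
  noncol i j k hij hik hjk h := hgen i j k hij hik hjk
    (ratio_collinear (hR.injective.ne hij) h)

theorem mem_edgeSet_trace (R : Polygon ℂ n) {k : ℕ} (c : Fin k → Fin n) (i : Fin k) :
    (R.trace c).edgeSet ℝ i = segment ℝ (R.vertices (c i)) (R.vertices (c (finRotate k i))) :=
  affineSegment_eq_segment ℝ _ _

theorem boundary_trace (R : Polygon ℂ n) {k : ℕ} (c : Fin k → Fin n) :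
    (R.trace c).boundary ℝ = bd R.vertices (List.ofFn c) := by
  ext z
  simp only [boundary, Set.mem_iUnion, mem_edgeSet_trace, bd, Set.mem_ofPred_eq, cyc_ofFn,
    List.mem_ofFn]
  simp

theorem windingAngle_trace (R : Polygon ℂ n) {k : ℕ} (c : Fin k → Fin n) (z : ℂ) :
    (R.trace c).windingAngle z = wind R.vertices (List.ofFn c) z := by
  rw [wind, cyc_ofFn, List.map_ofFn, List.sum_ofFn]
  rfl

theorem inside_trace (R : Polygon ℂ n) {k : ℕ} (c : Fin k → Fin n) :
    (R.trace c).inside = PlanarCycle.inside R.vertices (List.ofFn c) := by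
  ext z
  simp only [inside, PlanarCycle.inside, Set.mem_ofPred_eq, boundary_trace, windingAngle_trace]

theorem isSimple_trace {R : Polygon ℂ n} (hR : GP R.vertices) {k : ℕ} {c : Fin k → Fin n} :
    (R.trace c).IsSimple ↔ Simple R.vertices (List.ofFn c) := by
  constructor
  · intro h
    have hc : Function.Injective c := fun i j hij =>
      h.injective (show R.vertices (c i) = R.vertices (c j) by rw [hij])
    refine ⟨List.nodup_ofFn.2 hc, by simpa using h.three_le, ?_⟩
    intro a b d e h1 h2 n1 n2 n3 n4
    obtain ⟨i, rfl, rfl⟩ := mem_cyc_ofFn.1 h1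
    obtain ⟨j, rfl, rfl⟩ := mem_cyc_ofFn.1 h2
    rw [← mem_edgeSet_trace, ← mem_edgeSet_trace]
    exact h.nonconsecutive i j (fun h => n1 (by rw [h])) (fun h => n3 (by rw [← h]))
      fun h => n2 (by rw [← h])
  · intro h
    have hc : Function.Injective c := List.nodup_ofFn.1 h.nodup
    refine ⟨by simpa using h.three_le, fun i j hij => hc (hR.inj hij), fun i => ?_,
      fun i j n1 n2 n3 => ?_⟩
    · rw [mem_edgeSet_trace, mem_edgeSet_trace]
      have h1 : (c i, c (finRotate k i)) ∈ cyc (List.ofFn c) := mem_cyc_ofFn.2 ⟨i, rfl, rfl⟩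
      have h2 : (c (finRotate k i), c (finRotate k (finRotate k i))) ∈ cyc (List.ofFn c) :=
        mem_cyc_ofFn.2 ⟨_, rfl, rfl⟩
      ext z
      constructor
      · rintro ⟨hz, hz'⟩
        rw [segment_symm] at hz
        exact hR.inter_share (h.ne h1).symm (h.ne h2) (h.prev_ne_next h1 h2) hz hz'
      · rintro rfl
        exact ⟨right_mem_segment _ _ _, left_mem_segment _ _ _⟩
    · rw [mem_edgeSet_trace, mem_edgeSet_trace]
      by_cases n4 : finRotate k i = finRotate k j
      · exact absurd ((finRotate k).injective n4) n1
      · exact h.disjoint _ _ _ _ (mem_cyc_ofFn.2 ⟨i, rfl, rfl⟩) (mem_cyc_ofFn.2 ⟨j, rfl, rfl⟩)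
          (hc.ne n1) (hc.ne n3) (hc.ne (Ne.symm n2)) (hc.ne n4)

theorem eventually_iff_of_iff {P : ℝ → Prop} {Q : Prop}
    (h : ∀ᶠ ε : ℝ in 𝓝[>] 0, (P ε ↔ Q)) : (∀ᶠ ε : ℝ in 𝓝[>] 0, P ε) ↔ Q := by
  constructor
  · intro hP
    obtain ⟨ε, h1, h2⟩ := (h.and hP).exists
    exact h1.1 h2
  · exact fun hQ => h.mono fun ε hε => hε.2 hQ

/-- The sector vector has the same cross products with the edges as they have with each other. So it
tests exactly the sign of the turn, and its negative tests the opposite sign. -/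
theorem vertex_trace {R : Polygon ℂ n} (hR : GP R.vertices) (hgen : R.InGeneralPosition) {k : ℕ}
    {c : Fin k → Fin n} {σ : ℝ} (hL : Oriented R.vertices (List.ofFn c) σ) (i : Fin k) :
    ((R.trace c).IsConvexVertex i ↔ c i ∈ Corner R.vertices σ (List.ofFn c)) ∧
      ((R.trace c).IsReflexVertex i ↔ c i ∉ Corner R.vertices σ (List.ofFn c)) := by
  have hp : (c ((finRotate k).symm i), c i) ∈ cyc (List.ofFn c) :=
    mem_cyc_ofFn.2 ⟨_, rfl, by simp only [Equiv.apply_symm_apply]⟩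
  have hn : (c i, c (finRotate k i)) ∈ cyc (List.ofFn c) := mem_cyc_ofFn.2 ⟨_, rfl, rfl⟩
  have hnd : ¬(R.trace c).IsDegenerateVertex i :=
    hgen _ _ _ (hL.simple.ne hp) (hL.simple.prev_ne_next hp hn) (hL.simple.ne hn)
  have hk := hL.ori_ne hR hp hn
  rw [IsConvexVertex, IsReflexVertex, and_iff_right hnd, and_iff_right hnd, inside_trace,
    hL.simple.mem_corner hp hn]
  rw [ori_eq] at hk ⊢
  set n' := R.vertices (c (finRotate k i)) - R.vertices (c i) with hn'
  set p' := R.vertices (c ((finRotate k).symm i)) - R.vertices (c i) with hp'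
  have hs : (R.trace c).sectorVector i = p' + n' := rfl
  have hRi : (R.trace c).vertices i = R.vertices (c i) := rfl
  have hcr := right_ne_zero_of_mul hk
  have c1 : cr n' (p' + n') = cr n' p' := by rw [cr_add_right, cr_self, add_zero]
  have c2 : cr (p' + n') p' = cr n' p' := by simp [cr]; ring
  have o1 : OffRay n' (p' + n') := offRay_of_cr_ne_zero (by rwa [c1])
  have o2 : OffRay p' (p' + n') := offRay_of_cr_ne_zero (by rw [cr_swap, c2]; exact neg_ne_zero.2 hcr)
  have o3 : OffRay n' (-(p' + n')) := offRay_of_cr_ne_zero (by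
    rw [cr_neg_right, c1]; exact neg_ne_zero.2 hcr)
  have o4 : OffRay p' (-(p' + n')) := offRay_of_cr_ne_zero (by
    rw [cr_neg_right, cr_swap, c2, neg_neg]; exact hcr)
  rw [hs, hRi]
  constructor
  · apply eventually_iff_of_iff
    filter_upwards [hL.sector hR hp hn o1 o2] with ε hε
    rw [hε.2, InSec, c1, c2]
    constructor
    · rintro (h | ⟨h, h' | h'⟩)
      · exact h.1
      · exact h'
      · exact h'
    · exact fun h => Or.inl ⟨h, h, h⟩
  · apply eventually_iff_of_iff
    filter_upwards [hL.sector hR hp hn o3 o4] with ε hε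
    rw [sub_eq_add_neg, ← mul_neg, hε.2, InSec, cr_neg_right, cr_neg_left, c1, c2]
    constructor
    · rintro (h | ⟨h, -⟩)
      · linarith [h.2.1]
      · exact h.not_gt
    · intro h
      have := lt_of_le_of_ne (not_lt.1 h) hk
      exact Or.inr ⟨this, Or.inl (by linarith)⟩

theorem ncard_convex_trace {R : Polygon ℂ n} (hR : GP R.vertices) (hgen : R.InGeneralPosition)
    {k : ℕ} {c : Fin k → Fin n} {σ : ℝ} (hL : Oriented R.vertices (List.ofFn c) σ) :
    {i | (R.trace c).IsConvexVertex i}.ncard = (Corner R.vertices σ (List.ofFn c)).ncard := by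
  have hc : Function.Injective c := List.nodup_ofFn.1 hL.simple.nodup
  rw [← Set.ncard_image_of_injective _ hc]
  congr 1
  ext x
  constructor
  · rintro ⟨i, hi, rfl⟩
    exact (vertex_trace hR hgen hL i).1.1 hi
  · intro hx
    obtain ⟨i, rfl⟩ := (List.mem_ofFn).1 (corner_subset σ _ hx)
    exact ⟨i, (vertex_trace hR hgen hL i).1.2 hx, rfl⟩

theorem isPseudoTriangularFace_iff {R : Polygon ℂ n} (hR : GP R.vertices)
    (hgen : R.InGeneralPosition) {G : SimpleGraph (Fin n)} {k : ℕ} {c : Fin k → Fin n} :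
    R.IsPseudoTriangularFace G c ↔ Face R.vertices G (List.ofFn c) := by
  constructor
  · rintro ⟨h1, ⟨h2, h3⟩, h4⟩
    obtain ⟨σ, hσ⟩ := ((isSimple_trace hR).1 h2).oriented hR
    refine ⟨fun a b hab => ?_, ⟨σ, hσ, by rw [← ncard_convex_trace hR hgen hσ]; exact h3⟩, ?_⟩
    · obtain ⟨i, rfl, rfl⟩ := mem_cyc_ofFn.1 hab
      exact h1 i
    · rw [inside_trace] at h4; exact h4
  · rintro ⟨h1, ⟨σ, hσ, h3⟩, h4⟩
    refine ⟨fun i => h1 _ _ (mem_cyc_ofFn.2 ⟨i, rfl, rfl⟩), ⟨(isSimple_trace hR).2 hσ.simple, ?_⟩, ?_⟩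
    · rw [ncard_convex_trace hR hgen hσ]; exact h3
    · rw [inside_trace]; exact h4

theorem isPseudoTriangulation_iff {R : Polygon ℂ n} (hR : GP R.vertices)
    (hgen : R.InGeneralPosition) {G : SimpleGraph (Fin n)} :
    R.IsPseudoTriangulation G ↔ Subdivision R.vertices (List.ofFn id) G := by
  have hin : R.inside = PlanarCycle.inside R.vertices (List.ofFn id) := inside_trace R id
  constructor
  · intro h
    refine ⟨fun a b hab => ?_, h.nonCrossing, fun i j hij => ?_, fun z hz hzd => ?_⟩
    · obtain ⟨i, rfl, rfl⟩ := mem_cyc_ofFn.1 hab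
      exact h.boundary_adj i
    · by_cases h1 : j = finRotate n i
      · exact Or.inl (mem_cyc_ofFn.2 ⟨i, rfl, h1.symm⟩)
      by_cases h2 : i = finRotate n j
      · exact Or.inr (Or.inl (mem_cyc_ofFn.2 ⟨j, rfl, h2.symm⟩))
      · rw [← hin]; exact Or.inr (Or.inr (h.diagonal i j hij h1 h2))
    · rw [← hin] at hz
      obtain ⟨k, c, hc, hzc⟩ := h.subdivides z hz hzd
      exact ⟨_, (isPseudoTriangularFace_iff hR hgen).1 hc, by rw [← inside_trace]; exact hzc⟩
  · intro h
    refine ⟨fun i => h.boundary _ _ (mem_cyc_ofFn.2 ⟨i, rfl, rfl⟩), h.nonCrossing,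
      fun i j hij h1 h2 => ?_, fun z hz hzd => ?_⟩
    · rw [hin]
      rcases h.diagonal i j hij with h' | h' | h'
      · obtain ⟨x, rfl, rfl⟩ := mem_cyc_ofFn.1 h'
        exact absurd rfl h1
      · obtain ⟨x, rfl, rfl⟩ := mem_cyc_ofFn.1 h'
        exact absurd rfl h2
      · exact h'
    · rw [hin] at hz
      obtain ⟨L, hL, hzL⟩ := h.faces z hz hzd
      rw [← List.ofFn_get L] at hL hzL
      exact ⟨_, L.get, (isPseudoTriangularFace_iff hR hgen).2 hL, by rw [inside_trace]; exact hzL⟩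

/-! ### Pointed vertices -/

theorem cr_mul_mul (z a b : ℂ) : cr (z * a) (z * b) = Complex.normSq z * cr a b := by
  simp [cr, Complex.normSq_apply]; ring

theorem ccwAngle_mem (v a b : ℂ) : ccwAngle v a b ∈ Set.Ioc 0 (2 * Real.pi) := by
  have := toIocMod_mem_Ioc Real.two_pi_pos 0 (Complex.arg ((b - v) / (a - v)))
  rwa [zero_add] at this

theorem sin_ccwAngle_sub (v a b : ℂ) (φ : ℝ) :
    Real.sin (ccwAngle v a b - φ) = Real.sin (Complex.arg ((b - v) / (a - v)) - φ) := by
  rw [ccwAngle, toIocMod, zsmul_eq_mul, sub_right_comm, Real.sin_sub_int_mul_two_pi]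

/-- Measured from `a`, all edges have angles in `[θ, 2π]`, an interval shorter than `π`; `a` itself
has angle `2π` by the convention of `ccwAngle`. -/
theorem pointed_of_isPointed {R : Polygon ℂ n} (hR : GP R.vertices) {G : SimpleGraph (Fin n)}
    {v : Fin n} (h : R.IsPointed G v) : Pointed R.vertices G v := by
  obtain ⟨a, b, ha, hb, hmin, hpi⟩ := h
  set θ := ccwAngle (R v) (R a) (R b) with hθ
  -- For `θ > π` this `φ` satisfies `φ < θ` and `2π - φ < π`, so every edge direction is ahead of
  -- `φ` by an angle in `(0, π)`.
  set φ := (Real.pi + θ) / 2 with hφ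
  refine ⟨(R.vertices a - R.vertices v) * Complex.exp (φ * Complex.I), fun j hj => ?_⟩
  have ha0 : R.vertices a - R.vertices v ≠ 0 := sub_ne_zero.2 (hR.inj.ne ha.ne')
  have hj0 : R.vertices j - R.vertices v ≠ 0 := sub_ne_zero.2 (hR.inj.ne hj.ne')
  have e : R.vertices j - R.vertices v = (R.vertices a - R.vertices v) *
      ((R.vertices j - R.vertices v) / (R.vertices a - R.vertices v)) := by
    field_simp
  have h1 := hmin j hj
  have h2 := ccwAngle_mem (R v) (R a) (R j)
  have h3 := ccwAngle_mem (R v) (R a) (R b)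
  rw [e, cr_mul_mul]
  refine mul_pos (Complex.normSq_pos.2 ha0) ?_
  set r := (R.vertices j - R.vertices v) / (R.vertices a - R.vertices v) with hr
  have hr0 : r ≠ 0 := div_ne_zero hj0 ha0
  have hcr : cr (Complex.exp (φ * Complex.I)) r = ‖r‖ * Real.sin (Complex.arg r - φ) := by
    have h3 := Complex.norm_mul_cos_arg r
    have h4 := Complex.norm_mul_sin_arg r
    rw [cr, Real.sin_sub, Complex.exp_ofReal_mul_I_re, Complex.exp_ofReal_mul_I_im, ← h3, ← h4]
    ring
  rw [hcr, ← sin_ccwAngle_sub (R v) (R a) (R j) φ]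
  refine mul_pos (norm_pos_iff.2 hr0) (Real.sin_pos_of_pos_of_lt_pi ?_ ?_)
  · linarith
  · linarith [h2.2]

/-- Seen from the boundary direction `e` of the half plane, the arguments of all edges lie in `(0,
π)`. The gap from the largest to the smallest exceeds `π`; with a single edge both coincide and the
gap is the full turn. -/
theorem isPointed_of_pointed {R : Polygon ℂ n} {G : SimpleGraph (Fin n)}
    {v w : Fin n} (hw : G.Adj v w) (h : Pointed R.vertices G v) : R.IsPointed G v := by
  classical
  obtain ⟨e, he⟩ := h
  have he0 : e ≠ 0 := by rintro rfl; simpa [cr] using he w hw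
  set f : Fin n → ℝ := fun j => Complex.arg ((R.vertices j - R.vertices v) / e) with hf
  have hpos : ∀ j, G.Adj v j → 0 < f j ∧ f j < Real.pi := by
    intro j hj
    have him : 0 < ((R.vertices j - R.vertices v) / e).im := by
      rw [ratio_im]; exact div_pos (he j hj) (Complex.normSq_pos.2 he0)
    constructor
    · exact lt_of_le_of_ne (Complex.arg_nonneg_iff.2 him.le)
        fun h => him.ne' (Complex.arg_eq_zero_iff.1 h.symm).2
    · exact Complex.arg_lt_pi_iff.2 (Or.inr him.ne')
  set N : Finset (Fin n) := Finset.univ.filter (G.Adj v) with hN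
  have hmem : ∀ j, j ∈ N ↔ G.Adj v j := by simp [hN]
  have hne : N.Nonempty := ⟨w, (hmem w).2 hw⟩
  obtain ⟨a, haN, ha⟩ := N.exists_max_image f hne
  obtain ⟨b, hbN, hb⟩ := N.exists_min_image f hne
  rw [hmem] at haN hbN
  have hang : ∀ j, G.Adj v j → ccwAngle (R v) (R a) (R j) = f j - f a + 2 * Real.pi := by
    intro j hj
    have hja : f j ≤ f a := ha j ((hmem j).2 hj)
    have h1 := hpos j hj
    have h2 := hpos a haN
    have hj0 : (R.vertices j - R.vertices v) / e ≠ 0 := by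
      intro h; rw [hf] at h1; simp [h] at h1
    have ha0 : (R.vertices a - R.vertices v) / e ≠ 0 := by
      intro h; rw [hf] at h2; simp [h] at h2
    have hq : (R.vertices j - R.vertices v) / (R.vertices a - R.vertices v) =
        ((R.vertices j - R.vertices v) / e) / ((R.vertices a - R.vertices v) / e) := by
      rw [div_div_div_cancel_right₀ he0]
    have harg : Complex.arg ((R.vertices j - R.vertices v) / (R.vertices a - R.vertices v)) =
        f j - f a := by
      rw [hq, ← Real.Angle.toReal_coe_eq_self_iff_mem_Ioc.2 (Complex.arg_mem_Ioc _),
        Complex.arg_div_coe_angle hj0 ha0, ← Real.Angle.coe_sub,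
        Real.Angle.toReal_coe_eq_self_iff_mem_Ioc.2]
      constructor <;> simp only [hf] at * <;> linarith
    rw [ccwAngle]
    change toIocMod Real.two_pi_pos 0
      (Complex.arg ((R.vertices j - R.vertices v) / (R.vertices a - R.vertices v))) = _
    rw [harg]
    rw [toIocMod_eq_iff]
    refine ⟨⟨by linarith, by linarith⟩, -1, by simp⟩
  refine ⟨a, b, haN, hbN, fun j hj => ?_, ?_⟩
  · rw [hang b hbN, hang j hj]
    linarith [hb j ((hmem j).2 hj)]
  · rw [hang b hbN]
    linarith [hpos b hbN, hpos a haN]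

theorem PT_eq_subdivisions {R : Polygon ℂ n} (hR : GP R.vertices) (hgen : R.InGeneralPosition)
    {σ : ℝ} (hB : Oriented R.vertices (List.ofFn id) σ) (V : Finset (Fin n)) :
    R.PT V = subdivisions R.vertices σ (List.ofFn id) V := by
  ext G
  have hm : ∀ i : Fin n, i ∈ List.ofFn (id : Fin n → Fin n) := by simp
  simp only [PT, subdivisions, Set.mem_ofPred_eq, isPseudoTriangulation_iff hR hgen]
  refine and_congr_right fun hG => forall_congr' fun i => ?_
  have h1 : R.IsReflexVertex i ↔ i ∉ Corner R.vertices σ (List.ofFn id) :=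
    (vertex_trace (c := id) hR hgen hB i).2
  have h2 : R.IsPointed G i ↔ Pointed R.vertices G i := by
    obtain ⟨w, hw⟩ := exists_next (hm i)
    exact ⟨pointed_of_isPointed hR, isPointed_of_pointed (hG.boundary _ _ hw)⟩
  rw [h1, h2]
  simp [hm i]

end Polygon

theorem mainTheorem4 {n : ℕ} (R : Polygon ℂ n) (hR : R.IsSimple) (hgen : R.InGeneralPosition)
    (V : Finset (Fin n)) (hV : ∀ i ∈ V, R.IsReflexVertex i) (p₀ : Fin n) (hp₀ : p₀ ∈ V) :
    (R.PT V).ncard ≤ 2 * (R.PT (V \ {p₀})).ncard := by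
  have hGP := Polygon.gp_vertices hR hgen
  obtain ⟨σ, hB⟩ := ((Polygon.isSimple_trace (c := id) hGP).1 hR).oriented hGP
  rw [Polygon.PT_eq_subdivisions hGP hgen hB, Polygon.PT_eq_subdivisions hGP hgen hB]
  -- That `p₀` is reflex enters here, as the statement that it is no corner of the boundary list.
  have h := PlanarCycle.ncard_subdivisions_le (V := (V : Set (Fin n))) hGP hB (by simp)
    ((Polygon.vertex_trace (c := id) hGP hgen hB p₀).2.1 (hV p₀ hp₀)) hp₀
  rwa [Finset.coe_sdiff, Finset.coe_singleton]
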